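/- Fix an integer constant $c$. A histogram uncertain point $p$ is a random point of $\mathbb{R}$ whose probability density $f_p$ is a step function with at most $c$ pieces: there are breakpoints $x_0<x_1<\dots<x_k$ with $k+2\le c$ and heights $y_0,\dots,y_{k-1}\ge 0$ such that $f_p=y_j$ on $[x_j,x_{j+1})$ for $0\le j<k$, $f_p=0$ outside $[x_0,x_k)$, and $\int_{\mathbb{R}} f_p=1$. For an interval $I$ let $\Pr[p\in I]=\int_I f_p$. **Theorem.** On the real RAM (unit cost for arithmetic and comparisons on real numbers and on machine words of $O(\log n)$ bits, no rounding of reals) there are a preprocessing algorithm and a query algorithm, depending only on $c$, with the following property. For every $n\ge 1$ and all histogram uncertain points $p_1,\dots,p_n$ with at most $c$ pieces each, given by their breakpoints and heights, the preprocessing algorithm builds in $O(n\log (n+1))$ time a data structure that occupies $O(n)$ memory cells. Given only this data structure and any unbounded interval $I$ (that is, $I=(-\infty,b]$, $I=[a,\infty)$ or $I=(-\infty,\infty)$), the query algorithm answers the top-1 query on $I$ in $O(\log (n+1))$ time: it returns an index $i$ such that $\Pr[p_i\in I]\ge\Pr[p_j\in I]$ for all $1\le j\le n$. All times are deterministic worst-case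 bounds, and the constants hidden in the $O$-notation depend only on $c$. -/

import Mathlib

open MeasureTheory

/-! ### Uncertain points with histogram densities -/

/-- A histogram probability density on `ℝ` with at most `c` pieces. The `k` bounded pieces are
`[x j, x (j+1))` with heights `y j`; together with the two unbounded pieces, on which the density is
`0`, there are `k + 2` pieces. -/
structure Histogram (c : ℕ) where
  k : ℕ
  pieces_le : k + 2 ≤ c
  x : Fin (k + 1) → ℝ
  x_strictMono : StrictMono x
  y : Fin k → ℝ
  y_nonneg : ∀ j, 0 ≤ y j
  area_eq_one : ∑ j : Fin k, y j * (x j.succ - x j.castSucc) = 1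

namespace Histogram

/-- The density: `y j` on `[x j, x (j+1))`, and `0` outside all bounded pieces. -/
noncomputable def pdf {c : ℕ} (p : Histogram c) (t : ℝ) : ℝ :=
  ∑ j : Fin p.k, (Set.Ico (p.x j.castSucc) (p.x j.succ)).indicator (fun _ => p.y j) t

/-- The distribution of the uncertain point: `p.law I` is the probability `Pr[p ∈ I]`. -/
noncomputable def law {c : ℕ} (p : Histogram c) : Measure ℝ :=
  volume.withDensity (fun t => ENNReal.ofReal (p.pdf t))

end Histogram

/-- Unbounded query intervals: `(-∞, b]`, `[a, ∞)` and `(-∞, ∞)`. -/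
inductive UnboundedInterval where
  | atMost (b : ℝ)
  | atLeast (a : ℝ)
  | whole

namespace UnboundedInterval

def toSet : UnboundedInterval → Set ℝ
  | atMost b => Set.Iic b
  | atLeast a => Set.Ici a
  | whole => Set.univ

/-- How the kind of the interval is passed to a program. -/
def tag : UnboundedInterval → ℕ
  | atMost _ => 0
  | atLeast _ => 1
  | whole => 2

/-- The finite endpoint (`0` if there is none). -/
noncomputable def endpoint : UnboundedInterval → ℝ
  | atMost b => b
  | atLeast a => a
  | whole => 0

end UnboundedInterval

/-! ### The real RAM

Programs are finite and structured. A memory cell holds either one natural number (a machine word)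
or one real number. Every arithmetic operation, comparison, memory access and assignment has unit
cost. There is no rounding of reals and no other way to turn a real into a word. -/

namespace RealRAM

/-- Word registers `iv`, real registers `rv`, word arrays `ia` and real arrays `ra`
(`ia a i` is the cell with index `i` of the array with name `a`). -/
structure State where
  iv : ℕ → ℕ
  rv : ℕ → ℝ
  ia : ℕ → ℕ → ℕ
  ra : ℕ → ℕ → ℝ

/-- Word expressions. Names of registers and arrays are fixed in the program text; indices of array
cells are computed. Subtraction is truncated and division rounds down. -/
inductive IExp where
  | lit (k : ℕ)
  | reg (r : ℕ)
  | get (a : ℕ) (e : IExp)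
  | add (e₁ e₂ : IExp)
  | sub (e₁ e₂ : IExp)
  | mul (e₁ e₂ : IExp)
  | div (e₁ e₂ : IExp)

namespace IExp

def eval (s : State) : IExp → ℕ
  | lit k => k
  | reg r => s.iv r
  | get a e => s.ia a (e.eval s)
  | add e₁ e₂ => e₁.eval s + e₂.eval s
  | sub e₁ e₂ => e₁.eval s - e₂.eval s
  | mul e₁ e₂ => e₁.eval s * e₂.eval s
  | div e₁ e₂ => e₁.eval s / e₂.eval s

def cost : IExp → ℕ
  | lit _ => 1
  | reg _ => 1
  | get _ e => e.cost + 1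
  | add e₁ e₂ => e₁.cost + e₂.cost + 1
  | sub e₁ e₂ => e₁.cost + e₂.cost + 1
  | mul e₁ e₂ => e₁.cost + e₂.cost + 1
  | div e₁ e₂ => e₁.cost + e₂.cost + 1

end IExp

/-- Real expressions; the only constants are natural numbers. A quotient by `0` is `0`. -/
inductive RExp where
  | lit (k : ℕ)
  | reg (r : ℕ)
  | get (a : ℕ) (e : IExp)
  | add (e₁ e₂ : RExp)
  | sub (e₁ e₂ : RExp)
  | mul (e₁ e₂ : RExp)
  | div (e₁ e₂ : RExp)

namespace RExp

noncomputable def eval (s : State) : RExp → ℝ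
  | lit k => (k : ℝ)
  | reg r => s.rv r
  | get a e => s.ra a (e.eval s)
  | add e₁ e₂ => e₁.eval s + e₂.eval s
  | sub e₁ e₂ => e₁.eval s - e₂.eval s
  | mul e₁ e₂ => e₁.eval s * e₂.eval s
  | div e₁ e₂ => e₁.eval s / e₂.eval s

def cost : RExp → ℕ
  | lit _ => 1
  | reg _ => 1
  | get _ e => e.cost + 1
  | add e₁ e₂ => e₁.cost + e₂.cost + 1
  | sub e₁ e₂ => e₁.cost + e₂.cost + 1
  | mul e₁ e₂ => e₁.cost + e₂.cost + 1
  | div e₁ e₂ => e₁.cost + e₂.cost + 1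

end RExp

/-- Tests: comparisons of words (`ilt`, `ile`) and of reals (`rlt`, `rle`), negation, conjunction. -/
inductive Test where
  | ilt (e₁ e₂ : IExp)
  | ile (e₁ e₂ : IExp)
  | rlt (e₁ e₂ : RExp)
  | rle (e₁ e₂ : RExp)
  | not (b : Test)
  | and (b₁ b₂ : Test)

namespace Test

def holds (s : State) : Test → Prop
  | ilt e₁ e₂ => e₁.eval s < e₂.eval s
  | ile e₁ e₂ => e₁.eval s ≤ e₂.eval s
  | rlt e₁ e₂ => e₁.eval s < e₂.eval s
  | rle e₁ e₂ => e₁.eval s ≤ e₂.eval s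
  | not b => ¬ b.holds s
  | and b₁ b₂ => b₁.holds s ∧ b₂.holds s

def cost : Test → ℕ
  | ilt e₁ e₂ => e₁.cost + e₂.cost + 1
  | ile e₁ e₂ => e₁.cost + e₂.cost + 1
  | rlt e₁ e₂ => e₁.cost + e₂.cost + 1
  | rle e₁ e₂ => e₁.cost + e₂.cost + 1
  | not b => b.cost + 1
  | and b₁ b₂ => b₁.cost + b₂.cost + 1

end Test

/-- Programs. `iset`/`rset` assign to a register, `iput`/`rput` to the array cell whose index is the
value of `e`. -/
inductive Program where
  | skip
  | iset (r : ℕ) (v : IExp)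
  | rset (r : ℕ) (v : RExp)
  | iput (a : ℕ) (e : IExp) (v : IExp)
  | rput (a : ℕ) (e : IExp) (v : RExp)
  | seq (p q : Program)
  | ite (b : Test) (p q : Program)
  | loop (b : Test) (p : Program)

/-- `Exec W p s t s'`: started in state `s`, the program `p` halts in state `s'` after exactly `t`
steps, and every word that it stores is smaller than `W` (storing a larger one is a fault, from
which there is no execution). `loop b p` repeats `p` while `b` holds. -/
inductive Exec (W : ℕ) : Program → State → ℕ → State → Prop
  | skip (s : State) : Exec W .skip s 1 s
  | iset (r : ℕ) (v : IExp) (s : State) (h : v.eval s < W) :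
      Exec W (.iset r v) s (v.cost + 1) { s with iv := Function.update s.iv r (v.eval s) }
  | rset (r : ℕ) (v : RExp) (s : State) :
      Exec W (.rset r v) s (v.cost + 1) { s with rv := Function.update s.rv r (v.eval s) }
  | iput (a : ℕ) (e : IExp) (v : IExp) (s : State) (h : v.eval s < W) :
      Exec W (.iput a e v) s (e.cost + v.cost + 1)
        { s with
          ia := Function.update s.ia a (Function.update (s.ia a) (e.eval s) (v.eval s)) }
  | rput (a : ℕ) (e : IExp) (v : RExp) (s : State) :
      Exec W (.rput a e v) s (e.cost + v.cost + 1)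
        { s with
          ra := Function.update s.ra a (Function.update (s.ra a) (e.eval s) (v.eval s)) }
  | seq {p q : Program} {s s₁ s₂ : State} {t₁ t₂ : ℕ}
      (h₁ : Exec W p s t₁ s₁) (h₂ : Exec W q s₁ t₂ s₂) :
      Exec W (.seq p q) s (t₁ + t₂) s₂
  | iteTrue {b : Test} {p q : Program} {s s' : State} {t : ℕ}
      (hb : b.holds s) (h : Exec W p s t s') :
      Exec W (.ite b p q) s (b.cost + 1 + t) s'
  | iteFalse {b : Test} {p q : Program} {s s' : State} {t : ℕ}
      (hb : ¬ b.holds s) (h : Exec W q s t s') :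
      Exec W (.ite b p q) s (b.cost + 1 + t) s'
  | loopStop {b : Test} {p : Program} {s : State} (hb : ¬ b.holds s) :
      Exec W (.loop b p) s (b.cost + 1) s
  | loopStep {b : Test} {p : Program} {s s₁ s₂ : State} {t₁ t₂ : ℕ}
      (hb : b.holds s) (h₁ : Exec W p s t₁ s₁) (h₂ : Exec W (.loop b p) s₁ t₂ s₂) :
      Exec W (.loop b p) s (b.cost + 1 + t₁ + t₂) s₂

/-- Only the contents of the cells with index `< len` of the word arrays and of the real arrays with
name `< A` are kept; these are `2 * A * len` cells. Everything else is erased. -/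
def State.restrict (A len : ℕ) (s : State) : State where
  iv := fun _ => 0
  rv := fun _ => 0
  ia := fun a i => if a < A ∧ i < len then s.ia a i else 0
  ra := fun a i => if a < A ∧ i < len then s.ra a i else 0

end RealRAM

open RealRAM in
/-- The memory that holds the input `P`: word register `0` contains `n`, cell `i` of word array `0`
the number of bounded pieces of the `i`-th point, and its breakpoints and heights lie in the cells
`i * c, i * c + 1, …` of the real arrays `0` and `1`. All other cells contain `0`. -/
noncomputable def inputState {c n : ℕ} (P : Fin n → Histogram c) : State where
  iv := fun r => if r = 0 then n else 0
  rv := fun _ => 0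
  ia := fun a i => if h : a = 0 ∧ i < n then (P ⟨i, h.2⟩).k else 0
  ra := fun a q =>
    if h : q / c < n then
      let p := P ⟨q / c, h⟩
      if a = 0 then (if hj : q % c < p.k + 1 then p.x ⟨q % c, hj⟩ else 0)
      else if a = 1 then (if hj : q % c < p.k then p.y ⟨q % c, hj⟩ else 0)
      else 0
    else 0

open RealRAM in
/-- The memory `D` together with the query `I`: its kind in word register `0` and its finite endpoint
in real register `0`. -/
noncomputable def queryState (D : State) (I : UnboundedInterval) : State :=
  { D with
    iv := Function.update D.iv 0 I.tag
    rv := Function.update D.rv 0 I.endpoint }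

open RealRAM in
/-- The word register `0` contains the index of a point of `P` whose probability of lying in `I`
is the largest. -/
def IsTop1Answer {c n : ℕ} (P : Fin n → Histogram c) (I : UnboundedInterval) (s : State) : Prop :=
  ∃ i : Fin n, s.iv 0 = (i : ℕ) ∧ ∀ j : Fin n, (P j).law I.toSet ≤ (P i).law I.toSet

/-! Let `F_i` be the distribution function of `p_i`. A query `(-∞, b]` asks for the largest
`F_i(b)`, a query `[a, ∞)` for the largest `1 - F_i(a)`. If all breakpoints lie in `[lo, hi]` and `D
= hi - lo`, the functions `G_i(t) = F_i(t) - F_i(t - D)` encode both: `G_i(b) = F_i(b)` for `b ≤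
hi`, and `G_i(a + D) = 1 - F_i(a)` for `a ≥ lo`. Outside these ranges all probabilities are `1` and
every index is right. Each `G_i` (`Histogram.bump`) is nonnegative and piecewise linear with `2c`
breakpoints, and vanishes outside them. So the task is to find the highest of `N = 2cn` segments
above a given abscissa `x`.

Cut the sorted breakpoints into slabs of `S` consecutive ones, with `S` of order `log N`. A segment
above `x` either has an end in the slab of `x`, and then a scan of the functions owning the `S`
breakpoints finds it, or it passes over the whole slab and acts there as a full line. The upper
envelope of the passing lines is a list with increasing starts. The lists of all slabs,
concatenated, still have sorted starts, so one binary search finds the only line that matters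
(`SearchData.le_of_tried`).

Size. The envelopes of `2 ^ l` slabs have at most `4N + 2 ^ l * l` lines (`sum_card_envelope_le`,
`sum_envelope_le`). Of two lines visible in one slab, the steeper wins in all slabs further right,
and the flatter in all slabs further left, as long as the winner passes over them. Assign to a
segment the smallest dyadic block of slabs that contains both of its ends, and the midpoint of this
block. Among the segments of one dyadic level visible in a slab, all but at most one are visible
there for the first or the last time, either at all or on their side of the midpoint. This charges
each segment at most four times and leaves at most `l` uncharged lines per slab. Since `l ≤ S`, the
term `2 ^ l * l` is at most `2 ^ l * S ≤ 2N`.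

Time. A segment may pass over many slabs, so the slabs are refined along a binary tree. A segment
that passes over a node but not over its parent ends in the sibling (`Spans.parent_or`), so the node
is next to one of its ends. Hence the envelope of a node is that of the parent's envelope together
with a list to which each segment contributes at most twice per level. Distributing the segments in
the order of slopes keeps all lists sorted, and a merge with a stack builds each envelope in time
linear in its input. The size bound holds on every level whose nodes have at least `L ≈ log N`
ranks, and the refinement stops there. The total is `O(N log N)`.

The working tables of the construction are sparse and more than linear. Only the flat tables written
at the end are read by a query, and they fit into a prefix of linear length of finitely many arrays.
Programs are verified by Hoare triples with a time bound (`Tri`): loop bodies through weakest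
preconditions, loops through potentials. -/

namespace RealRAM

/-! ### Timed Hoare triples, frames and weakest preconditions. -/

namespace Program

/-- The word register `r` is assigned somewhere in the program. -/
def setsI (r : ℕ) : Program → Bool
  | iset r' _ => r == r'
  | seq p q => p.setsI r || q.setsI r
  | ite _ p q => p.setsI r || q.setsI r
  | loop _ p => p.setsI r
  | _ => false

/-- The real register `r` is assigned somewhere in the program. -/
def setsR (r : ℕ) : Program → Bool
  | rset r' _ => r == r'
  | seq p q => p.setsR r || q.setsR r
  | ite _ p q => p.setsR r || q.setsR r
  | loop _ p => p.setsR r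
  | _ => false

/-- The word array `a` is written somewhere in the program. -/
def putsI (a : ℕ) : Program → Bool
  | iput a' _ _ => a == a'
  | seq p q => p.putsI a || q.putsI a
  | ite _ p q => p.putsI a || q.putsI a
  | loop _ p => p.putsI a
  | _ => false

/-- The real array `a` is written somewhere in the program. -/
def putsR (a : ℕ) : Program → Bool
  | rput a' _ _ => a == a'
  | seq p q => p.putsR a || q.putsR a
  | ite _ p q => p.putsR a || q.putsR a
  | loop _ p => p.putsR a
  | _ => false

/-- An upper bound for the running time of a program without loops. -/
def maxCost : Program → ℕ
  | skip => 1
  | iset _ v => v.cost + 1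
  | rset _ v => v.cost + 1
  | iput _ e v => e.cost + v.cost + 1
  | rput _ e v => e.cost + v.cost + 1
  | seq p q => p.maxCost + q.maxCost
  | ite b p q => b.cost + 1 + (p.maxCost + q.maxCost)
  -- This value is never used, because `wp` of a loop is `False`.
  | loop _ _ => 0

/-- Weakest precondition of a program without loops. -/
def wp (W : ℕ) : Program → (State → Prop) → State → Prop
  | skip, Q, s => Q s
  | iset r v, Q, s =>
      v.eval s < W ∧ Q { s with iv := Function.update s.iv r (v.eval s) }
  | rset r v, Q, s => Q { s with rv := Function.update s.rv r (v.eval s) }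
  | iput a e v, Q, s => v.eval s < W ∧ Q { s with
      ia := Function.update s.ia a (Function.update (s.ia a) (e.eval s) (v.eval s)) }
  | rput a e v, Q, s => Q { s with
      ra := Function.update s.ra a (Function.update (s.ra a) (e.eval s) (v.eval s)) }
  | seq p q, Q, s => wp W p (wp W q Q) s
  | ite b p q, Q, s => (b.holds s → wp W p Q s) ∧ (¬ b.holds s → wp W q Q s)
  | loop _ _, _, _ => False

end Program

/-- `s'` agrees with `s` on everything that `p` does not assign. -/
structure Frame (p : Program) (s s' : State) : Prop where
  iv : ∀ r, p.setsI r = false → s'.iv r = s.iv r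
  rv : ∀ r, p.setsR r = false → s'.rv r = s.rv r
  ia : ∀ a, p.putsI a = false → s'.ia a = s.ia a
  ra : ∀ a, p.putsR a = false → s'.ra a = s.ra a

theorem Frame.refl (p : Program) (s : State) : Frame p s s :=
  ⟨fun _ _ => rfl, fun _ _ => rfl, fun _ _ => rfl, fun _ _ => rfl⟩

theorem Frame.trans {p : Program} {s₁ s₂ s₃ : State} (h : Frame p s₁ s₂) (h' : Frame p s₂ s₃) :
    Frame p s₁ s₃ :=
  ⟨fun r hr => (h'.iv r hr).trans (h.iv r hr), fun r hr => (h'.rv r hr).trans (h.rv r hr),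
   fun r hr => (h'.ia r hr).trans (h.ia r hr), fun r hr => (h'.ra r hr).trans (h.ra r hr)⟩

theorem Frame.of_imp {p q : Program} {s s' : State} (h : Frame p s s')
    (h₁ : ∀ r, q.setsI r = false → p.setsI r = false)
    (h₂ : ∀ r, q.setsR r = false → p.setsR r = false)
    (h₃ : ∀ r, q.putsI r = false → p.putsI r = false)
    (h₄ : ∀ r, q.putsR r = false → p.putsR r = false) : Frame q s s' :=
  ⟨fun r hr => h.iv r (h₁ r hr), fun r hr => h.rv r (h₂ r hr),
   fun r hr => h.ia r (h₃ r hr), fun r hr => h.ra r (h₄ r hr)⟩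

theorem Exec.frame {W : ℕ} {p : Program} {s s' : State} {t : ℕ} (h : Exec W p s t s') :
    Frame p s s' := by
  induction h with
  | skip => exact Frame.refl _ _
  | iset r v s h =>
    refine ⟨fun r' hr => ?_, fun _ _ => rfl, fun _ _ => rfl, fun _ _ => rfl⟩
    simp only [Program.setsI, beq_eq_false_iff_ne] at hr
    exact Function.update_of_ne hr _ _
  | rset r v s =>
    refine ⟨fun _ _ => rfl, fun r' hr => ?_, fun _ _ => rfl, fun _ _ => rfl⟩
    simp only [Program.setsR, beq_eq_false_iff_ne] at hr
    exact Function.update_of_ne hr _ _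
  | iput a e v s h =>
    refine ⟨fun _ _ => rfl, fun _ _ => rfl, fun r' hr => ?_, fun _ _ => rfl⟩
    simp only [Program.putsI, beq_eq_false_iff_ne] at hr
    exact Function.update_of_ne hr _ _
  | rput a e v s =>
    refine ⟨fun _ _ => rfl, fun _ _ => rfl, fun _ _ => rfl, fun r' hr => ?_⟩
    simp only [Program.putsR, beq_eq_false_iff_ne] at hr
    exact Function.update_of_ne hr _ _
  | seq h₁ h₂ ih₁ ih₂ =>
    refine (ih₁.of_imp ?_ ?_ ?_ ?_).trans (ih₂.of_imp ?_ ?_ ?_ ?_) <;>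
      simp +contextual [Program.setsI, Program.setsR, Program.putsI, Program.putsR]
  | iteTrue hb h ih =>
    refine ih.of_imp ?_ ?_ ?_ ?_ <;>
      simp +contextual [Program.setsI, Program.setsR, Program.putsI, Program.putsR]
  | iteFalse hb h ih =>
    refine ih.of_imp ?_ ?_ ?_ ?_ <;>
      simp +contextual [Program.setsI, Program.setsR, Program.putsI, Program.putsR]
  | loopStop hb => exact Frame.refl _ _
  | loopStep hb h₁ h₂ ih₁ ih₂ =>
    refine (ih₁.of_imp ?_ ?_ ?_ ?_).trans ih₂ <;>
      simp [Program.setsI, Program.setsR, Program.putsI, Program.putsR]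

/-- Started in `s`, the program `p` halts within `T` steps in a state that satisfies `Q`. -/
def Tri (W : ℕ) (p : Program) (s : State) (T : ℕ) (Q : State → Prop) : Prop :=
  ∃ t s', Exec W p s t s' ∧ t ≤ T ∧ Q s'

theorem Tri.mono {W : ℕ} {p : Program} {s : State} {T T' : ℕ} {Q Q' : State → Prop}
    (h : Tri W p s T Q) (hT : T ≤ T') (hQ : ∀ s', Frame p s s' → Q s' → Q' s') :
    Tri W p s T' Q' := by
  obtain ⟨t, s', he, ht, hq⟩ := h
  exact ⟨t, s', he, ht.trans hT, hQ _ he.frame hq⟩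

/-- The continuation also receives the frame of the first program, so values that it does not assign
need not be carried through `R`. -/
theorem Tri.seq {W : ℕ} {p q : Program} {s : State} {T₁ T₂ : ℕ} {R Q : State → Prop}
    (h : Tri W p s T₁ R) (h' : ∀ s', Frame p s s' → R s' → Tri W q s' T₂ Q) :
    Tri W (.seq p q) s (T₁ + T₂) Q := by
  obtain ⟨t, s₁, he, ht, hr⟩ := h
  obtain ⟨t₂, s₂, he₂, ht₂, hq⟩ := h' s₁ he.frame hr
  exact ⟨_, _, .seq he he₂, by omega, hq⟩

theorem Tri.of_wp {W : ℕ} {p : Program} {Q : State → Prop} {s : State} (h : p.wp W Q s) :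
    Tri W p s p.maxCost Q := by
  induction p generalizing Q s with
  | skip => exact ⟨_, _, .skip s, le_rfl, h⟩
  | iset r v => exact ⟨_, _, .iset r v s h.1, le_rfl, h.2⟩
  | rset r v => exact ⟨_, _, .rset r v s, le_rfl, h⟩
  | iput a e v => exact ⟨_, _, .iput a e v s h.1, le_rfl, h.2⟩
  | rput a e v => exact ⟨_, _, .rput a e v s, le_rfl, h⟩
  | seq p q ihp ihq => exact (ihp h).seq fun s' _ hs' => ihq hs'
  | ite b p q ihp ihq =>
    by_cases hb : b.holds s
    · obtain ⟨t, s', he, ht, hq⟩ := ihp (h.1 hb)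
      exact ⟨_, _, .iteTrue hb he, by simp only [Program.maxCost]; omega, hq⟩
    · obtain ⟨t, s', he, ht, hq⟩ := ihq (h.2 hb)
      exact ⟨_, _, .iteFalse hb he, by simp only [Program.maxCost]; omega, hq⟩
  | loop b p => exact h.elim

theorem Program.wp_mono {W : ℕ} {p : Program} {Q Q' : State → Prop} {s : State} (h : p.wp W Q s)
    (hQ : ∀ s', Q s' → Q' s') : p.wp W Q' s := by
  induction p generalizing Q Q' s with
  | skip => exact hQ _ h
  | iset r v => exact ⟨h.1, hQ _ h.2⟩
  | rset r v => exact hQ _ h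
  | iput a e v => exact ⟨h.1, hQ _ h.2⟩
  | rput a e v => exact hQ _ h
  | seq p q ihp ihq => exact ihp h fun s' h' => ihq h' hQ
  | ite b p q ihp ihq => exact ⟨fun hb => ihp (h.1 hb) hQ, fun hb => ihq (h.2 hb) hQ⟩
  | loop b p => exact h.elim

theorem Frame.seq {p q : Program} {s₁ s₂ s₃ : State} (h : Frame p s₁ s₂) (h' : Frame q s₂ s₃) :
    Frame (.seq p q) s₁ s₃ := by
  refine (h.of_imp ?_ ?_ ?_ ?_).trans (h'.of_imp ?_ ?_ ?_ ?_) <;>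
    simp +contextual [Program.setsI, Program.setsR, Program.putsI, Program.putsR]

theorem Program.wp_frame {W : ℕ} {p : Program} {Q : State → Prop} {s : State} (h : p.wp W Q s) :
    p.wp W (fun s' => Frame p s s' ∧ Q s') s := by
  induction p generalizing Q s with
  | skip => exact ⟨Frame.refl _ _, h⟩
  | iset r v => exact ⟨h.1, (Exec.iset r v s h.1).frame, h.2⟩
  | rset r v => exact ⟨(Exec.rset (W := W) r v s).frame, h⟩
  | iput a e v => exact ⟨h.1, (Exec.iput a e v s h.1).frame, h.2⟩
  | rput a e v => exact ⟨(Exec.rput (W := W) a e v s).frame, h⟩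
  | seq p q ihp ihq =>
    change p.wp W (q.wp W fun s' => Frame (.seq p q) s s' ∧ Q s') s
    exact Program.wp_mono (ihp h) fun s' h' => Program.wp_mono (ihq h'.2) fun s'' h'' =>
      ⟨h'.1.seq h''.1, h''.2⟩
  | ite b p q ihp ihq =>
    refine ⟨fun hb => Program.wp_mono (ihp (h.1 hb)) fun s' h' => ⟨h'.1.of_imp ?_ ?_ ?_ ?_, h'.2⟩,
      fun hb => Program.wp_mono (ihq (h.2 hb)) fun s' h' => ⟨h'.1.of_imp ?_ ?_ ?_ ?_, h'.2⟩⟩ <;>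
      simp +contextual [Program.setsI, Program.setsR, Program.putsI, Program.putsR]
  | loop b p => exact h.elim

/-- Loops: each iteration is paid by a decrease of the potential `Φ`. -/
theorem Tri.loop_potential {W : ℕ} {b : Test} {p : Program} {s₀ : State} (I : State → Prop)
    (Φ : State → ℕ) (h₀ : I s₀)
    (h : ∀ s, Frame p s₀ s → I s → b.holds s →
      ∃ T, Tri W p s T fun s' => I s' ∧ T + b.cost + 1 + Φ s' ≤ Φ s) :
    Tri W (.loop b p) s₀ (Φ s₀ + b.cost + 1) fun s' => I s' ∧ ¬ b.holds s' := by
  have key : ∀ m : ℕ, ∀ s, Frame p s₀ s → I s → Φ s ≤ m →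
      Tri W (.loop b p) s (Φ s + b.cost + 1) fun s' => I s' ∧ ¬ b.holds s' := by
    intro m
    induction m with
    | zero =>
      intro s hF hI hm
      by_cases hb : b.holds s
      · obtain ⟨T, t, s', -, -, -, hΦ⟩ := h s hF hI hb
        omega
      · exact ⟨_, _, .loopStop hb, by omega, hI, hb⟩
    | succ m ih =>
      intro s hF hI hm
      by_cases hb : b.holds s
      · obtain ⟨T, t, s₁, he, ht, hI', hΦ⟩ := h s hF hI hb
        obtain ⟨t₂, s₂, he₂, ht₂, hq⟩ := ih s₁ (hF.trans he.frame) hI' (by omega)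
        exact ⟨_, _, .loopStep hb he he₂, by omega, hq⟩
      · exact ⟨_, _, .loopStop hb, by omega, hI, hb⟩
  exact key _ s₀ (Frame.refl _ _) h₀ le_rfl

/-- The time for one iteration of a loop whose body has no loops. -/
def iterCost (b : Test) (p : Program) : ℕ := p.maxCost + b.cost + 1

/-- Loops whose body has no loops: the measure `Φ` bounds the number of iterations. -/
theorem Tri.loop {W : ℕ} {b : Test} {p : Program} {s₀ : State} (I : State → Prop)
    (Φ : State → ℕ) (h₀ : I s₀)
    (h : ∀ s, Frame p s₀ s → I s → b.holds s → p.wp W (fun s' => I s' ∧ Φ s' < Φ s) s) :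
    Tri W (.loop b p) s₀ ((Φ s₀ + 1) * iterCost b p) fun s' => I s' ∧ ¬ b.holds s' := by
  refine (Tri.loop_potential I (fun s => Φ s * iterCost b p) h₀ fun s hF hI hb =>
    ⟨_, (Tri.of_wp (h s hF hI hb)).mono le_rfl fun s' _ hs' => ⟨hs'.1, ?_⟩⟩).mono ?_
      fun s' _ hs' => hs'
  · have h2 : (Φ s' + 1) * iterCost b p ≤ Φ s * iterCost b p := Nat.mul_le_mul_right _ hs'.2
    have h3 : iterCost b p = p.maxCost + b.cost + 1 := rfl
    rw [Nat.add_mul, one_mul] at h2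
    omega
  · have h3 : iterCost b p = p.maxCost + b.cost + 1 := rfl
    rw [Nat.add_mul, one_mul]
    omega

/-- Loops in which the word register `r` counts up to the value `N` of the word register `r'`. -/
theorem Tri.count_loop {W : ℕ} {r r' N : ℕ} {p : Program} {s₀ : State} (J : ℕ → State → Prop)
    (hr : s₀.iv r = 0) (hr' : s₀.iv r' = N) (hp : p.setsI r' = false) (h₀ : J 0 s₀)
    (h : ∀ k < N, ∀ s, Frame p s₀ s → s.iv r = k → s.iv r' = N → J k s →
      p.wp W (fun s' => s'.iv r = k + 1 ∧ J (k + 1) s') s) :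
    Tri W (.loop (.ilt (.reg r) (.reg r')) p) s₀
      ((N + 1) * iterCost (.ilt (.reg r) (.reg r')) p) (J N) := by
  refine (Tri.loop (fun s => s.iv r ≤ N ∧ J (s.iv r) s) (fun s => N - s.iv r)
    ⟨by omega, by rwa [hr]⟩ fun s hF hI hb => ?_).mono (Nat.mul_le_mul_right _ (by omega))
    fun s' f' hs' => ?_
  · have hN : s.iv r' = N := (hF.iv r' hp).trans hr'
    simp only [Test.holds, IExp.eval, hN] at hb
    refine Program.wp_mono (h _ hb s hF rfl hN hI.2) fun s' hs' => ?_
    rw [hs'.1]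
    exact ⟨⟨hb, hs'.2⟩, by omega⟩
  · obtain ⟨⟨h1, h2⟩, hb⟩ := hs'
    simp only [Test.holds, IExp.eval, (f'.iv r' hp).trans hr', not_lt] at hb
    rwa [le_antisymm h1 hb] at h2

end RealRAM

/-! ### Distribution functions and the combined function for both kinds of queries. -/

namespace Histogram

variable {c : ℕ} (p : Histogram c)

/-- The cumulative distribution function as a finite sum. -/
noncomputable def cdf (t : ℝ) : ℝ :=
  ∑ j : Fin p.k, p.y j * (min (max t (p.x j.castSucc)) (p.x j.succ) - p.x j.castSucc)

theorem x_lt (j : Fin p.k) : p.x j.castSucc < p.x j.succ :=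
  p.x_strictMono Fin.castSucc_lt_succ

theorem law_eq_sum {I : Set ℝ} (hI : MeasurableSet I) :
    p.law I = ∑ j : Fin p.k, ENNReal.ofReal (p.y j) *
      volume (Set.Ico (p.x j.castSucc) (p.x j.succ) ∩ I) := by
  have h1 : ∀ t, ENNReal.ofReal (p.pdf t) = ∑ j : Fin p.k,
      (Set.Ico (p.x j.castSucc) (p.x j.succ)).indicator (fun _ => ENNReal.ofReal (p.y j)) t := by
    intro t
    rw [pdf, ENNReal.ofReal_sum_of_nonneg]
    · refine Finset.sum_congr rfl fun j _ => ?_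
      by_cases h : t ∈ Set.Ico (p.x j.castSucc) (p.x j.succ) <;> simp [h]
    · exact fun j _ => Set.indicator_nonneg (fun _ _ => p.y_nonneg j) _
  rw [law, withDensity_apply _ hI]
  simp_rw [h1]
  rw [lintegral_finsetSum]
  · refine Finset.sum_congr rfl fun j _ => ?_
    rw [lintegral_indicator measurableSet_Ico, lintegral_const, Measure.restrict_restrict
      measurableSet_Ico]
    simp
  · exact fun j _ => measurable_const.indicator measurableSet_Ico

theorem volume_Ico_inter_Iic {a b t : ℝ} (h : a < b) :
    volume (Set.Ico a b ∩ Set.Iic t) = ENNReal.ofReal (min (max t a) b - a) := by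
  rcases lt_or_ge t b with hb | hb
  · have : Set.Ico a b ∩ Set.Iic t = Set.Icc a t := by
      ext z; simp only [Set.mem_inter_iff, Set.mem_Ico, Set.mem_Iic, Set.mem_Icc]
      exact ⟨fun hz => ⟨hz.1.1, hz.2⟩, fun hz => ⟨⟨hz.1, hz.2.trans_lt hb⟩, hz.2⟩⟩
    rw [this, Real.volume_Icc]
    rcases le_total t a with ha | ha
    · rw [max_eq_right ha, min_eq_left h.le, sub_self, ENNReal.ofReal_zero,
        ENNReal.ofReal_of_nonpos (by linarith)]
    · rw [max_eq_left ha, min_eq_left hb.le]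
  · have : Set.Ico a b ∩ Set.Iic t = Set.Ico a b :=
      Set.inter_eq_left.2 fun z hz => hz.2.le.trans hb
    rw [this, Real.volume_Ico, min_eq_right (le_max_of_le_left hb)]

theorem volume_Ico_inter_Ici (a b t : ℝ) :
    volume (Set.Ico a b ∩ Set.Ici t) = ENNReal.ofReal (b - min (max t a) b) := by
  have : Set.Ico a b ∩ Set.Ici t = Set.Ico (max t a) b := by
    ext z; simp only [Set.mem_inter_iff, Set.mem_Ico, Set.mem_Ici, max_le_iff]; tauto
  rw [this, Real.volume_Ico]
  rcases le_total (max t a) b with hb | hb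
  · rw [min_eq_left hb]
  · rw [min_eq_right hb, sub_self, ENNReal.ofReal_zero, ENNReal.ofReal_of_nonpos (by linarith)]

theorem clamp_nonneg {a b t : ℝ} (h : a < b) : 0 ≤ min (max t a) b - a :=
  sub_nonneg.2 (le_min (le_max_right _ _) h.le)

theorem law_Iic (t : ℝ) : p.law (Set.Iic t) = ENNReal.ofReal (p.cdf t) := by
  rw [p.law_eq_sum measurableSet_Iic, cdf, ENNReal.ofReal_sum_of_nonneg]
  · refine Finset.sum_congr rfl fun j _ => ?_
    rw [volume_Ico_inter_Iic (p.x_lt j), ENNReal.ofReal_mul (p.y_nonneg j)]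
  · exact fun j _ => mul_nonneg (p.y_nonneg j) (clamp_nonneg (p.x_lt j))

theorem law_Ici (t : ℝ) : p.law (Set.Ici t) = ENNReal.ofReal (1 - p.cdf t) := by
  have h : 1 - p.cdf t = ∑ j : Fin p.k, p.y j *
      (p.x j.succ - min (max t (p.x j.castSucc)) (p.x j.succ)) := by
    rw [cdf, ← p.area_eq_one, ← Finset.sum_sub_distrib]
    exact Finset.sum_congr rfl fun j _ => by ring
  rw [p.law_eq_sum measurableSet_Ici, h, ENNReal.ofReal_sum_of_nonneg]
  · refine Finset.sum_congr rfl fun j _ => ?_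
    rw [volume_Ico_inter_Ici, ENNReal.ofReal_mul (p.y_nonneg j)]
  · exact fun j _ => mul_nonneg (p.y_nonneg j) (sub_nonneg.2 (min_le_right _ _))

theorem law_univ : p.law Set.univ = 1 := by
  rw [p.law_eq_sum MeasurableSet.univ, ← ENNReal.ofReal_one, ← p.area_eq_one,
    ENNReal.ofReal_sum_of_nonneg]
  · refine Finset.sum_congr rfl fun j _ => ?_
    rw [Set.inter_univ, Real.volume_Ico, ENNReal.ofReal_mul (p.y_nonneg j)]
  · exact fun j _ => mul_nonneg (p.y_nonneg j) (sub_nonneg.2 (p.x_lt j).le)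

theorem cdf_mono : Monotone p.cdf := fun _ _ h =>
  Finset.sum_le_sum fun j _ => mul_le_mul_of_nonneg_left
    (sub_le_sub_right (min_le_min_right _ (max_le_max_right _ h)) _) (p.y_nonneg j)

/-- The breakpoints, with the last one repeated forever. -/
def pt (j : ℕ) : ℝ := p.x ⟨min j p.k, by omega⟩

/-- The heights, followed by zeros. -/
def ht (j : ℕ) : ℝ := if h : j < p.k then p.y ⟨j, h⟩ else 0

theorem pt_mono : Monotone p.pt := fun i j h =>
  p.x_strictMono.monotone (Fin.mk_le_mk.2 (by omega))

theorem x_castSucc (j : Fin p.k) : p.x j.castSucc = p.pt j :=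
  congrArg p.x (Fin.ext (by simp [j.2.le]))

theorem x_succ (j : Fin p.k) : p.x j.succ = p.pt (j + 1) :=
  congrArg p.x (Fin.ext (by simp))

theorem pt_of_le {j : ℕ} (h : p.k ≤ j) : p.pt j = p.pt p.k :=
  congrArg p.x (Fin.ext (by simp [h]))

theorem cdf_of_le {t : ℝ} (h : t ≤ p.pt 0) : p.cdf t = 0 := by
  refine Finset.sum_eq_zero fun j _ => ?_
  have h1 : t ≤ p.x j.castSucc := h.trans ((p.pt_mono (Nat.zero_le _)).trans_eq (p.x_castSucc j).symm)
  rw [max_eq_right h1, min_eq_left (p.x_lt j).le, sub_self, mul_zero]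

theorem cdf_of_ge {t : ℝ} (h : p.pt p.k ≤ t) : p.cdf t = 1 := by
  rw [cdf, ← p.area_eq_one]
  refine Finset.sum_congr rfl fun j _ => ?_
  have h1 : p.x j.succ ≤ t := ((p.x_succ j).trans_le (p.pt_mono (by omega))).trans h
  rw [min_eq_right (le_max_of_le_left h1)]

theorem cdf_nonneg (t : ℝ) : 0 ≤ p.cdf t :=
  Finset.sum_nonneg fun j _ => mul_nonneg (p.y_nonneg j) (clamp_nonneg (p.x_lt j))

theorem cdf_le_one (t : ℝ) : p.cdf t ≤ 1 :=
  (p.cdf_mono (le_max_left t (p.pt p.k))).trans_eq (p.cdf_of_ge (le_max_right _ _))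

/-- Between `pt j` and `t` only the summand of the piece `j` changes: the clamps of earlier pieces
are saturated and those of later pieces are still at their left ends. For `j ≥ k` the padded
interval is a single point. -/
theorem cdf_affine (j : ℕ) {t : ℝ} (h₁ : p.pt j ≤ t) (h₂ : t ≤ p.pt (j + 1)) :
    p.cdf t = p.cdf (p.pt j) + p.ht j * (t - p.pt j) := by
  by_cases hj : j < p.k
  · have h3 : ∀ i : Fin p.k,
        p.y i * (min (max t (p.x i.castSucc)) (p.x i.succ) - p.x i.castSucc) =
        p.y i * (min (max (p.pt j) (p.x i.castSucc)) (p.x i.succ) - p.x i.castSucc) +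
          if i = ⟨j, hj⟩ then p.y i * (t - p.pt j) else 0 := by
      intro i
      rw [x_castSucc, x_succ]
      have hi : p.pt i ≤ p.pt (i + 1) := p.pt_mono (by omega)
      rcases lt_trichotomy (i : ℕ) j with h | h | h
      · have h4 : p.pt (i + 1) ≤ p.pt j := p.pt_mono (by omega)
        rw [if_neg (fun h' => by rw [h'] at h; exact lt_irrefl _ h),
          min_eq_right (le_max_of_le_left (h4.trans h₁)), min_eq_right (le_max_of_le_left h4),
          add_zero]
      · rw [if_pos (Fin.ext h), h, max_eq_left h₁, max_self, min_eq_left h₂,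
          min_eq_left (h₁.trans h₂)]
        ring
      · have h4 : p.pt (j + 1) ≤ p.pt i := p.pt_mono (by omega)
        rw [if_neg (fun h' => by rw [h'] at h; exact lt_irrefl _ h), max_eq_right (h₂.trans h4),
          max_eq_right ((h₁.trans h₂).trans h4), add_zero]
    rw [cdf, Finset.sum_congr rfl fun i _ => h3 i, Finset.sum_add_distrib, ← cdf]
    simp [ht, hj]
  · rw [not_lt] at hj
    rw [p.pt_of_le (by omega : p.k ≤ j + 1)] at h₂
    rw [p.pt_of_le hj] at h₁ ⊢
    rw [le_antisymm h₂ h₁, sub_self, mul_zero, add_zero]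

theorem cdf_pt_succ (j : ℕ) :
    p.cdf (p.pt (j + 1)) = p.cdf (p.pt j) + p.ht j * (p.pt (j + 1) - p.pt j) :=
  p.cdf_affine j (p.pt_mono (by omega)) le_rfl

/-- The distribution function, followed at distance `D` by its reversal. -/
noncomputable def bump (D t : ℝ) : ℝ := p.cdf t - p.cdf (t - D)

/-- The breakpoints of `bump`. -/
def bumpPt (D : ℝ) (j : ℕ) : ℝ := if j < c then p.pt j else p.pt (j - c) + D

/-- The values of `bump` at its breakpoints. -/
noncomputable def bumpVal (j : ℕ) : ℝ :=
  if j < c then p.cdf (p.pt j) else 1 - p.cdf (p.pt (j - c))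

theorem k_lt : p.k + 1 < c := p.pieces_le

variable {D : ℝ}

theorem bump_nonneg (hD : 0 ≤ D) (t : ℝ) : 0 ≤ p.bump D t :=
  sub_nonneg.2 (p.cdf_mono (by linarith))

theorem bump_of_le {t : ℝ} (h : t ≤ p.pt 0 + D) : p.bump D t = p.cdf t := by
  rw [bump, p.cdf_of_le (by linarith : t - D ≤ p.pt 0), sub_zero]

theorem bump_of_ge {t : ℝ} (h : p.pt p.k ≤ t) : p.bump D t = 1 - p.cdf (t - D) := by
  rw [bump, p.cdf_of_ge h]

/-- The three cases are the ascent along `cdf`, the plateau of height `1` from the last breakpoint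
to `pt 0 + D`, and the descent. The hypothesis on `D` says that the descent does not begin before
the ascent has ended. -/
theorem bump_affine (hD : p.pt p.k ≤ p.pt 0 + D) (j : ℕ) :
    ∃ σ, ∀ t, p.bumpPt D j ≤ t → t ≤ p.bumpPt D (j + 1) →
      p.bump D t = p.bumpVal j + σ * (t - p.bumpPt D j) := by
  have hk := p.k_lt
  rcases lt_trichotomy (j + 1) c with h | h | h
  · have hj' : j < c := by omega
    refine ⟨p.ht j, fun t h₁ h₂ => ?_⟩
    rw [bumpPt, if_pos hj'] at h₁ ⊢
    rw [bumpPt, if_pos h] at h₂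
    rw [bumpVal, if_pos hj', p.bump_of_le, p.cdf_affine j h₁ h₂]
    have : p.pt (j + 1) ≤ p.pt p.k := by
      rw [← p.pt_of_le (le_max_right (j + 1) p.k)]; exact p.pt_mono (le_max_left _ _)
    linarith
  · have hj' : j < c := by omega
    refine ⟨0, fun t h₁ h₂ => ?_⟩
    rw [bumpPt, if_pos hj', p.pt_of_le (by omega : p.k ≤ j)] at h₁
    rw [bumpPt, if_neg (by omega), h, Nat.sub_self] at h₂
    rw [bumpVal, if_pos hj', p.bump_of_le h₂, p.cdf_of_ge h₁, p.pt_of_le (by omega : p.k ≤ j),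
      p.cdf_of_ge le_rfl]
    ring
  · have hj' : ¬ j < c := by omega
    have hjc : j + 1 - c = j - c + 1 := by omega
    refine ⟨-p.ht (j - c), fun t h₁ h₂ => ?_⟩
    rw [bumpPt, if_neg hj'] at h₁ ⊢
    rw [bumpPt, if_neg (by omega), hjc] at h₂
    rw [bumpVal, if_neg hj', p.bump_of_ge, p.cdf_affine (j - c) (by linarith) (by linarith)]
    · ring
    · have := p.pt_mono (Nat.zero_le (j - c)); linarith

/-- Both ends of the list carry the value `0`. Therefore the artificial piece between the last
breakpoint of one point and the first of the next is the zero line, and trying it in a query does no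
harm. -/
theorem bumpVal_zero : p.bumpVal 0 = 0 := by
  have hk := p.k_lt
  rw [bumpVal, if_pos (by omega), p.cdf_of_le le_rfl]

theorem bumpVal_last : p.bumpVal (2 * c - 1) = 0 := by
  have hk := p.k_lt
  rw [bumpVal, if_neg (by omega), p.pt_of_le (by omega), p.cdf_of_ge le_rfl, sub_self]

theorem bump_pos {t : ℝ} (h : 0 < p.bump D t) :
    p.bumpPt D 0 ≤ t ∧ t < p.bumpPt D (2 * c - 1) := by
  have hk := p.k_lt
  constructor
  · by_contra! h'
    rw [bumpPt, if_pos (by omega)] at h'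
    have h0 := p.cdf_of_le h'.le
    rw [bump, h0] at h
    linarith [p.cdf_nonneg (t - D)]
  · by_contra! h'
    rw [bumpPt, if_neg (by omega), p.pt_of_le (by omega : p.k ≤ 2 * c - 1 - c)] at h'
    rw [bump, p.cdf_of_ge (by linarith : p.pt p.k ≤ t - D)] at h
    linarith [p.cdf_le_one t]

end Histogram

/-! ### All pieces of all functions in one table. -/

/-- `n` nonnegative functions `G i` that are linear between consecutive breakpoints
`bx (i * M), …, bx (i * M + M - 1)` and vanish elsewhere; `ic q + sl q * x` is the line of the
piece between the breakpoints `q` and `q + 1`. -/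
structure PieceSystem (n M : ℕ) (bx sl ic : ℕ → ℝ) (G : ℕ → ℝ → ℝ) : Prop where
  nonneg : ∀ i < n, ∀ x, 0 ≤ G i x
  line : ∀ i < n, ∀ j, j + 1 < M → ∀ x, bx (i * M + j) ≤ x → x ≤ bx (i * M + j + 1) →
    G i x = ic (i * M + j) + sl (i * M + j) * x
  support : ∀ i < n, ∀ x, 0 < G i x → bx (i * M) ≤ x ∧ x < bx (i * M + (M - 1))
  gap : ∀ i < n, sl (i * M + (M - 1)) = 0 ∧ ic (i * M + (M - 1)) = 0

section

variable {c n : ℕ} (P : Fin n → Histogram c) (D : ℝ)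

/-- All breakpoints of the functions `bump`, point by point. -/
noncomputable def allPt (q : ℕ) : ℝ :=
  if h : q / (2 * c) < n then (P ⟨q / (2 * c), h⟩).bumpPt D (q % (2 * c)) else 0

/-- The values at all breakpoints. -/
noncomputable def allVal (q : ℕ) : ℝ :=
  if h : q / (2 * c) < n then (P ⟨q / (2 * c), h⟩).bumpVal (q % (2 * c)) else 0

/-- For repeated breakpoints the denominator is `0` and so is the slope. The piece is then a single
point, at which the line still has the right value. -/
noncomputable def allSlope (q : ℕ) : ℝ :=
  (allVal P (q + 1) - allVal P q) / (allPt P D (q + 1) - allPt P D q)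

noncomputable def allIcpt (q : ℕ) : ℝ := allVal P q - allSlope P D q * allPt P D q

noncomputable def allBump (i : ℕ) (t : ℝ) : ℝ := if h : i < n then (P ⟨i, h⟩).bump D t else 0

variable {P D}

theorem mul_add_div_eq {M i j : ℕ} (h : j < M) : (i * M + j) / M = i := by
  rw [Nat.mul_comm, Nat.mul_add_div (by omega), Nat.div_eq_of_lt h, add_zero]

theorem mul_add_mod_eq {M i j : ℕ} (h : j < M) : (i * M + j) % M = j := by
  rw [Nat.mul_comm, Nat.mul_add_mod, Nat.mod_eq_of_lt h]

theorem allPt_eq {i j : ℕ} (hi : i < n) (hj : j < 2 * c) :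
    allPt P D (i * (2 * c) + j) = (P ⟨i, hi⟩).bumpPt D j := by
  simp only [allPt, mul_add_div_eq hj, mul_add_mod_eq hj, hi, dif_pos]

theorem allVal_eq {i j : ℕ} (hi : i < n) (hj : j < 2 * c) :
    allVal P (i * (2 * c) + j) = (P ⟨i, hi⟩).bumpVal j := by
  simp only [allVal, mul_add_div_eq hj, mul_add_mod_eq hj, hi, dif_pos]

theorem allVal_of_le (hc : 2 ≤ c) {q : ℕ} (h : n * (2 * c) ≤ q) : allVal P q = 0 := by
  rw [allVal, dif_neg]
  rwa [not_lt, Nat.le_div_iff_mul_le (by omega)]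

theorem pieceSystem_allBump (hc : 2 ≤ c) (hD₀ : 0 ≤ D)
    (hD : ∀ i, (P i).pt (P i).k ≤ (P i).pt 0 + D) :
    PieceSystem n (2 * c) (allPt P D) (allSlope P D) (allIcpt P D) (allBump P D) where
  nonneg i hi x := by rw [allBump, dif_pos hi]; exact Histogram.bump_nonneg _ hD₀ x
  line i hi j hj x h₁ h₂ := by
    obtain ⟨σ, hσ⟩ := (P ⟨i, hi⟩).bump_affine (hD _) j
    have hv := allVal_eq (P := P) hi (by omega : j < 2 * c)
    have hv' := allVal_eq (P := P) hi hj
    have hp := allPt_eq (P := P) (D := D) hi (by omega : j < 2 * c)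
    have hp' := allPt_eq (P := P) (D := D) hi hj
    rw [← add_assoc] at hv' hp'
    rw [allIcpt, allSlope, allBump, dif_pos hi]
    have e₁ := hσ x (hp ▸ h₁) (hp' ▸ h₂)
    have hle := h₁.trans h₂
    rw [hp] at h₁ hle
    rw [hp'] at h₂ hle
    have e₂ := hσ _ hle le_rfl
    have e₃ := hσ _ le_rfl hle
    rw [hv, hv', hp, hp', e₁]
    set a := (P ⟨i, hi⟩).bumpPt D j
    set b := (P ⟨i, hi⟩).bumpPt D (j + 1)
    -- The stored value at the right breakpoint is the value of the function there, also where two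
    -- formulas meet. Hence the chord through the two stored values has slope `σ`.
    have e₄ : (P ⟨i, hi⟩).bumpVal (j + 1) = (P ⟨i, hi⟩).bump D b := by
      have hk := (P ⟨i, hi⟩).k_lt
      simp only [b, Histogram.bumpPt, Histogram.bumpVal]
      split_ifs with h
      · rw [Histogram.bump_of_le]
        have : (P ⟨i, hi⟩).pt (j + 1) ≤ (P ⟨i, hi⟩).pt (P ⟨i, hi⟩).k := by
          rw [← (P ⟨i, hi⟩).pt_of_le (le_max_right (j + 1) _)]
          exact (P ⟨i, hi⟩).pt_mono (le_max_left _ _)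
        linarith [hD ⟨i, hi⟩]
      · rw [Histogram.bump_of_ge, add_sub_cancel_right]
        have := (P ⟨i, hi⟩).pt_mono (Nat.zero_le (j + 1 - c))
        linarith [hD ⟨i, hi⟩]
    rw [e₄, e₂]
    rcases hle.eq_or_lt with h | h
    · have hx : x = a := le_antisymm (h ▸ h₂) h₁
      rw [hx, ← h]; simp
    · have : b - a ≠ 0 := (sub_pos.2 h).ne'
      field_simp
      ring
  support i hi x h := by
    rw [allBump, dif_pos hi] at h
    have h0 := allPt_eq (P := P) (D := D) hi (by omega : 0 < 2 * c)
    rw [add_zero] at h0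
    rw [h0, allPt_eq hi (by omega)]
    exact Histogram.bump_pos _ h
  gap i hi := by
    have h₁ : allVal P (i * (2 * c) + (2 * c - 1)) = 0 := by
      rw [allVal_eq hi (by omega), Histogram.bumpVal_last]
    have h₂ : allVal P (i * (2 * c) + (2 * c - 1) + 1) = 0 := by
      have e : i * (2 * c) + (2 * c - 1) + 1 = (i + 1) * (2 * c) + 0 := by
        rw [Nat.add_mul, one_mul]; omega
      rw [e]
      by_cases hi' : i + 1 < n
      · rw [allVal_eq hi' (by omega), Histogram.bumpVal_zero]
      -- The last point has no successor; the value after the end of the table is `0` by definition.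
      · refine allVal_of_le hc ?_
        rw [add_zero]
        exact Nat.mul_le_mul_right _ (by omega)
    simp [allIcpt, allSlope, h₁, h₂]

end

/-! ### Counting the visible segments of all slabs of a level. -/

/-- Sets that are pairwise disjoint subsets of `{0, …, N - 1}` have together at most `N` elements. -/
theorem sum_card_le_of_unique {m N : ℕ} {F : ℕ → Finset ℕ} (hF : ∀ v < m, ∀ q ∈ F v, q < N)
    (hu : ∀ v v' q, v < v' → v' < m → q ∈ F v → q ∉ F v') :
    ∑ v ∈ Finset.range m, (F v).card ≤ N := by
  rw [← Finset.card_biUnion]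
  · refine (Finset.card_le_card (t := Finset.range N) fun q hq => ?_).trans_eq
      (Finset.card_range N)
    obtain ⟨v, hv, hq⟩ := Finset.mem_biUnion.1 hq
    exact Finset.mem_range.2 (hF v (Finset.mem_range.1 hv) q hq)
  · intro v hv v' hv' hne
    refine Finset.disjoint_left.2 fun q hq hq' => ?_
    rcases lt_or_gt_of_ne hne with h | h
    · exact hu v v' q h (Finset.mem_range.1 hv') hq hq'
    · exact hu v' v q h (Finset.mem_range.1 hv) hq' hq

/-- The level `k + 1` is the least one on which `a` and `b` share a dyadic block. One level below
they lie in its two halves. -/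
theorem exists_level {a b l : ℕ} (hab : a < b) (hb : b < 2 ^ l) :
    ∃ k < l, a / 2 ^ k < b / 2 ^ k ∧ a / 2 ^ (k + 1) = b / 2 ^ (k + 1) := by
  have h : ∃ k, a / 2 ^ k = b / 2 ^ k :=
    ⟨l, by rw [Nat.div_eq_of_lt hb, Nat.div_eq_of_lt (hab.trans hb)]⟩
  have h0 : Nat.find h ≠ 0 := fun h0 => by
    have := Nat.find_spec h
    rw [h0] at this
    simp at this
    omega
  obtain ⟨k, hk⟩ := Nat.exists_eq_succ_of_ne_zero h0
  refine ⟨k, ?_, ?_, ?_⟩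
  · have : Nat.find h ≤ l := Nat.find_min' h (by
      rw [Nat.div_eq_of_lt hb, Nat.div_eq_of_lt (hab.trans hb)])
    omega
  · exact lt_of_le_of_ne (Nat.div_le_div_right hab.le) (Nat.find_min h (by omega))
  · have := Nat.find_spec h
    rwa [hk] at this

/-- An upper bound for the total size of the upper envelopes `E v` of the segments `q` with
`a q < v < b q` in the slabs `v < 2 ^ l`: in a slab, the segments are ordered by slope, and of two
segments the one with the larger slope wins in all slabs further right. -/
theorem sum_card_envelope_le {l N : ℕ} {a b : ℕ → ℕ} {slope : ℕ → ℝ} {E : ℕ → Finset ℕ}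
    (hspan : ∀ v < 2 ^ l, ∀ q ∈ E v, q < N ∧ a q < v ∧ v < b q ∧ b q < 2 ^ l)
    (hslope : ∀ v < 2 ^ l, ∀ q ∈ E v, ∀ q' ∈ E v, q ≠ q' → slope q ≠ slope q')
    (hright : ∀ v v' q q', v < v' → v' < 2 ^ l → q ∈ E v → q' ∈ E v → slope q < slope q' →
      v' < b q' → q ∉ E v')
    (hleft : ∀ v v' q q', v' < v → v < 2 ^ l → q ∈ E v → q' ∈ E v → slope q < slope q' →
      a q < v' → q' ∉ E v') :
    ∑ v ∈ Finset.range (2 ^ l), (E v).card ≤ 4 * N + 2 ^ l * l := by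
  classical
  have hlev : ∀ q, ∃ k, a q < b q → b q < 2 ^ l →
      k < l ∧ a q / 2 ^ k < b q / 2 ^ k ∧ a q / 2 ^ (k + 1) = b q / 2 ^ (k + 1) := by
    intro q
    by_cases h : a q < b q ∧ b q < 2 ^ l
    · obtain ⟨k, h1, h2⟩ := exists_level h.1 h.2
      exact ⟨k, fun _ _ => ⟨h1, h2⟩⟩
    · exact ⟨0, fun h1 h2 => (h ⟨h1, h2⟩).elim⟩
  choose lev hlev using hlev
  -- `z q` is the first slab of the right half of the smallest dyadic block containing `a q` and `b
  -- q`, so it separates the two ends.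
  set z : ℕ → ℕ := fun q => (2 * (a q / 2 ^ (lev q + 1)) + 1) * 2 ^ lev q with hz
  have hlev' : ∀ v < 2 ^ l, ∀ q ∈ E v, lev q < l ∧ a q < z q ∧ z q ≤ b q ∧
      a q / 2 ^ (lev q + 1) = v / 2 ^ (lev q + 1) := by
    intro v hv q hq
    obtain ⟨-, h1, h2, h3⟩ := hspan v hv q hq
    obtain ⟨h4, h5, h6⟩ := hlev q (h1.trans h2) h3
    have hp : 0 < 2 ^ lev q := by positivity
    have e1 : a q / 2 ^ (lev q + 1) = a q / 2 ^ lev q / 2 := by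
      rw [pow_succ, Nat.div_div_eq_div_mul]
    have e2 : b q / 2 ^ (lev q + 1) = b q / 2 ^ lev q / 2 := by
      rw [pow_succ, Nat.div_div_eq_div_mul]
    refine ⟨h4, ?_, ?_, le_antisymm (Nat.div_le_div_right h1.le) ?_⟩
    · rw [hz]
      refine (Nat.div_lt_iff_lt_mul hp).1 ?_
      omega
    · rw [hz]
      refine (Nat.le_div_iff_mul_le hp).1 ?_
      omega
    · rw [h6]
      exact Nat.div_le_div_right h2.le
  -- The dyadic block of `q` contains every slab over which `q` passes. So segments of one level
  -- over the same slab have the same block and the same midpoint.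
  have hzz : ∀ v < 2 ^ l, ∀ q ∈ E v, ∀ q' ∈ E v, lev q = lev q' → z q = z q' := by
    intro v hv q hq q' hq' h
    have h1 := (hlev' v hv q hq).2.2.2
    have h2 := (hlev' v hv q' hq').2.2.2
    simp only [hz]
    rw [h1, h2, h]
  -- The four reasons to charge the occurrence of `q` in the slab `v`. Under `C₀` it is the last one
  -- at all, under `C₁` the first one from `z q` on, under `C₂` the first one at all, under `C₃` the
  -- last one before `z q`. In each case the witness `q'` passes over all slabs that have to be
  -- excluded: it reaches at least as far outwards as `q`, or inwards up to the common midpoint.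
  let C₀ : ℕ → ℕ → Prop := fun v q => z q ≤ v ∧
    ∃ q' ∈ E v, lev q = lev q' ∧ slope q < slope q' ∧ b q ≤ b q'
  let C₁ : ℕ → ℕ → Prop := fun v q => z q ≤ v ∧
    ∃ q' ∈ E v, lev q = lev q' ∧ slope q' < slope q ∧ b q < b q'
  let C₂ : ℕ → ℕ → Prop := fun v q => v < z q ∧
    ∃ q' ∈ E v, lev q = lev q' ∧ slope q' < slope q ∧ a q' ≤ a q
  let C₃ : ℕ → ℕ → Prop := fun v q => v < z q ∧
    ∃ q' ∈ E v, lev q = lev q' ∧ slope q < slope q' ∧ a q' < a q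
  let R : ℕ → ℕ → Prop := fun v q => ¬ C₀ v q ∧ ¬ C₁ v q ∧ ¬ C₂ v q ∧ ¬ C₃ v q
  have hR : ∀ v < 2 ^ l, ((E v).filter (R v)).card ≤ l := by
    intro v hv
    rw [← Finset.card_range l]
    refine Finset.card_le_card_of_injOn lev (fun q hq => ?_) ?_
    · exact Finset.mem_coe.2 (Finset.mem_range.2 (hlev' v hv q (Finset.mem_filter.1 hq).1).1)
    -- Two segments of one level cannot both stay uncharged. On the right of the midpoint the order
    -- of their right ends decides which of them is charged, on the left the order of their left
    -- ends.
    · have main : ∀ q ∈ E v, ∀ q' ∈ E v, R v q → R v q' → lev q = lev q' →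
          ¬ slope q < slope q' := by
        intro q hq q' hq' hr hr' hl hs
        have hzq := hzz v hv q hq q' hq' hl
        rcases le_or_gt (z q) v with hside | hside
        · rcases le_or_gt (b q) (b q') with h | h
          · exact hr.1 ⟨hside, q', hq', hl, hs, h⟩
          · exact hr'.2.1 ⟨hzq ▸ hside, q, hq, hl.symm, hs, h⟩
        · rcases le_or_gt (a q) (a q') with h | h
          · exact hr'.2.2.1 ⟨hzq ▸ hside, q, hq, hl.symm, hs, h⟩
          · exact hr.2.2.2 ⟨hside, q', hq', hl, hs, h⟩
      intro q hq q' hq' hl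
      obtain ⟨hq, hr⟩ := Finset.mem_filter.1 (Finset.mem_coe.1 hq)
      obtain ⟨hq', hr'⟩ := Finset.mem_filter.1 (Finset.mem_coe.1 hq')
      by_contra hne
      rcases lt_or_gt_of_ne (hslope v hv q hq q' hq' hne) with h | h
      · exact main q hq q' hq' hr hr' hl h
      · exact main q' hq' q hq hr' hr hl.symm h
  have hC : ∀ (C : ℕ → ℕ → Prop) [∀ v, DecidablePred (C v)], (∀ v v' q, v < v' → v' < 2 ^ l → q ∈ E v → q ∈ E v' →
      C v q → ¬ C v' q) → ∑ v ∈ Finset.range (2 ^ l), ((E v).filter (C v)).card ≤ N := by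
    intro C _ hC
    refine sum_card_le_of_unique (fun v hv q hq => (hspan v hv q (Finset.mem_filter.1 hq).1).1) ?_
    intro v v' q hvv' hv' hq hq'
    obtain ⟨h1, h2⟩ := Finset.mem_filter.1 hq
    obtain ⟨h3, h4⟩ := Finset.mem_filter.1 hq'
    exact hC v v' q hvv' hv' h1 h3 h2 h4
  have h₀ := hC C₀ fun v v' q hvv' hv' hq hq' hc _ => by
    obtain ⟨-, q', hq₁, -, hs, hb⟩ := hc
    exact hright v v' q q' hvv' hv' hq hq₁ hs ((hspan v' hv' q hq').2.2.1.trans_le hb) hq'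
  have h₁ := hC C₁ fun v v' q hvv' hv' hq hq' hc hc' => by
    obtain ⟨-, q', hq₁, hl, hs, hb⟩ := hc'
    refine hleft v' v q' q hvv' hv' hq₁ hq' hs (lt_of_lt_of_le ?_ hc.1) hq
    rw [hzz v' hv' q hq' q' hq₁ hl]
    exact (hlev' v' hv' q' hq₁).2.1
  have h₂ := hC C₂ fun v v' q hvv' hv' hq hq' hc hc' => by
    obtain ⟨-, q', hq₁, -, hs, hb⟩ := hc'
    exact hleft v' v q' q hvv' hv' hq₁ hq' hs (hb.trans_lt (hspan v (hvv'.trans hv') q hq).2.1) hq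
  have h₃ := hC C₃ fun v v' q hvv' hv' hq hq' hc hc' => by
    obtain ⟨-, q', hq₁, hl, hs, hb⟩ := hc
    refine hright v v' q q' hvv' hv' hq hq₁ hs (lt_of_lt_of_le hc'.1 ?_) hq'
    rw [hzz v (hvv'.trans hv') q hq q' hq₁ hl]
    exact (hlev' v (hvv'.trans hv') q' hq₁).2.2.1
  have hsplit : ∀ v ∈ Finset.range (2 ^ l), (E v).card ≤ ((E v).filter (C₀ v)).card +
      ((E v).filter (C₁ v)).card + ((E v).filter (C₂ v)).card + ((E v).filter (C₃ v)).card + l := by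
    intro v hv
    have hsub : E v ⊆ (E v).filter (C₀ v) ∪ (E v).filter (C₁ v) ∪ (E v).filter (C₂ v) ∪
        (E v).filter (C₃ v) ∪ (E v).filter (R v) := by
      intro q hq
      simp only [Finset.mem_union, Finset.mem_filter, hq, true_and]
      by_cases c0 : C₀ v q
      · exact Or.inl (Or.inl (Or.inl (Or.inl c0)))
      by_cases c1 : C₁ v q
      · exact Or.inl (Or.inl (Or.inl (Or.inr c1)))
      by_cases c2 : C₂ v q
      · exact Or.inl (Or.inl (Or.inr c2))
      by_cases c3 : C₃ v q
      · exact Or.inl (Or.inr c3)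
      exact Or.inr ⟨c0, c1, c2, c3⟩
    have hcard := Finset.card_le_card hsub
    have u1 := Finset.card_union_le ((E v).filter (C₀ v)) ((E v).filter (C₁ v))
    have u2 := Finset.card_union_le ((E v).filter (C₀ v) ∪ (E v).filter (C₁ v))
      ((E v).filter (C₂ v))
    have u3 := Finset.card_union_le ((E v).filter (C₀ v) ∪ (E v).filter (C₁ v) ∪
      (E v).filter (C₂ v)) ((E v).filter (C₃ v))
    have u4 := Finset.card_union_le ((E v).filter (C₀ v) ∪ (E v).filter (C₁ v) ∪
      (E v).filter (C₂ v) ∪ (E v).filter (C₃ v)) ((E v).filter (R v))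
    have := hR v (Finset.mem_range.1 hv)
    omega
  refine (Finset.sum_le_sum hsplit).trans ?_
  simp only [Finset.sum_add_distrib, Finset.sum_const, Finset.card_range, smul_eq_mul]
  omega

/-! ### Chains of lines and upper envelopes on an interval. -/

section Envelope

variable (sl ic : ℕ → ℝ)

/-- The value at `x` of the line with number `q`. -/
def lineAt (q : ℕ) (x : ℝ) : ℝ := ic q + sl q * x

/-- `k` lines `sq d` of increasing slopes, consecutive ones crossing at the abscissae `ss (d + 1)`,
which increase from `ss 0 = xl` and are less than `xr`. -/
structure IsLineChain (k : ℕ) (sq : ℕ → ℕ) (ss : ℕ → ℝ) (xl xr : ℝ) : Prop where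
  first : 0 < k → ss 0 = xl
  lt_right : ∀ d < k, ss d < xr
  step : ∀ d, d + 1 < k → ss d < ss (d + 1) ∧ sl (sq d) < sl (sq (d + 1)) ∧
    lineAt sl ic (sq d) (ss (d + 1)) = lineAt sl ic (sq (d + 1)) (ss (d + 1))

variable {sl ic} {k : ℕ} {sq : ℕ → ℕ} {ss : ℕ → ℝ} {xl xr : ℝ}

theorem lineAt_le_of_le {q q' : ℕ} {s x : ℝ} (h : lineAt sl ic q s ≤ lineAt sl ic q' s)
    (hs : sl q ≤ sl q') (hx : s ≤ x) : lineAt sl ic q x ≤ lineAt sl ic q' x := by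
  have := mul_le_mul_of_nonneg_right hs (sub_nonneg.2 hx)
  simp only [lineAt] at *
  linarith

theorem lineAt_le_of_ge {q q' : ℕ} {s x : ℝ} (h : lineAt sl ic q' s ≤ lineAt sl ic q s)
    (hs : sl q ≤ sl q') (hx : x ≤ s) : lineAt sl ic q' x ≤ lineAt sl ic q x := by
  have := mul_le_mul_of_nonneg_right hs (sub_nonneg.2 hx)
  simp only [lineAt] at *
  linarith

theorem lineAt_lt_of_lt {q q' : ℕ} {s x : ℝ} (h : lineAt sl ic q s ≤ lineAt sl ic q' s)
    (hs : sl q < sl q') (hx : s < x) : lineAt sl ic q x < lineAt sl ic q' x := by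
  have := mul_lt_mul_of_pos_right hs (sub_pos.2 hx)
  simp only [lineAt] at *
  linarith

theorem lineAt_lt_of_gt {q q' : ℕ} {s x : ℝ} (h : lineAt sl ic q' s ≤ lineAt sl ic q s)
    (hs : sl q < sl q') (hx : x < s) : lineAt sl ic q' x < lineAt sl ic q x := by
  have := mul_lt_mul_of_pos_right hs (sub_pos.2 hx)
  simp only [lineAt] at *
  linarith

namespace IsLineChain

theorem start_lt (h : IsLineChain sl ic k sq ss xl xr) {d d' : ℕ} (hd : d < d') (hd' : d' < k) :
    ss d < ss d' ∧ sl (sq d) < sl (sq d') := by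
  induction d', hd using Nat.le_induction with
  | base => exact ⟨(h.step d hd').1, (h.step d hd').2.1⟩
  | succ m hm ih =>
    obtain ⟨h1, h2⟩ := ih (by omega)
    exact ⟨h1.trans (h.step m hd').1, h2.trans (h.step m hd').2.1⟩

theorem left_le (h : IsLineChain sl ic k sq ss xl xr) {d : ℕ} (hd : d < k) : xl ≤ ss d := by
  rw [← h.first (by omega)]
  rcases Nat.eq_zero_or_pos d with h0 | h0
  · rw [h0]
  · exact (h.start_lt h0 hd).1.le

theorem sq_injOn (h : IsLineChain sl ic k sq ss xl xr) {d d' : ℕ} (hd : d < k) (hd' : d' < k)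
    (e : sq d = sq d') : d = d' := by
  rcases lt_trichotomy d d' with h1 | h1 | h1
  · exact absurd (congrArg sl e) (h.start_lt h1 hd').2.ne
  · exact h1
  · exact absurd (congrArg sl e) (h.start_lt h1 hd).2.ne'

/-- A line of the chain is the largest between its start and the start of the next line. -/
theorem le_of_mem (h : IsLineChain sl ic k sq ss xl xr) {d : ℕ} (hd : d < k) {x : ℝ} (h₁ : ss d ≤ x)
    (h₂ : d + 1 < k → x ≤ ss (d + 1)) {d' : ℕ} (hd' : d' < k) :
    lineAt sl ic (sq d') x ≤ lineAt sl ic (sq d) x := by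
  rcases le_total d d' with hle | hle
  · induction d', hle using Nat.le_induction with
    | base => exact le_rfl
    | succ m hm ih =>
      refine le_trans ?_ (ih (by omega))
      obtain ⟨-, s2, s3⟩ := h.step m hd'
      refine lineAt_le_of_ge s3.ge s2.le ((h₂ (by omega)).trans ?_)
      rcases hm.eq_or_lt with e | e
      · rw [e]
      · exact (h.start_lt (by omega : d + 1 < m + 1) hd').1.le
  · induction hle using Nat.decreasingInduction with
    | self => exact le_rfl
    | of_succ m hm ih =>
      refine le_trans ?_ (ih (by omega))
      obtain ⟨-, s2, s3⟩ := h.step m (by omega)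
      refine lineAt_le_of_le s3.le s2.le (le_trans ?_ h₁)
      rcases (Nat.succ_le_of_lt hm).eq_or_lt with e | e
      · rw [← e]
      · exact (h.start_lt e hd).1.le

theorem pop (h : IsLineChain sl ic (k + 1) sq ss xl xr) : IsLineChain sl ic k sq ss xl xr where
  first hk := h.first (by omega)
  lt_right d hd := h.lt_right d (by omega)
  step d hd := h.step d (by omega)

theorem congr (h : IsLineChain sl ic k sq ss xl xr) {sq' : ℕ → ℕ} {ss' : ℕ → ℝ}
    (h₁ : ∀ d < k, sq' d = sq d) (h₂ : ∀ d < k, ss' d = ss d) :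
    IsLineChain sl ic k sq' ss' xl xr where
  first hk := by rw [h₂ 0 hk, h.first hk]
  lt_right d hd := by rw [h₂ d hd]; exact h.lt_right d hd
  step d hd := by
    rw [h₂ d (by omega), h₂ _ hd, h₁ d (by omega), h₁ _ hd]
    exact h.step d hd

theorem singleton (h : xl < xr) (h₀ : ss 0 = xl) : IsLineChain sl ic 1 sq ss xl xr where
  first _ := h₀
  lt_right d hd := by rwa [Nat.lt_one_iff.1 hd, h₀]
  step d hd := absurd hd (by omega)

/-- The new line is below the top line at the start of the latter and above it at `xr`. So it is
steeper, and the crossing lies strictly between these two abscissae. The quotient in `hs` is this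
crossing. -/
theorem push (h : IsLineChain sl ic (k + 1) sq ss xl xr)
    (h₁ : lineAt sl ic (sq (k + 1)) (ss k) < lineAt sl ic (sq k) (ss k))
    (h₂ : lineAt sl ic (sq k) xr < lineAt sl ic (sq (k + 1)) xr)
    (hs : ss (k + 1) = (ic (sq k) - ic (sq (k + 1))) / (sl (sq (k + 1)) - sl (sq k))) :
    IsLineChain sl ic (k + 2) sq ss xl xr := by
  have hlt := h.lt_right k (by omega)
  have hsl : sl (sq k) < sl (sq (k + 1)) := by
    simp only [lineAt] at h₁ h₂
    nlinarith
  have hpos : 0 < sl (sq (k + 1)) - sl (sq k) := sub_pos.2 hsl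
  have hcross : lineAt sl ic (sq k) (ss (k + 1)) = lineAt sl ic (sq (k + 1)) (ss (k + 1)) := by
    rw [hs]
    simp only [lineAt]
    field_simp
    ring
  refine ⟨fun _ => h.first (by omega), fun d hd => ?_, fun d hd => ?_⟩
  · rcases Nat.lt_succ_iff_lt_or_eq.1 hd with hd | hd
    · exact h.lt_right d hd
    · rw [hd, hs, div_lt_iff₀ hpos]
      simp only [lineAt] at h₂
      linarith
  · rcases Nat.lt_succ_iff_lt_or_eq.1 hd with hd | hd
    · exact h.step d hd
    · obtain rfl : d = k := by omega
      refine ⟨?_, hsl, hcross⟩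
      rw [hs, lt_div_iff₀ hpos]
      simp only [lineAt] at h₁
      linarith

/-- A line that is overtaken by `q` at its start is nowhere needed any more. -/
theorem pop_cover (h : IsLineChain sl ic (k + 1) sq ss xl xr) {q : ℕ} (hq : sl (sq k) ≤ sl q)
    (hle : lineAt sl ic (sq k) (ss k) ≤ lineAt sl ic q (ss k)) {x : ℝ} (hx : xl ≤ x) :
    (∃ d < k, lineAt sl ic (sq k) x ≤ lineAt sl ic (sq d) x) ∨
      lineAt sl ic (sq k) x ≤ lineAt sl ic q x := by
  rcases le_total (ss k) x with hs | hs
  · exact Or.inr (lineAt_le_of_le hle hq hs)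
  · rcases Nat.eq_zero_or_pos k with h0 | h0
    · subst h0
      rw [h.first (by omega)] at hs hle
      exact Or.inr (lineAt_le_of_le hle hq hx)
    · obtain ⟨m, rfl⟩ := Nat.exists_eq_add_of_lt h0
      rw [Nat.zero_add] at *
      obtain ⟨-, s2, s3⟩ := h.step m (by omega)
      exact Or.inl ⟨m, by omega, lineAt_le_of_ge s3.ge s2.le hs⟩

end IsLineChain

variable (sl ic) in
/-- The chain is the upper envelope on `[xl, xr)` of the lines in `Q`. -/
structure IsEnvelope (k : ℕ) (sq : ℕ → ℕ) (ss : ℕ → ℝ) (xl xr : ℝ) (Q : ℕ → Prop) : Prop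
    extends IsLineChain sl ic k sq ss xl xr where
  mem : ∀ d < k, Q (sq d)
  cover : ∀ q, Q q → ∀ x, xl ≤ x → x < xr → ∃ d < k, lineAt sl ic q x ≤ lineAt sl ic (sq d) x

namespace IsEnvelope

variable {Q : ℕ → Prop}

theorem le_of_start_le (h : IsEnvelope sl ic k sq ss xl xr Q) {d : ℕ} (hd : d < k) {x : ℝ}
    (h₁ : ss d ≤ x) (h₂ : d + 1 < k → x ≤ ss (d + 1)) (h₃ : x < xr) {q : ℕ} (hq : Q q) :
    lineAt sl ic q x ≤ lineAt sl ic (sq d) x := by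
  obtain ⟨d', hd', hle⟩ := h.cover q hq x ((h.left_le hd).trans h₁) h₃
  exact hle.trans (h.le_of_mem hd h₁ h₂ hd')

theorem le_start (h : IsEnvelope sl ic k sq ss xl xr Q) {d : ℕ} (hd : d < k) {q : ℕ} (hq : Q q) :
    lineAt sl ic q (ss d) ≤ lineAt sl ic (sq d) (ss d) :=
  h.le_of_start_le hd le_rfl (fun h' => (h.step d h').1.le) (h.lt_right d hd) hq

end IsEnvelope

/-- The piece `q` passes over the node that consists of the ranks `v * S, …, v * S + S - 1`. -/
def Spans (N : ℕ) (rk : ℕ → ℕ) (S v q : ℕ) : Prop :=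
  q < N ∧ rk q / S < v ∧ v < rk (q + 1) / S

/-- Of two lines in the envelope of one slab, the steeper one is at least as high at its own start
and strictly higher everywhere to the right of it. In a later slab over which it still passes it
excludes the flatter one; the left side is symmetric. The alternative `k v = 0` admits nodes whose
envelopes are not yet built. -/
theorem sum_envelope_le {N l S : ℕ} {rk : ℕ → ℕ} {xs : ℕ → ℝ} {k : ℕ → ℕ} {sq : ℕ → ℕ → ℕ}
    {ss : ℕ → ℕ → ℝ} (hN : 0 < N) (hS : N ≤ 2 ^ l * S) (hrk : ∀ q ≤ N, rk q < N)
    (hxs : ∀ a b, a ≤ b → b < N → xs a ≤ xs b)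
    (h : ∀ v < 2 ^ l, k v = 0 ∨
      IsEnvelope sl ic (k v) (sq v) (ss v) (xs (v * S)) (xs ((v + 1) * S)) (Spans N rk S v)) :
    ∑ v ∈ Finset.range (2 ^ l), k v ≤ 4 * N + 2 ^ l * l := by
  classical
  have hS0 : 0 < S := Nat.pos_of_ne_zero fun h0 => by rw [h0] at hS; omega
  have hE : ∀ v < 2 ^ l, ∀ d < k v, IsEnvelope sl ic (k v) (sq v) (ss v) (xs (v * S))
      (xs ((v + 1) * S)) (Spans N rk S v) := fun v hv d hd => (h v hv).resolve_left (by omega)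
  have hcard : ∀ v ∈ Finset.range (2 ^ l),
      k v = ((Finset.range (k v)).image (sq v)).card := by
    intro v hv
    rw [Finset.card_image_of_injOn, Finset.card_range]
    intro d hd d' hd' e
    rw [Finset.mem_coe, Finset.mem_range] at hd hd'
    exact (hE v (Finset.mem_range.1 hv) d hd).sq_injOn hd hd' e
  rw [Finset.sum_congr rfl hcard]
  -- `xs` is known to be monotone only below `N`. A piece that passes over `v` has its right end
  -- beyond `v`, which bounds the ranks of both borders of `v`.
  have hmul : ∀ v q, q < N → v < rk (q + 1) / S → v * S < N := fun v q hq hv =>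
    (Nat.mul_le_of_le_div S v _ hv.le).trans_lt (hrk _ hq)
  have hmul' : ∀ v q, q < N → v < rk (q + 1) / S → (v + 1) * S < N := fun v q hq hv =>
    (Nat.mul_le_of_le_div S (v + 1) _ hv).trans_lt (hrk _ hq)
  refine sum_card_envelope_le (N := N) (a := fun q => rk q / S) (b := fun q => rk (q + 1) / S)
    (slope := sl) (fun v hv q hq => ?_) (fun v hv q hq q' hq' hne => ?_)
    (fun v v' q q' hvv' hv' hq hq' hs hb hq₂ => ?_) (fun v v' q q' hvv' hv hq hq' hs ha hq₂ => ?_)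
  · obtain ⟨d, hd, rfl⟩ := Finset.mem_image.1 hq
    have hd := Finset.mem_range.1 hd
    obtain ⟨h1, h2, h3⟩ := (hE v hv d hd).mem d hd
    refine ⟨h1, h2, h3, (Nat.div_lt_iff_lt_mul hS0).2 ((hrk _ h1).trans_le hS)⟩
  · obtain ⟨d, hd, rfl⟩ := Finset.mem_image.1 hq
    obtain ⟨d', hd', rfl⟩ := Finset.mem_image.1 hq'
    have hd := Finset.mem_range.1 hd
    have hd' := Finset.mem_range.1 hd'
    rcases lt_or_gt_of_ne (fun e => hne (congrArg (sq v) e) : d ≠ d') with hlt | hlt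
    · exact ((hE v hv d hd).start_lt hlt hd').2.ne
    · exact ((hE v hv d hd).start_lt hlt hd).2.ne'
  · obtain ⟨d, hd, rfl⟩ := Finset.mem_image.1 hq
    obtain ⟨d', hd', rfl⟩ := Finset.mem_image.1 hq'
    obtain ⟨d₂, hd₂, e⟩ := Finset.mem_image.1 hq₂
    have hd := Finset.mem_range.1 hd
    have hd' := Finset.mem_range.1 hd'
    have hd₂ := Finset.mem_range.1 hd₂
    have hv := hvv'.trans hv'
    obtain ⟨m1, m2, m3⟩ := (hE v hv d hd).mem d hd
    obtain ⟨n1, n2, n3⟩ := (hE v hv d hd).mem d' hd'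
    have key := (hE v' hv' d₂ hd₂).le_start hd₂ (q := sq v d') ⟨n1, n2.trans hvv', hb⟩
    rw [e] at key
    have k1 := (hE v hv d hd).le_start hd' ((hE v hv d hd).mem d hd)
    refine absurd key (not_le.2 (lineAt_lt_of_lt k1 hs ?_))
    refine ((hE v hv d hd).lt_right d' hd').trans_le (le_trans ?_ ((hE v' hv' d₂ hd₂).left_le hd₂))
    exact hxs _ _ (Nat.mul_le_mul_right _ hvv') (hmul _ _ n1 hb)
  · obtain ⟨d, hd, rfl⟩ := Finset.mem_image.1 hq
    obtain ⟨d', hd', rfl⟩ := Finset.mem_image.1 hq'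
    obtain ⟨d₂, hd₂, e⟩ := Finset.mem_image.1 hq₂
    have hd := Finset.mem_range.1 hd
    have hd' := Finset.mem_range.1 hd'
    have hd₂ := Finset.mem_range.1 hd₂
    have hv' := hvv'.trans hv
    obtain ⟨m1, m2, m3⟩ := (hE v hv d hd).mem d hd
    obtain ⟨n1, n2, n3⟩ := (hE v hv d hd).mem d' hd'
    have key := (hE v' hv' d₂ hd₂).le_start hd₂ (q := sq v d) ⟨m1, ha, hvv'.trans m3⟩
    rw [e] at key
    have k1 := (hE v hv d hd).le_start hd ((hE v hv d hd).mem d' hd')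
    refine absurd key (not_le.2 (lineAt_lt_of_gt k1 hs ?_))
    refine ((hE v' hv' d₂ hd₂).lt_right d₂ hd₂).trans_le
      (le_trans ?_ ((hE v hv d hd).left_le hd))
    exact hxs _ _ (Nat.mul_le_mul_right _ hvv') (hmul _ _ m1 m3)

/-- A piece that passes over a node but not over its parent ends in the sibling. -/
theorem Spans.parent_or {N S v q : ℕ} {rk : ℕ → ℕ} (h : Spans N rk S v q) :
    Spans N rk (2 * S) (v / 2) q ∨ v = rk q / S + 1 ∨ v + 1 = rk (q + 1) / S := by
  obtain ⟨h1, h2, h3⟩ := h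
  have e : ∀ r, r / (2 * S) = r / S / 2 := fun r => by rw [Nat.mul_comm, Nat.div_div_eq_div_mul]
  simp only [Spans, e]
  omega

theorem Spans.child {N S v q : ℕ} {rk : ℕ → ℕ} (h : Spans N rk (2 * S) (v / 2) q) :
    Spans N rk S v q := by
  obtain ⟨h1, h2, h3⟩ := h
  have e : ∀ r, r / (2 * S) = r / S / 2 := fun r => by rw [Nat.mul_comm, Nat.div_div_eq_div_mul]
  simp only [Spans, e] at *
  omega

end Envelope

infixr:60 " ;; " => RealRAM.Program.seq

namespace RealRAM

/-! ### Merge sort. -/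

section MergeSort

/-- `p` maps `{0, …, N - 1}` onto itself. -/
def IsPermOn (p : ℕ → ℕ) (N : ℕ) : Prop := ∀ x, (∃ a < N, p a = x) ↔ x < N

/-- The values `key (p a)` increase in each of the blocks `{β * w, …, β * w + w - 1}`. -/
def SortedBlocks (key : ℕ → ℝ) (p : ℕ → ℕ) (N w : ℕ) : Prop :=
  ∀ a b, a ≤ b → b < N → a / w = b / w → key (p a) ≤ key (p b)

/-- The state of a merge of the blocks `[β, β + w)` and `[β + w, β + 2 w)` of `p` into `B`: the first
`k` cells are written, `i` and `j` are the next candidates. -/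
structure MergeInv (key : ℕ → ℝ) (p B : ℕ → ℕ) (N w k i j β : ℕ) : Prop where
  base : ∃ m, β = m * (2 * w)
  k_le : k ≤ N
  le_i : β ≤ i
  i_le : i ≤ β + w
  le_j : β + w ≤ j
  j_le : j ≤ β + 2 * w
  j_bound : j ≤ N ∨ j = β + w
  sum : k + (β + w) = i + j
  image : ∀ x, (∃ a < k, B a = x) ↔ ∃ a, (a < i ∨ β + w ≤ a ∧ a < j) ∧ p a = x
  sorted : SortedBlocks key B k (2 * w)
  left : ∀ a, β ≤ a → a < k → ∀ i', i ≤ i' → i' < β + w → i' < N → key (B a) ≤ key (p i')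
  right : ∀ a, β ≤ a → a < k → ∀ j', j ≤ j' → j' < β + 2 * w → j' < N → key (B a) ≤ key (p j')

variable {key : ℕ → ℝ} {p B : ℕ → ℕ} {N w k i j β : ℕ}

theorem div_eq_of_block {m a w : ℕ} (h₁ : m * w ≤ a) (h₂ : a < m * w + w) : a / w = m :=
  Nat.div_eq_of_lt_le h₁ (by rwa [Nat.add_mul, one_mul])

theorem block_of_div_eq {m a w : ℕ} (hw : 0 < w) (h : a / w = m) :
    m * w ≤ a ∧ a < m * w + w := by
  subst h
  exact ⟨Nat.div_mul_le_self a w, Nat.lt_div_mul_add hw⟩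

namespace MergeInv

theorem init : MergeInv key p B N w 0 0 w 0 where
  base := ⟨0, by simp⟩
  k_le := Nat.zero_le _
  le_i := le_rfl
  i_le := by omega
  le_j := by omega
  j_le := by omega
  j_bound := by omega
  sum := by omega
  image x := by
    constructor
    · rintro ⟨a, ha, -⟩; omega
    · rintro ⟨a, ha, -⟩; omega
  sorted a b _ hb := by omega
  left a _ ha := by omega
  right a _ ha := by omega

/-- After `2 * w` written cells both blocks are used up and `k` is the base of the next pair. Its
right block may already lie beyond `N`; this is why `j_bound` has a second alternative. -/
theorem next (h : MergeInv key p B N w k i j β) (hk : β + 2 * w ≤ k) :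
    MergeInv key p B N w k k (k + w) k where
  base := by
    obtain ⟨m, hm⟩ := h.base
    have := h.sum; have := h.i_le; have := h.j_le
    exact ⟨m + 1, by rw [Nat.add_mul]; omega⟩
  k_le := h.k_le
  le_i := le_rfl
  i_le := by omega
  le_j := by omega
  j_le := by omega
  j_bound := by omega
  sum := by omega
  image x := by
    rw [h.image x]
    have := h.sum; have := h.i_le; have := h.j_le
    refine exists_congr fun a => and_congr_left fun _ => ?_
    omega
  sorted := h.sorted
  left a ha ha' := by omega
  right a ha ha' := by omega

theorem image_push {s t : ℕ → Prop} {y : ℕ} (him : ∀ x, (∃ a < k, B a = x) ↔ ∃ a, s a ∧ p a = x)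
    (ht : ∀ a, t a ↔ s a ∨ a = y) (x : ℕ) :
    (∃ a < k + 1, Function.update B k (p y) a = x) ↔ ∃ a, t a ∧ p a = x := by
  constructor
  · rintro ⟨a, ha, hx⟩
    rcases Nat.lt_succ_iff_lt_or_eq.1 ha with h1 | h1
    · rw [Function.update_of_ne h1.ne] at hx
      obtain ⟨b, hb, hbx⟩ := (him x).1 ⟨a, h1, hx⟩
      exact ⟨b, (ht b).2 (Or.inl hb), hbx⟩
    · rw [h1, Function.update_self] at hx
      exact ⟨y, (ht y).2 (Or.inr rfl), hx⟩
  · rintro ⟨a, ha, hx⟩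
    rcases (ht a).1 ha with h1 | h1
    · obtain ⟨b, hb, hbx⟩ := (him x).2 ⟨a, h1, hx⟩
      exact ⟨b, by omega, by rwa [Function.update_of_ne hb.ne]⟩
    · exact ⟨k, by omega, by rw [Function.update_self, ← h1, hx]⟩

theorem sorted_push (h : SortedBlocks key B k w) {x : ℕ}
    (hx : ∀ a < k, a / w = k / w → key (B a) ≤ key x) :
    SortedBlocks key (Function.update B k x) (k + 1) w := by
  intro a b hab hb e
  rcases Nat.lt_succ_iff_lt_or_eq.1 hb with h1 | h1
  · rw [Function.update_of_ne h1.ne, Function.update_of_ne (hab.trans_lt h1).ne]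
    exact h a b hab h1 e
  · subst h1
    rw [Function.update_self]
    rcases hab.eq_or_lt with h2 | h2
    · rw [h2, Function.update_self]
    · rw [Function.update_of_ne h2.ne]
      exact hx a h2 e

theorem frontier_push {P : ℕ → Prop} {β x : ℕ} {f : ℕ → ℕ}
    (h : ∀ a, β ≤ a → a < k → ∀ i', P i' → key (B a) ≤ key (f i'))
    (hx : ∀ i', P i' → key x ≤ key (f i')) :
    ∀ a, β ≤ a → a < k + 1 → ∀ i', P i' → key (Function.update B k x a) ≤ key (f i') := by
  intro a ha ha' i' hi'
  rcases Nat.lt_succ_iff_lt_or_eq.1 ha' with h1 | h1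
  · rw [Function.update_of_ne h1.ne]; exact h a ha h1 i' hi'
  · rw [h1, Function.update_self]; exact hx i' hi'

/-- Because the blocks of `p` are sorted, the smaller of the two next keys is a lower bound for all
that remains of both. The field `left`, applied to the cell `i` itself, says that it is not smaller
than the keys already written for this pair. -/
theorem takeLeft (h : MergeInv key p B N w k i j β) (hp : SortedBlocks key p N w) (hk : k < N)
    (hk' : k < β + 2 * w) (hi : i < β + w)
    (hle : j < β + 2 * w → j < N → key (p i) ≤ key (p j)) :
    MergeInv key p (Function.update B k (p i)) N w (k + 1) (i + 1) j β := by
  obtain ⟨m, hm⟩ := h.base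
  have h1 := h.sum; have h2 := h.le_i; have h3 := h.le_j
  have hm2 : 2 * m * w = β := by rw [hm]; ring
  have hm3 : (2 * m + 1) * w = β + w := by rw [← hm2]; ring
  have hL : ∀ i', i ≤ i' → i' < β + w → i' < N → key (p i) ≤ key (p i') := fun i' h₁ h₂ h₃ =>
    hp i i' h₁ h₃ ((div_eq_of_block (m := 2 * m) (by omega) (by omega)).trans
      (div_eq_of_block (by omega) (by omega)).symm)
  have hR : ∀ j', j ≤ j' → j' < β + 2 * w → j' < N → key (p i) ≤ key (p j') := fun j' h₁ h₂ h₃ =>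
    (hle (by omega) (by omega)).trans (hp j j' h₁ h₃
      ((div_eq_of_block (m := 2 * m + 1) (by omega) (by omega)).trans
        (div_eq_of_block (by omega) (by omega)).symm))
  refine ⟨h.base, by omega, by omega, by omega, h3, h.j_le, h.j_bound, by omega, ?_, ?_, ?_, ?_⟩
  · exact image_push h.image fun a => by omega
  · refine sorted_push h.sorted fun a ha e => h.left a ?_ ha i le_rfl hi (by omega)
    have := (block_of_div_eq (by omega) (e.trans (div_eq_of_block (m := m) (by omega)
      (by omega)))).1
    omega
  · intro a ha ha' i' h₁ h₂ h₃
    exact frontier_push (P := fun i' => i ≤ i' ∧ i' < β + w ∧ i' < N) (f := p)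
      (fun a h₁ h₂ i' h₃ => h.left a h₁ h₂ i' h₃.1 h₃.2.1 h₃.2.2)
      (fun i' h₃ => hL i' h₃.1 h₃.2.1 h₃.2.2) a ha ha' i' ⟨by omega, h₂, h₃⟩
  · intro a ha ha' j' h₁ h₂ h₃
    exact frontier_push (P := fun i' => j ≤ i' ∧ i' < β + 2 * w ∧ i' < N) (f := p)
      (fun a h₁ h₂ i' h₃ => h.right a h₁ h₂ i' h₃.1 h₃.2.1 h₃.2.2)
      (fun i' h₃ => hR i' h₃.1 h₃.2.1 h₃.2.2) a ha ha' j' ⟨by omega, h₂, h₃⟩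

theorem takeRight (h : MergeInv key p B N w k i j β) (hp : SortedBlocks key p N w) (hk : k < N)
    (hj : j < β + 2 * w) (hjN : j < N)
    (hle : i < β + w → key (p j) ≤ key (p i)) :
    MergeInv key p (Function.update B k (p j)) N w (k + 1) i (j + 1) β := by
  obtain ⟨m, hm⟩ := h.base
  have h1 := h.sum; have h2 := h.le_i; have h3 := h.le_j; have h4 := h.i_le
  have hm2 : 2 * m * w = β := by rw [hm]; ring
  have hm3 : (2 * m + 1) * w = β + w := by rw [← hm2]; ring
  have hL : ∀ i', i ≤ i' → i' < β + w → i' < N → key (p j) ≤ key (p i') := fun i' h₁ h₂ h₃ =>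
    (hle (by omega)).trans (hp i i' h₁ h₃
      ((div_eq_of_block (m := 2 * m) (by omega) (by omega)).trans
        (div_eq_of_block (by omega) (by omega)).symm))
  have hR : ∀ j', j ≤ j' → j' < β + 2 * w → j' < N → key (p j) ≤ key (p j') := fun j' h₁ h₂ h₃ =>
    hp j j' h₁ h₃ ((div_eq_of_block (m := 2 * m + 1) (by omega) (by omega)).trans
      (div_eq_of_block (by omega) (by omega)).symm)
  refine ⟨h.base, by omega, h2, h4, by omega, by omega, by omega, by omega, ?_, ?_, ?_, ?_⟩
  · exact image_push h.image fun a => by omega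
  · refine sorted_push h.sorted fun a ha e => h.right a ?_ ha j le_rfl hj (by omega)
    have := (block_of_div_eq (by omega) (e.trans (div_eq_of_block (m := m) (by omega)
      (by omega)))).1
    omega
  · intro a ha ha' i' h₁ h₂ h₃
    exact frontier_push (P := fun i' => i ≤ i' ∧ i' < β + w ∧ i' < N) (f := p)
      (fun a h₁ h₂ i' h₃ => h.left a h₁ h₂ i' h₃.1 h₃.2.1 h₃.2.2)
      (fun i' h₃ => hL i' h₃.1 h₃.2.1 h₃.2.2) a ha ha' i' ⟨by omega, h₂, h₃⟩
  · intro a ha ha' j' h₁ h₂ h₃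
    exact frontier_push (P := fun i' => j ≤ i' ∧ i' < β + 2 * w ∧ i' < N) (f := p)
      (fun a h₁ h₂ i' h₃ => h.right a h₁ h₂ i' h₃.1 h₃.2.1 h₃.2.2)
      (fun i' h₃ => hR i' h₃.1 h₃.2.1 h₃.2.2) a ha ha' j' ⟨by omega, h₂, h₃⟩

end MergeInv

/-- Merges the blocks of length `w` (word register `3`) of word array `4` in pairs into word array
`5`; one step writes the cell `k` (word register `2`). -/
def mergeStep (K : ℕ) : Program :=
  .ite (.ile (.add (.reg 6) (.mul (.lit 2) (.reg 3))) (.reg 2))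
    (.iset 6 (.reg 2) ;; .iset 4 (.reg 2) ;; .iset 5 (.add (.reg 2) (.reg 3))) .skip ;;
  .ite (.and (.ilt (.reg 4) (.add (.reg 6) (.reg 3)))
      (.not (.and (.and (.ilt (.reg 5) (.add (.reg 6) (.mul (.lit 2) (.reg 3))))
        (.ilt (.reg 5) (.reg 1)))
        (.rlt (.get K (.get 4 (.reg 5))) (.get K (.get 4 (.reg 4)))))))
    (.iput 5 (.reg 2) (.get 4 (.reg 4)) ;; .iset 4 (.add (.reg 4) (.lit 1)))
    (.iput 5 (.reg 2) (.get 4 (.reg 5)) ;; .iset 5 (.add (.reg 5) (.lit 1))) ;;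
  .iset 2 (.add (.reg 2) (.lit 1))

/-- Copies cell `k` of word array `5` to word array `4`. -/
def copyStep : Program :=
  .iput 4 (.reg 2) (.get 5 (.reg 2)) ;; .iset 2 (.add (.reg 2) (.lit 1))

def mergeInit : Program :=
  .iset 6 (.lit 0) ;; .iset 4 (.lit 0) ;; .iset 5 (.reg 3) ;; .iset 2 (.lit 0)

def mergePass (K : ℕ) : Program :=
  mergeInit ;; .loop (.ilt (.reg 2) (.reg 1)) (mergeStep K) ;;
  .iset 2 (.lit 0) ;; .loop (.ilt (.reg 2) (.reg 1)) copyStep ;;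
  .iset 3 (.mul (.lit 2) (.reg 3))

def identityStep : Program :=
  .iput 4 (.reg 2) (.reg 2) ;; .iset 2 (.add (.reg 2) (.lit 1))

/-- Merge sort: makes word array `4` a permutation of `{0, …, N - 1}` (`N` in word register `1`)
that sorts the real array `K`. -/
def sortProg (K : ℕ) : Program :=
  .iset 2 (.lit 0) ;; .loop (.ilt (.reg 2) (.reg 1)) identityStep ;;
  .iset 3 (.lit 1) ;; .loop (.ilt (.reg 3) (.reg 1)) (mergePass K)

theorem mergeStep_spec {W K w : ℕ} {s : State} {p : ℕ → ℕ} {N : ℕ} (hW : 4 * N < W)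
    (h1 : s.iv 1 = N) (h3 : s.iv 3 = w) (hw : 0 < w) (hwN : w < N) (h4 : s.ia 4 = p)
    (hp : SortedBlocks (s.ra K) p N w) (hpl : ∀ a < N, p a < N)
    (hk : s.iv 2 < N) (h : MergeInv (s.ra K) p (s.ia 5) N w (s.iv 2) (s.iv 4) (s.iv 5) (s.iv 6)) :
    (mergeStep K).wp W (fun s' =>
      MergeInv (s.ra K) p (s'.ia 5) N w (s'.iv 2) (s'.iv 4) (s'.iv 5) (s'.iv 6) ∧
        s'.iv 2 = s.iv 2 + 1) s := by
  -- The comparison is the same whether or not a new pair of blocks has just been entered, so it is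
  -- treated for arbitrary `i`, `j` and `β`.
  have key : ∀ {i j β}, MergeInv (s.ra K) p (s.ia 5) N w (s.iv 2) i j β → s.iv 2 < β + 2 * w →
      ((i < β + w ∧ ¬((j < β + 2 * w ∧ j < N) ∧ s.ra K (p j) < s.ra K (p i))) →
        p i < W ∧ i + 1 < W ∧ s.iv 2 + 1 < W ∧ MergeInv (s.ra K) p
          (Function.update (s.ia 5) (s.iv 2) (p i)) N w (s.iv 2 + 1) (i + 1) j β ∧ True) ∧
      (¬(i < β + w ∧ ¬((j < β + 2 * w ∧ j < N) ∧ s.ra K (p j) < s.ra K (p i))) →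
        p j < W ∧ j + 1 < W ∧ s.iv 2 + 1 < W ∧ MergeInv (s.ra K) p
          (Function.update (s.ia 5) (s.iv 2) (p j)) N w (s.iv 2 + 1) i (j + 1) β ∧ True) := by
    intro i j β h hlt
    have e1 := h.sum; have e2 := h.le_i; have e3 := h.i_le; have e4 := h.le_j; have e5 := h.j_le
    constructor
    · rintro ⟨h₁, h₂⟩
      have := hpl i (by omega)
      exact ⟨by omega, by omega, by omega, h.takeLeft hp hk hlt h₁
        fun h₃ h₄ => not_lt.1 fun h₅ => h₂ ⟨⟨h₃, h₄⟩, h₅⟩, trivial⟩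
    · intro h₁
      have hj : j < N ∧ j < β + 2 * w := by
        by_cases hi : i < β + w
        · have h₂ : (j < β + 2 * w ∧ j < N) ∧ s.ra K (p j) < s.ra K (p i) := by
            by_contra h₂; exact h₁ ⟨hi, h₂⟩
          exact h₂.1.symm
        · omega
      have := hpl j hj.1
      refine ⟨by omega, by omega, by omega, h.takeRight hp hk hj.2 hj.1 fun hi => ?_, trivial⟩
      by_contra h₂
      exact h₁ ⟨hi, fun h₃ => h₂ h₃.2.le⟩
  simp only [mergeStep, Program.wp, Test.holds, IExp.eval, RExp.eval, Function.update_self,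
    Function.update_apply, reduceIte, Nat.reduceEqDiff, h1, h3, h4]
  refine ⟨fun hb => ⟨by omega, by omega, by omega, key (h.next hb) (by omega)⟩,
    fun hb => key h (by omega)⟩

/-- The state between two passes of the merge sort. -/
structure PassInv (key : ℕ → ℝ) (p : ℕ → ℕ) (N w : ℕ) : Prop where
  perm : IsPermOn p N
  sorted : SortedBlocks key p N w

theorem IsPermOn.lt {p : ℕ → ℕ} {N a : ℕ} (h : IsPermOn p N) (ha : a < N) : p a < N :=
  (h _).1 ⟨a, ha, rfl⟩

theorem PassInv.congr {key : ℕ → ℝ} {p p' : ℕ → ℕ} {N w : ℕ} (h : PassInv key p N w)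
    (hp : ∀ a < N, p' a = p a) : PassInv key p' N w where
  perm x := by
    rw [← h.perm x]
    refine exists_congr fun a => and_congr_right fun ha => ?_
    rw [hp a ha]
  sorted a b hab hb e := by
    rw [hp a (by omega), hp b hb]
    exact h.sorted a b hab hb e

theorem MergeInv.finish {key : ℕ → ℝ} {p B : ℕ → ℕ} {N w i j β : ℕ} (hp : IsPermOn p N)
    (h : MergeInv key p B N w N i j β) :
    PassInv key B N (2 * w) where
  perm x := by
    rw [h.image x, ← hp x]
    -- Either the right block was never touched, and then `i = N`, or `j ≤ N` forces `i = β + w` and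
    -- `j = N`. In both cases exactly the cells below `N` have been consumed.
    have hj := h.j_bound
    have e1 := h.sum; have e2 := h.i_le; have e3 := h.le_j; have e5 := h.j_le; have e6 := h.le_i
    constructor
    · rintro ⟨a, ha, hx⟩
      exact ⟨a, by omega, hx⟩
    · rintro ⟨a, ha, hx⟩
      exact ⟨a, by omega, hx⟩
  sorted := h.sorted

end MergeSort
end RealRAM

namespace RealRAM
section MergeSort

def passCost (K N : ℕ) : ℕ :=
  mergeInit.maxCost + ((N + 1) * iterCost (.ilt (.reg 2) (.reg 1)) (mergeStep K) +
    (Program.maxCost (.iset 2 (.lit 0)) + ((N + 1) * iterCost (.ilt (.reg 2) (.reg 1)) copyStep +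
      Program.maxCost (.iset 3 (.mul (.lit 2) (.reg 3))))))

theorem mergePass_spec {W K N w : ℕ} {s : State} (hW : 4 * N < W)
    (h1 : s.iv 1 = N) (h3 : s.iv 3 = w) (hw : 0 < w) (hwN : w < N)
    (hp : PassInv (s.ra K) (s.ia 4) N w) :
    Tri W (mergePass K) s (passCost K N) fun s' =>
      PassInv (s.ra K) (s'.ia 4) N (2 * w) ∧ s'.iv 3 = 2 * w := by
  refine Tri.seq (R := fun s' => MergeInv (s.ra K) (s.ia 4) (s'.ia 5) N w (s'.iv 2) (s'.iv 4)
      (s'.iv 5) (s'.iv 6) ∧ s'.iv 2 = 0) (Tri.of_wp ?_) fun s₁ f₁ hs₁ => ?_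
  · simp only [mergeInit, Program.wp, IExp.eval, Function.update_apply, reduceIte,
      Nat.reduceEqDiff, h3]
    exact ⟨by omega, by omega, by omega, by omega, MergeInv.init, trivial⟩
  have g1 : s₁.iv 1 = N := (f₁.iv 1 rfl).trans h1
  have g3 : s₁.iv 3 = w := (f₁.iv 3 rfl).trans h3
  have g4 : s₁.ia 4 = s.ia 4 := f₁.ia 4 rfl
  have gK : s₁.ra K = s.ra K := f₁.ra K rfl
  refine Tri.seq (R := fun s' => MergeInv (s.ra K) (s.ia 4) (s'.ia 5) N w N (s'.iv 4)
      (s'.iv 5) (s'.iv 6)) ((Tri.loop (fun s' => MergeInv (s.ra K) (s.ia 4) (s'.ia 5) N w (s'.iv 2)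
      (s'.iv 4) (s'.iv 5) (s'.iv 6)) (fun s' => N - s'.iv 2) hs₁.1
      fun s₂ f₂ hI hb => ?_).mono (Nat.mul_le_mul_right _ (by omega)) fun s' f' hs' => ?_)
      fun s₂ f₂ hs₂ => ?_
  · have g1' := (f₂.iv 1 rfl).trans g1
    have g4' := (f₂.ia 4 rfl).trans g4
    have gK' : s₂.ra K = s.ra K := (f₂.ra K rfl).trans gK
    simp only [Test.holds, IExp.eval, g1'] at hb
    have := mergeStep_spec (K := K) hW g1' ((f₂.iv 3 rfl).trans g3) hw hwN g4' (by rw [gK']; exact hp.sorted)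
      (fun a ha => hp.perm.lt ha) hb (by rw [gK']; exact hI)
    rw [gK'] at this
    refine Program.wp_mono this fun s' hs' => ⟨hs'.1, ?_⟩
    rw [hs'.2]; omega
  · have := hs'.2
    simp only [Test.holds, IExp.eval, (f'.iv 1 rfl).trans g1, not_lt] at this
    have e : s'.iv 2 = N := le_antisymm hs'.1.k_le this
    rw [← e]
    rw [e]
    exact e ▸ hs'.1
  have h5 := MergeInv.finish hp.perm hs₂
  have k1 : s₂.iv 1 = N := (f₂.iv 1 rfl).trans g1
  have k3 : s₂.iv 3 = w := (f₂.iv 3 rfl).trans g3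
  refine Tri.seq (R := fun s' => s'.iv 2 = 0) (Tri.of_wp ?_) fun s₃ f₃ hs₃ => ?_
  · simp only [Program.wp, IExp.eval, Function.update_self]
    exact ⟨by omega, trivial⟩
  have l1 : s₃.iv 1 = N := (f₃.iv 1 rfl).trans k1
  have l3 : s₃.iv 3 = w := (f₃.iv 3 rfl).trans k3
  have l5 : s₃.ia 5 = s₂.ia 5 := f₃.ia 5 rfl
  refine Tri.seq (Tri.count_loop (fun k s' => ∀ a < k, s'.ia 4 a = s₂.ia 5 a) hs₃ l1 rfl (by simp)
    fun k hk s₄ f₄ hk' _ hI => ?_) fun s₄ f₄ hs₄ => ?_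
  · have g5 := (f₄.ia 5 rfl).trans l5
    simp only [copyStep, Program.wp, IExp.eval, Function.update_apply, reduceIte, hk', g5]
    refine ⟨?_, by omega, trivial, fun a ha => ?_⟩
    · have := h5.perm.lt hk; omega
    · split_ifs with h
      · rw [h]
      · exact hI a (by omega)
  refine Tri.of_wp ?_
  simp only [Program.wp, IExp.eval, Function.update_self, (f₄.iv 3 rfl).trans l3]
  exact ⟨by omega, h5.congr hs₄, trivial⟩

/-- The time for the merge sort of `N ≤ 2 ^ l` cells. -/
def sortCost (K N l : ℕ) : ℕ :=
  Program.maxCost (.iset 2 (.lit 0)) + ((N + 1) * iterCost (.ilt (.reg 2) (.reg 1)) identityStep +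
    (Program.maxCost (.iset 3 (.lit 1)) +
      (l * (passCost K N + (Test.ilt (.reg 3) (.reg 1)).cost + 1) +
        (Test.ilt (.reg 3) (.reg 1)).cost + 1)))

theorem sortProg_spec {W K N l : ℕ} {s : State} (hW : 4 * N + 1 < W) (h1 : s.iv 1 = N)
    (hl : N ≤ 2 ^ l) :
    Tri W (sortProg K) s (sortCost K N l) fun s' => IsPermOn (s'.ia 4) N ∧
      ∀ a b, a ≤ b → b < N → s.ra K (s'.ia 4 a) ≤ s.ra K (s'.ia 4 b) := by
  refine Tri.seq (R := fun s' => s'.iv 2 = 0) (Tri.of_wp ?_) fun s₁ f₁ hs₁ => ?_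
  · simp only [Program.wp, IExp.eval, Function.update_self]
    exact ⟨by omega, trivial⟩
  have g1 : s₁.iv 1 = N := (f₁.iv 1 rfl).trans h1
  refine Tri.seq (Tri.count_loop (fun k s' => ∀ a < k, s'.ia 4 a = a) hs₁ g1 rfl (by simp)
    fun k hk s₂ f₂ hk' _ hI => ?_) fun s₂ f₂ hs₂ => ?_
  · simp only [identityStep, Program.wp, IExp.eval, Function.update_apply, reduceIte, hk']
    refine ⟨by omega, by omega, trivial, fun a ha => ?_⟩
    split_ifs with h
    · rw [h]
    · exact hI a (by omega)
  have gK : s₂.ra K = s.ra K := (f₂.ra K rfl).trans (f₁.ra K rfl)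
  refine Tri.seq (R := fun s' => s'.iv 3 = 1) (Tri.of_wp ?_) fun s₃ f₃ hs₃ => ?_
  · simp only [Program.wp, IExp.eval, Function.update_self]
    exact ⟨by omega, trivial⟩
  have k1 : s₃.iv 1 = N := (f₃.iv 1 rfl).trans ((f₂.iv 1 rfl).trans g1)
  have kK : s₃.ra K = s.ra K := (f₃.ra K rfl).trans gK
  -- The potential pays for one pass per doubling of the block length that is still possible up to
  -- `2 ^ l`.
  refine (Tri.loop_potential (fun s' => ∃ m, s'.iv 3 = 2 ^ m ∧ PassInv (s.ra K) (s'.ia 4) N (2 ^ m))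
    (fun s' => (l - Nat.log 2 (s'.iv 3)) * (passCost K N + (Test.ilt (.reg 3) (.reg 1)).cost + 1))
    ⟨0, hs₃, ?_⟩ fun s₄ f₄ hI hb =>
    ⟨passCost K N, ?_⟩).mono ?_ fun s' f' hs' => ?_
  · rw [f₃.ia 4 rfl]
    refine ⟨fun x => ⟨fun ⟨a, ha, hx⟩ => ?_, fun hx => ⟨x, hx, hs₂ x hx⟩⟩, fun a b hab hb e => ?_⟩
    · rw [← hx, hs₂ a ha]; exact ha
    · rw [pow_zero, Nat.div_one, Nat.div_one] at e
      rw [e]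
  · obtain ⟨m, hm, hI⟩ := hI
    have g1' := (f₄.iv 1 rfl).trans k1
    have gK' := (f₄.ra K rfl).trans kK
    simp only [Test.holds, IExp.eval, g1', hm] at hb
    refine (mergePass_spec (K := K) (w := 2 ^ m) (by omega) g1' hm (by positivity) hb (by rw [gK']; exact hI)).mono le_rfl
      fun s' f' hs' => ⟨⟨m + 1, ?_, ?_⟩, ?_⟩
    · rw [hs'.2, pow_succ, Nat.mul_comm]
    · rw [pow_succ, Nat.mul_comm, ← gK']; exact hs'.1
    · have hml : m < l := (Nat.pow_lt_pow_iff_right (by norm_num)).1 (hb.trans_le hl)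
      have e : 2 * 2 ^ m = 2 ^ (m + 1) := by rw [pow_succ, Nat.mul_comm]
      rw [hs'.2, hm, e, Nat.log_pow (by norm_num), Nat.log_pow (by norm_num)]
      obtain ⟨d, rfl⟩ := Nat.exists_eq_add_of_lt hml
      rw [show m + d + 1 - (m + 1) = d by omega, show m + d + 1 - m = d + 1 by omega, Nat.add_mul d,
        one_mul]
      omega
  · rw [hs₃, Nat.log_one_right, Nat.sub_zero]
  · obtain ⟨⟨m, hm, hI⟩, hb⟩ := hs'
    simp only [Test.holds, IExp.eval, (f'.iv 1 rfl).trans k1, hm, not_lt] at hb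
    refine ⟨hI.perm, fun a b hab hb' => hI.sorted a b hab hb' ?_⟩
    rw [Nat.div_eq_of_lt (by omega), Nat.div_eq_of_lt (by omega)]

end MergeSort
end RealRAM

namespace RealRAM
-- From the input to the table of breakpoints, slopes and intercepts.
section Convert

/-- The memory holds the input `P`. -/
structure HoldsInput {c n : ℕ} (P : Fin n → Histogram c) (s : State) : Prop where
  size : s.iv 0 = n
  pieces : ∀ i : Fin n, s.ia 0 i = (P i).k
  pt : ∀ (i : Fin n) (j : ℕ), j ≤ (P i).k → s.ra 0 (i * c + j) = (P i).pt j
  ht : ∀ (i : Fin n) (j : ℕ), j < (P i).k → s.ra 1 (i * c + j) = (P i).ht j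

theorem holdsInput_inputState {c n : ℕ} (P : Fin n → Histogram c) :
    HoldsInput P (inputState P) where
  size := by simp [inputState]
  pieces i := by simp [inputState]
  pt i j hj := by
    have hk := (P i).k_lt
    have h1 : (i * c + j) / c = i := mul_add_div_eq (by omega)
    have h2 : (i * c + j) % c = j := mul_add_mod_eq (by omega)
    have e : ∀ i', i' = i → ∀ h : j < (P i').k + 1, (P i').x ⟨j, h⟩ = (P i).pt j := by
      rintro _ rfl _
      exact congrArg (P _).x (Fin.ext (min_eq_left hj).symm)
    simp only [inputState, h1, h2, i.2, dif_pos, Fin.eta, if_true, Nat.lt_succ_of_le hj]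
    exact e _ (Fin.ext h1) _
  ht i j hj := by
    have hk := (P i).k_lt
    have h1 : (i * c + j) / c = i := mul_add_div_eq (by omega)
    have h2 : (i * c + j) % c = j := mul_add_mod_eq (by omega)
    have e : ∀ i', i' = i → ∀ h : j < (P i').k, (P i').y ⟨j, h⟩ = (P i).y ⟨j, hj⟩ := by
      rintro _ rfl _; rfl
    simp only [inputState, h1, h2, i.2, dif_pos, Fin.eta, hj, one_ne_zero, if_false, Histogram.ht,
      if_true]
    exact e _ (Fin.ext h1) _

/-- Real register `0` becomes the smallest and real register `1` the largest breakpoint of the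
points seen so far. -/
def rangeStep (c : ℕ) : Program :=
  .rset 5 (.get 0 (.mul (.reg 2) (.lit c))) ;;
  .ite (.rlt (.reg 5) (.reg 0)) (.rset 0 (.reg 5)) .skip ;;
  .rset 5 (.get 0 (.add (.mul (.reg 2) (.lit c)) (.get 0 (.reg 2)))) ;;
  .ite (.rlt (.reg 1) (.reg 5)) (.rset 1 (.reg 5)) .skip ;;
  .iset 2 (.add (.reg 2) (.lit 1))

/-- Writes a breakpoint and its copy at distance `D` (real register `2`). -/
def fillStep (c : ℕ) : Program :=
  .iset 3 (.div (.reg 2) (.lit c)) ;;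
  .iset 4 (.sub (.reg 2) (.mul (.reg 3) (.lit c))) ;;
  .ite (.ile (.reg 4) (.lit 0))
    (.rset 3 (.lit 0) ;; .rset 4 (.get 0 (.reg 2)))
    (.ite (.ile (.reg 4) (.get 0 (.reg 3)))
      (.rset 3 (.add (.reg 3) (.mul (.get 1 (.sub (.reg 2) (.lit 1)))
        (.sub (.get 0 (.reg 2)) (.reg 4)))) ;; .rset 4 (.get 0 (.reg 2))) .skip) ;;
  .rput 2 (.add (.mul (.reg 3) (.lit (2 * c))) (.reg 4)) (.reg 4) ;;
  .rput 3 (.add (.mul (.reg 3) (.lit (2 * c))) (.reg 4)) (.reg 3) ;;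
  .rput 2 (.add (.mul (.reg 3) (.lit (2 * c))) (.add (.lit c) (.reg 4)))
    (.add (.reg 4) (.reg 2)) ;;
  .rput 3 (.add (.mul (.reg 3) (.lit (2 * c))) (.add (.lit c) (.reg 4)))
    (.sub (.lit 1) (.reg 3)) ;;
  .iset 2 (.add (.reg 2) (.lit 1))

/-- Writes slope and intercept of a piece. -/
def slopeStep : Program :=
  .rput 4 (.reg 2) (.div (.sub (.get 3 (.add (.reg 2) (.lit 1))) (.get 3 (.reg 2)))
    (.sub (.get 2 (.add (.reg 2) (.lit 1))) (.get 2 (.reg 2)))) ;;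
  .rput 5 (.reg 2) (.sub (.get 3 (.reg 2)) (.mul (.get 4 (.reg 2)) (.get 2 (.reg 2)))) ;;
  .iset 2 (.add (.reg 2) (.lit 1))

def rangeInit : Program :=
  .rset 0 (.get 0 (.lit 0)) ;; .rset 1 (.get 0 (.get 0 (.lit 0))) ;; .iset 2 (.lit 0)

def fillInit (c : ℕ) : Program :=
  .rset 2 (.sub (.reg 1) (.reg 0)) ;; .iset 1 (.mul (.reg 0) (.lit (2 * c))) ;;
  .iset 7 (.mul (.reg 0) (.lit c)) ;; .iset 2 (.lit 0)

/-- Computes breakpoints, slopes and intercepts of all pieces. -/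
def convertProg (c : ℕ) : Program :=
  rangeInit ;; .loop (.ilt (.reg 2) (.reg 0)) (rangeStep c) ;;
  fillInit c ;; .loop (.ilt (.reg 2) (.reg 7)) (fillStep c) ;;
  .iset 2 (.lit 0) ;; .loop (.ilt (.reg 2) (.reg 1)) slopeStep

def convertCost (c n : ℕ) : ℕ :=
  rangeInit.maxCost + ((n + 1) * iterCost (.ilt (.reg 2) (.reg 0)) (rangeStep c) +
    ((fillInit c).maxCost + ((n * c + 1) * iterCost (.ilt (.reg 2) (.reg 7)) (fillStep c) +
      (Program.maxCost (.iset 2 (.lit 0)) +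
        (n * (2 * c) + 1) * iterCost (.ilt (.reg 2) (.reg 1)) slopeStep))))

variable {c n : ℕ} {P : Fin n → Histogram c}

/-- All breakpoints lie between `lo` and `hi`. -/
def InRange (P : Fin n → Histogram c) (lo hi : ℝ) : Prop :=
  ∀ i, lo ≤ (P i).pt 0 ∧ (P i).pt (P i).k ≤ hi

theorem rangeStep_spec {W i : ℕ} {s : State} (h : HoldsInput P s) (hi : i < n) (h2 : s.iv 2 = i)
    (hW : n < W) (hJ : ∀ i' : Fin n, (i' : ℕ) < i → s.rv 0 ≤ (P i').pt 0 ∧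
      (P i').pt (P i').k ≤ s.rv 1) :
    (rangeStep c).wp W (fun s' => s'.iv 2 = i + 1 ∧ ∀ i' : Fin n, (i' : ℕ) < i + 1 →
      s'.rv 0 ≤ (P i').pt 0 ∧ (P i').pt (P i').k ≤ s'.rv 1) s := by
  have e1 := h.pt ⟨i, hi⟩ 0 (Nat.zero_le _)
  have e2 := h.pt ⟨i, hi⟩ _ le_rfl
  have e3 := h.pieces ⟨i, hi⟩
  simp only [add_zero] at e1 e2 e3
  have key : ∀ lo hi', (lo ≤ s.rv 0 ∧ lo ≤ (P ⟨i, hi⟩).pt 0) →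
      (s.rv 1 ≤ hi' ∧ (P ⟨i, hi⟩).pt (P ⟨i, hi⟩).k ≤ hi') →
      ∀ i' : Fin n, (i' : ℕ) < i + 1 → lo ≤ (P i').pt 0 ∧ (P i').pt (P i').k ≤ hi' := by
    intro lo hi' h₁ h₂ i' hi''
    rcases Nat.lt_succ_iff_lt_or_eq.1 hi'' with h₃ | h₃
    · exact ⟨h₁.1.trans (hJ i' h₃).1, (hJ i' h₃).2.trans h₂.1⟩
    · obtain rfl : i' = ⟨i, hi⟩ := Fin.ext h₃
      exact ⟨h₁.2, h₂.2⟩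
  simp only [rangeStep, Program.wp, Test.holds, IExp.eval, RExp.eval, Function.update_apply,
    reduceIte, Nat.reduceEqDiff, h2, e1, e2, e3]
  refine ⟨fun a => ⟨fun b => ⟨by omega, trivial, key _ _ ?_ ?_⟩,
      fun b => ⟨by omega, trivial, key _ _ ?_ ?_⟩⟩,
    fun a => ⟨fun b => ⟨by omega, trivial, key _ _ ?_ ?_⟩,
      fun b => ⟨by omega, trivial, key _ _ ?_ ?_⟩⟩⟩ <;>
  first
  | exact ⟨a.le, le_rfl⟩
  | exact ⟨b.le, le_rfl⟩
  | exact ⟨le_rfl, not_lt.1 a⟩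
  | exact ⟨le_rfl, not_lt.1 b⟩

/-- The breakpoints with numbers less than `u` are written. -/
structure Filled (P : Fin n → Histogram c) (D : ℝ) (s : State) (u : ℕ) : Prop where
  cells : ∀ (i : Fin n) (j : ℕ), j < c → i * c + j < u →
    s.ra 2 (i * (2 * c) + j) = (P i).pt j ∧
    s.ra 3 (i * (2 * c) + j) = (P i).cdf ((P i).pt j) ∧
    s.ra 2 (i * (2 * c) + (c + j)) = (P i).pt j + D ∧
    s.ra 3 (i * (2 * c) + (c + j)) = 1 - (P i).cdf ((P i).pt j)
  regs : ∀ (i : Fin n) (j : ℕ), j + 1 < c → u = i * c + (j + 1) →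
    s.rv 4 = (P i).pt j ∧ s.rv 3 = (P i).cdf ((P i).pt j)
  empty : ∀ q, n * (2 * c) ≤ q → s.ra 2 q = 0 ∧ s.ra 3 q = 0

theorem Filled.step {D : ℝ} {s s' : State} {i : Fin n} {j : ℕ}
    (h : Filled P D s (i * c + j)) (hj : j < c)
    (h4 : s'.rv 4 = (P i).pt j) (h3 : s'.rv 3 = (P i).cdf ((P i).pt j))
    (hx : s'.ra 2 = Function.update (Function.update (s.ra 2) (i * (2 * c) + j) ((P i).pt j))
      (i * (2 * c) + (c + j)) ((P i).pt j + D))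
    (hy : s'.ra 3 = Function.update (Function.update (s.ra 3) (i * (2 * c) + j)
      ((P i).cdf ((P i).pt j))) (i * (2 * c) + (c + j)) (1 - (P i).cdf ((P i).pt j))) :
    Filled P D s' (i * c + j + 1) where
  cells i' j' hj' hlt := by
    have inj : ∀ {a b : ℕ}, a < 2 * c → b < 2 * c → (i' : ℕ) * (2 * c) + a = i * (2 * c) + b →
        i' = i ∧ a = b := by
      intro a b ha hb e
      have e1 := congrArg (· / (2 * c)) e
      have e2 := congrArg (· % (2 * c)) e
      simp only [mul_add_div_eq ha, mul_add_div_eq hb] at e1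
      simp only [mul_add_mod_eq ha, mul_add_mod_eq hb] at e2
      exact ⟨Fin.ext e1, e2⟩
    rw [hx, hy]
    by_cases hij : i' = i ∧ j' = j
    · obtain ⟨rfl, rfl⟩ := hij
      have hne : (i' : ℕ) * (2 * c) + j' ≠ i' * (2 * c) + (c + j') := by omega
      simp only [Function.update_self, Function.update_of_ne hne, true_and]
    · have hne : ¬ (i' : ℕ) * (2 * c) + j' = i * (2 * c) + j := fun e =>
        hij (inj (by omega) (by omega) e)
      have hne2 : ¬ (i' : ℕ) * (2 * c) + j' = i * (2 * c) + (c + j) := fun e => by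
        have := inj (by omega) (by omega) e; omega
      have hne3 : ¬ (i' : ℕ) * (2 * c) + (c + j') = i * (2 * c) + j := fun e => by
        have := inj (by omega) (by omega) e; omega
      have hne4 : ¬ (i' : ℕ) * (2 * c) + (c + j') = i * (2 * c) + (c + j) := fun e => by
        have := inj (by omega) (by omega) e
        exact hij ⟨this.1, by omega⟩
      have hlt' : (i' : ℕ) * c + j' < i * c + j := by
        rcases Nat.lt_succ_iff_lt_or_eq.1 hlt with h1 | h1
        · exact h1
        · refine absurd ?_ hij
          have e1 := congrArg (· / c) h1
          have e2 := congrArg (· % c) h1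
          simp only [mul_add_div_eq hj, mul_add_div_eq hj'] at e1
          simp only [mul_add_mod_eq hj, mul_add_mod_eq hj'] at e2
          exact ⟨Fin.ext e1, e2⟩
      simp only [Function.update_apply, hne, hne2, hne3, hne4, if_false]
      exact h.cells i' j' hj' hlt'
  regs i' j' hj' e := by
    have h1 : (i : ℕ) * c + j = i' * c + j' := by omega
    have e1 := congrArg (· / c) h1
    have e2 := congrArg (· % c) h1
    simp only [mul_add_div_eq hj, mul_add_div_eq (by omega : j' < c)] at e1
    simp only [mul_add_mod_eq hj, mul_add_mod_eq (by omega : j' < c)] at e2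
    obtain rfl : i = i' := Fin.ext e1
    subst e2
    exact ⟨h4, h3⟩
  empty q hq := by
    have hi : ((i : ℕ) + 1) * (2 * c) ≤ n * (2 * c) := Nat.mul_le_mul_right _ i.2
    rw [Nat.add_mul, one_mul] at hi
    have n1 : q ≠ i * (2 * c) + (c + j) := by omega
    have n2 : q ≠ i * (2 * c) + j := by omega
    rw [hx, hy, Function.update_of_ne n1, Function.update_of_ne n2, Function.update_of_ne n1,
      Function.update_of_ne n2]
    exact h.empty q hq

theorem Filled.allPt_eq {D : ℝ} {s : State} (hc : 2 ≤ c) (h : Filled P D s (n * c)) (q : ℕ) :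
    s.ra 2 q = allPt P D q ∧ s.ra 3 q = allVal P q := by
  by_cases hq : q / (2 * c) < n
  · have hm : q % (2 * c) < 2 * c := Nat.mod_lt _ (by omega)
    have e : q = q / (2 * c) * (2 * c) + q % (2 * c) := (Nat.div_add_mod' q _).symm
    have hi : ∀ j < c, (q / (2 * c)) * c + j < n * c := fun j hj => by
      have := Nat.mul_le_mul_right c hq
      rw [Nat.succ_mul] at this
      omega
    simp only [allPt, allVal, hq, dif_pos, Histogram.bumpPt, Histogram.bumpVal]
    by_cases hj : q % (2 * c) < c
    · have := h.cells ⟨_, hq⟩ _ hj (hi _ hj)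
      simp only [← e] at this
      simp only [hj, if_true]
      exact ⟨this.1, this.2.1⟩
    · have hj' : q % (2 * c) - c < c := by omega
      have := h.cells ⟨_, hq⟩ _ hj' (hi _ hj')
      rw [Nat.add_sub_of_le (not_lt.1 hj)] at this
      simp only [← e] at this
      simp only [hj, if_false]
      exact ⟨this.2.2.1, this.2.2.2⟩
  · simp only [allPt, allVal, hq, dif_neg, not_false_eq_true]
    rw [not_lt, Nat.le_div_iff_mul_le (by omega)] at hq
    exact h.empty q hq

/-- Two real registers keep the previous breakpoint and the value of `cdf` there, so `cdf` at the
next breakpoint costs one multiplication. For `j > k` they are left unchanged, which produces the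
padding by repeated breakpoints. -/
theorem fillStep_spec {W u : ℕ} {D : ℝ} {s : State} (hc : 2 ≤ c) (h : HoldsInput P s)
    (hW : n * (2 * c) < W) (hu : u < n * c) (h2 : s.iv 2 = u) (hD : s.rv 2 = D)
    (hJ : Filled P D s u) :
    (fillStep c).wp W (fun s' => s'.iv 2 = u + 1 ∧ Filled P D s' (u + 1)) s := by
  obtain ⟨i, j, hj, rfl⟩ : ∃ (i : Fin n) (j : ℕ), j < c ∧ u = i * c + j :=
    ⟨⟨u / c, (Nat.div_lt_iff_lt_mul (by omega)).2 hu⟩, u % c, Nat.mod_lt _ (by omega),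
      (Nat.div_add_mod' u c).symm⟩
  have e1 : ((i : ℕ) * c + j) / c = i := mul_add_div_eq hj
  have e2 : (i : ℕ) * c + j - i * c = j := by omega
  have e3 := h.pieces i
  have hle : (i : ℕ) * c + j + 1 < W := by
    have : n * (2 * c) = n * c + n * c := by ring
    omega
  have hiW : (i : ℕ) < W := by
    have : (i : ℕ) ≤ i * c := Nat.le_mul_of_pos_right _ (by omega)
    omega
  simp only [fillStep, Program.wp, Test.holds, IExp.eval, RExp.eval, Function.update_apply,
    reduceIte, Nat.reduceEqDiff, h2, e1, e2, e3, hD]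
  refine ⟨hiW, by omega, fun h0 => ⟨hle, trivial, ?_⟩, fun h0 => ⟨fun hk => ⟨hle, trivial, ?_⟩,
    fun hk => ⟨hle, trivial, ?_⟩⟩⟩
  · obtain rfl : j = 0 := by omega
    have e4 := h.pt i 0 (Nat.zero_le _)
    have e5 : (P i).cdf ((P i).pt 0) = 0 := (P i).cdf_of_le le_rfl
    rw [add_zero] at e4
    refine hJ.step hj e4 ?_ ?_ ?_ <;> simp [e4, e5]
  · obtain ⟨m, rfl⟩ := Nat.exists_eq_succ_of_ne_zero (by omega : j ≠ 0)
    have e4 := h.pt i (m + 1) hk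
    have e5 := h.ht i m (by omega)
    have e6 : (i : ℕ) * c + (m + 1) - 1 = i * c + m := by omega
    have e7 := (P i).cdf_pt_succ m
    obtain ⟨r1, r2⟩ := hJ.regs i m hj rfl
    refine hJ.step hj e4 ?_ ?_ ?_ <;> simp [e4, e5, e6, e7, r1, r2]
  · obtain ⟨m, rfl⟩ := Nat.exists_eq_succ_of_ne_zero (by omega : j ≠ 0)
    have e4 : (P i).pt (m + 1) = (P i).pt m := by
      rw [(P i).pt_of_le (by omega : (P i).k ≤ m + 1), (P i).pt_of_le (by omega : (P i).k ≤ m)]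
    obtain ⟨r1, r2⟩ := hJ.regs i m hj rfl
    refine hJ.step hj ?_ ?_ ?_ ?_ <;> simp [e4, r1, r2]

theorem HoldsInput.congr {s s' : State} (h : HoldsInput P s) (h0 : s'.iv 0 = s.iv 0)
    (h1 : s'.ia 0 = s.ia 0) (h2 : s'.ra 0 = s.ra 0) (h3 : s'.ra 1 = s.ra 1) : HoldsInput P s' where
  size := h0.trans h.size
  pieces := by rw [h1]; exact h.pieces
  pt := by rw [h2]; exact h.pt
  ht := by rw [h3]; exact h.ht

/-- The pieces of the functions `allBump` are stored. -/
structure HoldsPieces (P : Fin n → Histogram c) (D : ℝ) (s : State) : Prop where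
  size : s.iv 1 = n * (2 * c)
  pt : s.ra 2 = allPt P D
  slope : ∀ q < n * (2 * c), s.ra 4 q = allSlope P D q
  icpt : ∀ q < n * (2 * c), s.ra 5 q = allIcpt P D q

/-- The arrays `2` and `3` have to be empty at the beginning because the slope of the very last
piece reads one cell beyond the table, where `allPt` and `allVal` are `0`. -/
theorem convertProg_spec {W : ℕ} {s : State} (hc : 2 ≤ c) (h : HoldsInput P s)
    (he : ∀ q, s.ra 2 q = 0 ∧ s.ra 3 q = 0) (hW : n * (2 * c) < W) :
    Tri W (convertProg c) s (convertCost c n) fun s' =>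
      InRange P (s'.rv 0) (s'.rv 1) ∧ s'.rv 2 = s'.rv 1 - s'.rv 0 ∧
        HoldsPieces P (s'.rv 2) s' := by
  have hnW : n * c ≤ n * (2 * c) := Nat.mul_le_mul_left _ (by omega)
  have hnW' : n ≤ n * c := Nat.le_mul_of_pos_right _ (by omega)
  refine Tri.seq (R := fun s' => s'.iv 2 = 0) (Tri.of_wp ?_) fun s₁ f₁ hs₁ => ?_
  · simp only [rangeInit, Program.wp, IExp.eval, Function.update_self]
    exact ⟨by omega, trivial⟩
  have H₁ : HoldsInput P s₁ := h.congr (f₁.iv 0 rfl) (f₁.ia 0 rfl) (f₁.ra 0 rfl) (f₁.ra 1 rfl)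
  refine Tri.seq (Tri.count_loop (fun i s' => ∀ i' : Fin n, (i' : ℕ) < i → s'.rv 0 ≤ (P i').pt 0 ∧
      (P i').pt (P i').k ≤ s'.rv 1) hs₁ H₁.size rfl (by simp) fun i hi s₂ f₂ h2 _ hI => ?_)
      fun s₂ f₂ hs₂ => ?_
  · exact rangeStep_spec (H₁.congr (f₂.iv 0 rfl) (f₂.ia 0 rfl) (f₂.ra 0 rfl) (f₂.ra 1 rfl)) hi h2 (by omega) hI
  have H₂ : HoldsInput P s₂ := H₁.congr (f₂.iv 0 rfl) (f₂.ia 0 rfl) (f₂.ra 0 rfl) (f₂.ra 1 rfl)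
  refine Tri.seq (R := fun s' => s'.iv 2 = 0 ∧ s'.iv 7 = n * c ∧ s'.iv 1 = n * (2 * c) ∧
    s'.rv 2 = s'.rv 1 - s'.rv 0) (Tri.of_wp ?_) fun s₃ f₃ hs₃ => ?_
  · simp only [fillInit, Program.wp, IExp.eval, RExp.eval, Function.update_apply, reduceIte,
      Nat.reduceEqDiff, H₂.size]
    exact ⟨by omega, by omega, by omega, trivial, trivial, trivial, trivial⟩
  have H₃ : HoldsInput P s₃ := H₂.congr (f₃.iv 0 rfl) (f₃.ia 0 rfl) (f₃.ra 0 rfl) (f₃.ra 1 rfl)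
  obtain ⟨g2, g7, g1, gD⟩ := hs₃
  have hR : InRange P (s₃.rv 0) (s₃.rv 1) := by
    rw [f₃.rv 0 rfl, f₃.rv 1 rfl]
    exact fun i => hs₂ i i.2
  have e2 : s₃.ra 2 = s.ra 2 := (f₃.ra 2 rfl).trans ((f₂.ra 2 rfl).trans (f₁.ra 2 rfl))
  have e3 : s₃.ra 3 = s.ra 3 := (f₃.ra 3 rfl).trans ((f₂.ra 3 rfl).trans (f₁.ra 3 rfl))
  refine Tri.seq (Tri.count_loop (fun u s' => Filled P (s₃.rv 2) s' u) g2 g7 rfl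
      ⟨by intros; omega, by intros; omega, fun q _ => by rw [e2, e3]; exact he q⟩
      fun u hu s₄ f₄ h2 _ hI => ?_) fun s₄ f₄ hs₄ => ?_
  · exact fillStep_spec hc (H₃.congr (f₄.iv 0 rfl) (f₄.ia 0 rfl) (f₄.ra 0 rfl) (f₄.ra 1 rfl)) hW hu
      h2 (f₄.rv 2 rfl) hI
  have hcells := hs₄.allPt_eq hc
  refine Tri.seq (R := fun s' => s'.iv 2 = 0) (Tri.of_wp ?_) fun s₅ f₅ hs₅ => ?_
  · simp only [Program.wp, IExp.eval, Function.update_self]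
    exact ⟨by omega, trivial⟩
  have k1 : s₅.iv 1 = n * (2 * c) := (f₅.iv 1 rfl).trans ((f₄.iv 1 rfl).trans g1)
  have k2 : s₅.ra 2 = s₄.ra 2 := f₅.ra 2 rfl
  have k3 : s₅.ra 3 = s₄.ra 3 := f₅.ra 3 rfl
  refine (Tri.count_loop (fun u s' => ∀ q < u, s'.ra 4 q = allSlope P (s₃.rv 2) q ∧
      s'.ra 5 q = allIcpt P (s₃.rv 2) q) hs₅ k1 rfl (by simp) fun u hu s₆ f₆ h2 _ hI => ?_).mono
      le_rfl fun s₆ f₆ hs₆ => ?_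
  · have l2 := (f₆.ra 2 rfl).trans k2
    have l3 := (f₆.ra 3 rfl).trans k3
    simp only [slopeStep, Program.wp, IExp.eval, RExp.eval, Function.update_apply, reduceIte,
      Nat.reduceEqDiff, h2, l2, l3, (hcells _).1, (hcells _).2]
    refine ⟨by omega, trivial, fun q hq => ?_⟩
    by_cases e : q = u
    · subst e
      simp [allIcpt, allSlope]
    · simp only [e, if_false]
      exact hI q (by omega)
  · have r0 : s₆.rv 0 = s₃.rv 0 := (f₆.rv 0 rfl).trans ((f₅.rv 0 rfl).trans (f₄.rv 0 rfl))
    have r1 : s₆.rv 1 = s₃.rv 1 := (f₆.rv 1 rfl).trans ((f₅.rv 1 rfl).trans (f₄.rv 1 rfl))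
    have r2 : s₆.rv 2 = s₃.rv 2 := (f₆.rv 2 rfl).trans ((f₅.rv 2 rfl).trans (f₄.rv 2 rfl))
    rw [r0, r1, r2]
    refine ⟨hR, gD, (f₆.iv 1 rfl).trans k1, ?_, fun q hq => (hs₆ q hq).1, fun q hq => (hs₆ q hq).2⟩
    rw [f₆.ra 2 rfl, k2]
    exact funext fun q => (hcells q).1

end Convert
end RealRAM

namespace RealRAM
-- Ranks of the breakpoints and the size of the tree.
section Ranks

/-- `px r` is the breakpoint of rank `r`, `xs r` its abscissa, `rk` the inverse of `px`. -/
structure Ranking (N : ℕ) (bx : ℕ → ℝ) (px rk : ℕ → ℕ) (xs : ℕ → ℝ) : Prop where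
  perm : IsPermOn px N
  rk_px : ∀ r < N, rk (px r) = r
  rk_last : rk N = 0
  xs_eq : ∀ r < N, xs r = bx (px r)
  mono : ∀ a b, a ≤ b → b < N → xs a ≤ xs b

/-- A surjection of a finite set onto itself is injective. -/
theorem IsPermOn.inj {p : ℕ → ℕ} {N a b : ℕ} (h : IsPermOn p N) (ha : a < N) (hb : b < N)
    (e : p a = p b) : a = b := by
  have him : (Finset.range N).image p = Finset.range N := by
    ext x
    simpa using h x
  exact Finset.injOn_of_card_image_eq (by rw [him]) (Finset.mem_coe.2 (Finset.mem_range.2 ha))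
    (Finset.mem_coe.2 (Finset.mem_range.2 hb)) e

namespace Ranking

variable {N : ℕ} {bx xs : ℕ → ℝ} {px rk : ℕ → ℕ}

theorem px_rk (h : Ranking N bx px rk xs) {q : ℕ} (hq : q < N) : px (rk q) = q := by
  obtain ⟨r, hr, rfl⟩ := (h.perm q).2 hq
  rw [h.rk_px r hr]

theorem rk_lt (h : Ranking N bx px rk xs) (hN : 0 < N) {q : ℕ} (hq : q ≤ N) : rk q < N := by
  rcases hq.eq_or_lt with rfl | hq
  · rw [h.rk_last]; exact hN
  · obtain ⟨r, hr, rfl⟩ := (h.perm q).2 hq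
    rwa [h.rk_px r hr]

theorem xs_rk (h : Ranking N bx px rk xs) {q : ℕ} (hq : q < N) : xs (rk q) = bx q := by
  rw [h.xs_eq _ (h.rk_lt (by omega) hq.le), h.px_rk hq]

end Ranking

def rankStep : Program :=
  .iput 2 (.reg 2) (.get 4 (.reg 2)) ;;
  .iput 6 (.get 4 (.reg 2)) (.reg 2) ;;
  .rput 6 (.reg 2) (.get 2 (.get 4 (.reg 2))) ;;
  .iset 2 (.add (.reg 2) (.lit 1))

/-- Stores the order of the breakpoints given by word array `4`. -/
def rankProg : Program :=
  .iset 2 (.lit 0) ;; .loop (.ilt (.reg 2) (.reg 1)) rankStep ;; .iput 6 (.reg 1) (.lit 0)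

def rankCost (N : ℕ) : ℕ :=
  Program.maxCost (.iset 2 (.lit 0)) + ((N + 1) * iterCost (.ilt (.reg 2) (.reg 1)) rankStep +
    Program.maxCost (.iput 6 (.reg 1) (.lit 0)))

/-- The cell `N` of the rank table is set to `0`: the piece `N - 1` has no right breakpoint, and
with right rank `0` it passes over no node. -/
theorem rankProg_spec {W N : ℕ} {s : State} (hW : N + 1 < W) (h1 : s.iv 1 = N)
    (hp : IsPermOn (s.ia 4) N)
    (hs : ∀ a b, a ≤ b → b < N → s.ra 2 (s.ia 4 a) ≤ s.ra 2 (s.ia 4 b)) :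
    Tri W rankProg s (rankCost N) fun s' =>
      Ranking N (s.ra 2) (s'.ia 2) (s'.ia 6) (s'.ra 6) := by
  refine Tri.seq (R := fun s' => s'.iv 2 = 0) (Tri.of_wp ?_) fun s₁ f₁ hs₁ => ?_
  · simp only [Program.wp, IExp.eval, Function.update_self]
    exact ⟨by omega, trivial⟩
  have g1 : s₁.iv 1 = N := (f₁.iv 1 rfl).trans h1
  have g4 : s₁.ia 4 = s.ia 4 := f₁.ia 4 rfl
  have g2 : s₁.ra 2 = s.ra 2 := f₁.ra 2 rfl
  refine Tri.seq (Tri.count_loop (fun k s' => ∀ r < k, s'.ia 2 r = s.ia 4 r ∧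
      s'.ia 6 (s.ia 4 r) = r ∧ s'.ra 6 r = s.ra 2 (s.ia 4 r)) hs₁ g1 rfl (by simp)
      fun k hk s₂ f₂ hk' _ hI => ?_) fun s₂ f₂ hs₂ => ?_
  · have k4 := (f₂.ia 4 rfl).trans g4
    have k2 := (f₂.ra 2 rfl).trans g2
    simp only [rankStep, Program.wp, IExp.eval, RExp.eval, Function.update_apply, reduceIte,
      Nat.reduceEqDiff, hk', k4, k2]
    have := hp.lt hk
    refine ⟨by omega, by omega, by omega, trivial, fun r hr => ?_⟩
    by_cases e : r = k
    · subst e; simp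
    · have hne : ¬ s.ia 4 r = s.ia 4 k := fun h => e (hp.inj (by omega) hk h)
      simp only [e, hne, if_false]
      exact hI r (by omega)
  refine (Tri.of_wp (Q := fun s' => s'.ia 6 = Function.update (s₂.ia 6) N 0) ?_).mono le_rfl
    fun s₃ f₃ hs₃ => ?_
  · simp only [Program.wp, IExp.eval, Function.update_self, (f₂.iv 1 rfl).trans g1]
    exact ⟨by omega, trivial⟩
  have e2 : s₃.ia 2 = s₂.ia 2 := f₃.ia 2 rfl
  have e6 : s₃.ra 6 = s₂.ra 6 := f₃.ra 6 rfl
  rw [hs₃, e2, e6]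
  have e4 : ∀ r < N, s₂.ia 2 r = s.ia 4 r := fun r hr => (hs₂ r hr).1
  refine ⟨fun x => ?_, fun r hr => ?_, Function.update_self .., fun r hr => ?_,
    fun a b hab hb => ?_⟩
  · rw [← hp x]
    exact exists_congr fun a => and_congr_right fun ha => by rw [e4 a ha]
  · rw [e4 r hr, Function.update_of_ne (hp.lt hr).ne]
    exact (hs₂ r hr).2.1
  · rw [e4 r hr]
    exact (hs₂ r hr).2.2
  · rw [(hs₂ a (by omega)).2.2, (hs₂ b hb).2.2]
    exact hs a b hab hb

def sizeInit : Program := .iset 3 (.lit 1) ;; .iset 4 (.lit 2)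

def sizeStep : Program := .iset 4 (.mul (.lit 2) (.reg 4)) ;; .iset 3 (.add (.reg 3) (.lit 1))

/-- Computes a power of two that is not less than `N`. -/
def sizeProg : Program :=
  sizeInit ;; .loop (.ilt (.reg 4) (.reg 1)) sizeStep ;; .iset 7 (.mul (.lit 2) (.reg 4))

def sizeCost (l : ℕ) : ℕ :=
  sizeInit.maxCost + ((l + 1) * iterCost (.ilt (.reg 4) (.reg 1)) sizeStep +
    Program.maxCost (.iset 7 (.mul (.lit 2) (.reg 4))))

/-- `T = 2 ^ L` is roughly `N`. -/
structure TreeSize (N L T : ℕ) : Prop where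
  eq : T = 2 ^ L
  pos : 1 ≤ L
  le : N ≤ T
  ge : T ≤ 2 * N

/-- The search starts with `2 ^ 1` rather than `2 ^ 0` to have `1 ≤ L`. Since the power is doubled
only while it is less than `N`, it stays at most `2 * N`. -/
theorem sizeProg_spec {W N l : ℕ} {s : State} (hN : 0 < N) (hW : 4 * N < W) (h1 : s.iv 1 = N)
    (hl : N ≤ 2 ^ l) (hl1 : 1 ≤ l) :
    Tri W sizeProg s (sizeCost l) fun s' => TreeSize N (s'.iv 3) (s'.iv 4) ∧ s'.iv 3 ≤ l ∧
      s'.iv 7 = 2 * s'.iv 4 := by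
  refine Tri.seq (R := fun s' => s'.iv 3 = 1 ∧ s'.iv 4 = 2) (Tri.of_wp ?_) fun s₁ f₁ hs₁ => ?_
  · simp only [sizeInit, Program.wp, IExp.eval, Function.update_apply, reduceIte,
      Nat.reduceEqDiff]
    exact ⟨by omega, by omega, trivial, trivial⟩
  have g1 : s₁.iv 1 = N := (f₁.iv 1 rfl).trans h1
  refine Tri.seq (R := fun s' => TreeSize N (s'.iv 3) (s'.iv 4) ∧ s'.iv 3 ≤ l) ((Tri.loop
      (fun s' => s'.iv 4 = 2 ^ s'.iv 3 ∧ 1 ≤ s'.iv 3 ∧ s'.iv 4 ≤ 2 * N ∧ s'.iv 3 ≤ l)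
      (fun s' => l - s'.iv 3) (by rw [hs₁.1, hs₁.2]; omega) fun s₂ f₂ hI hb => ?_).mono
      (Nat.mul_le_mul_right _ (by omega)) fun s' f' hs' => ?_) fun s₂ f₂ hs₂ => ?_
  · obtain ⟨h4, h3, hle, h3l⟩ := hI
    simp only [Test.holds, IExp.eval, (f₂.iv 1 rfl).trans g1] at hb
    have hlt : s₂.iv 3 < l := by
      rw [h4] at hb
      exact (Nat.pow_lt_pow_iff_right (by norm_num)).1 (hb.trans_le hl)
    have hl2 : s₂.iv 3 < 2 ^ s₂.iv 3 := Nat.lt_two_pow_self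
    simp only [sizeStep, Program.wp, IExp.eval, Function.update_apply, reduceIte,
      Nat.reduceEqDiff]
    refine ⟨by omega, by omega, ⟨by rw [h4, pow_succ, Nat.mul_comm], by omega, by omega, by omega⟩,
      by omega⟩
  · obtain ⟨⟨h4, h3, hle, h3l⟩, hb⟩ := hs'
    simp only [Test.holds, IExp.eval, (f'.iv 1 rfl).trans g1, not_lt] at hb
    exact ⟨⟨h4, h3, hb, hle⟩, h3l⟩
  refine Tri.of_wp ?_
  have := hs₂.1.ge
  simp only [Program.wp, IExp.eval, Function.update_apply, reduceIte, Nat.reduceEqDiff]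
  exact ⟨by omega, hs₂.1, hs₂.2, trivial⟩

end Ranks

/-! ### Distribution of the pieces to the nodes next to their ends. -/

section Buckets

/-- The piece `q` passes over the node `g` of the tree; the children of `g` are `2 * g` and
`2 * g + 1`, and the root `1` has `T` ranks. -/
def NodeSpans (N T : ℕ) (rk : ℕ → ℕ) (g q : ℕ) : Prop :=
  Spans N rk (T / 2 ^ Nat.log 2 g) (g - 2 ^ Nat.log 2 g) q

theorem log_two_add {l v : ℕ} (hv : v < 2 ^ l) : Nat.log 2 (2 ^ l + v) = l :=
  Nat.log_eq_of_pow_le_of_lt_pow (by omega) (by rw [pow_succ]; omega)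

theorem nodeSpans_add {N T l v q : ℕ} {rk : ℕ → ℕ} (hv : v < 2 ^ l) :
    NodeSpans N T rk (2 ^ l + v) q ↔ Spans N rk (T / 2 ^ l) v q := by
  rw [NodeSpans, log_two_add hv, Nat.add_sub_cancel_left]

/-- The lists `db (0 * Z + g), …, db ((dc g - 1) * Z + g)` of pieces that pass over `g`, in the
order of their slopes; `b` is a bound for the slopes and `m` for the total length. -/
structure Buckets (N T Z : ℕ) (rk : ℕ → ℕ) (sl : ℕ → ℝ) (dc db : ℕ → ℕ) (b : ℝ) (m : ℕ) :
    Prop where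
  lt : ∀ g, 0 < dc g → g < Z
  mem : ∀ g d, d < dc g → NodeSpans N T rk g (db (d * Z + g))
  sorted : ∀ g d d', d ≤ d' → d' < dc g → sl (db (d * Z + g)) ≤ sl (db (d' * Z + g))
  le : ∀ g d, d < dc g → sl (db (d * Z + g)) ≤ b
  total : ∑ g ∈ Finset.range Z, dc g ≤ m

variable {N T Z : ℕ} {rk : ℕ → ℕ} {sl : ℕ → ℝ} {dc db : ℕ → ℕ} {b : ℝ} {m : ℕ}

/-- A table with a row for each list position and a column for each node is stored with stride `Z`.
Such an address is only computed and never stored as a word, so it is not subject to the word bound.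
-/
theorem cell_inj {d d' g g' Z : ℕ} (hg : g < Z) (hg' : g' < Z) (e : d * Z + g = d' * Z + g') :
    d = d' ∧ g = g' := by
  have e1 := congrArg (· / Z) e
  have e2 := congrArg (· % Z) e
  simp only [mul_add_div_eq hg, mul_add_div_eq hg'] at e1
  simp only [mul_add_mod_eq hg, mul_add_mod_eq hg'] at e2
  exact ⟨e1, e2⟩

namespace Buckets

theorem mono (h : Buckets N T Z rk sl dc db b m) {b' : ℝ} {m' : ℕ}
    (hb : (∃ g, 0 < dc g) → b ≤ b') (hm : m ≤ m') : Buckets N T Z rk sl dc db b' m' :=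
  ⟨h.lt, h.mem, h.sorted, fun g d hd => (h.le g d hd).trans (hb ⟨g, by omega⟩), h.total.trans hm⟩

variable {q g : ℕ}

theorem append_cell (h : Buckets N T Z rk sl dc db b m) (hg : g < Z) {g' d : ℕ}
    (hd : d < dc g') : Function.update db (dc g * Z + g) q (d * Z + g') = db (d * Z + g') := by
  refine Function.update_of_ne (fun e => ?_) _ _
  obtain ⟨rfl, rfl⟩ := cell_inj (h.lt g' (by omega)) hg e
  exact lt_irrefl _ hd

theorem append (h : Buckets N T Z rk sl dc db b m) (hg : g < Z) (hq : NodeSpans N T rk g q)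
    (hb : sl q = b) : Buckets N T Z rk sl (Function.update dc g (dc g + 1))
      (Function.update db (dc g * Z + g) q) b (m + 1) := by
  have key : ∀ g' d, d < Function.update dc g (dc g + 1) g' →
      (d < dc g' ∧ Function.update db (dc g * Z + g) q (d * Z + g') = db (d * Z + g')) ∨
      (g' = g ∧ d = dc g ∧ Function.update db (dc g * Z + g) q (d * Z + g') = q) := by
    intro g' d hd
    by_cases e : g' = g
    · subst e
      rw [Function.update_self] at hd
      rcases Nat.lt_succ_iff_lt_or_eq.1 hd with h1 | h1
      · exact Or.inl ⟨h1, h.append_cell hg h1⟩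
      · exact Or.inr ⟨rfl, h1, by rw [h1, Function.update_self]⟩
    · rw [Function.update_of_ne e] at hd
      exact Or.inl ⟨hd, h.append_cell hg hd⟩
  refine ⟨fun g' hg' => ?_, fun g' d hd => ?_, fun g' d d' hdd hd' => ?_, fun g' d hd => ?_, ?_⟩
  · rcases key g' 0 hg' with h1 | h1
    · exact h.lt g' h1.1
    · rw [h1.1]; exact hg
  · rcases key g' d hd with ⟨h1, h2⟩ | ⟨h1, h2, h3⟩
    · rw [h2]; exact h.mem g' d h1
    · rw [h3, h1]; exact hq
  · rcases key g' d' hd' with ⟨h1, h2⟩ | ⟨h1, h2, h3⟩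
    · rw [h2, h.append_cell hg (hdd.trans_lt h1)]
      exact h.sorted g' d d' hdd h1
    · rw [h3]
      rcases key g' d (hdd.trans_lt hd') with ⟨h4, h5⟩ | ⟨h4, h5, h6⟩
      · rw [h5, hb]; exact h.le g' d h4
      · rw [h6]
  · rcases key g' d hd with ⟨h1, h2⟩ | ⟨h1, h2, h3⟩
    · rw [h2]; exact h.le g' d h1
    · rw [h3, hb]
  · rw [Finset.sum_update_of_mem (Finset.mem_range.2 hg)]
    have := h.total
    rw [Finset.sum_eq_add_sum_sdiff_singleton_of_mem (Finset.mem_range.2 hg)] at this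
    omega

theorem mem_append (h : Buckets N T Z rk sl dc db b m) (hg : g < Z) {g' q' : ℕ}
    (hq' : (∃ d < dc g', db (d * Z + g') = q') ∨ g' = g ∧ q' = q) :
    ∃ d < Function.update dc g (dc g + 1) g',
      Function.update db (dc g * Z + g) q (d * Z + g') = q' := by
  rcases hq' with ⟨d, hd, e⟩ | ⟨rfl, rfl⟩
  · refine ⟨d, ?_, by rw [h.append_cell hg hd, e]⟩
    by_cases e' : g' = g
    · subst e'; rw [Function.update_self]; omega
    · rwa [Function.update_of_ne e']
  · exact ⟨dc g', by rw [Function.update_self]; omega, by rw [Function.update_self]⟩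

theorem dc_le (h : Buckets N T Z rk sl dc db b m) (g : ℕ) : dc g ≤ m := by
  rcases Nat.eq_zero_or_pos (dc g) with h0 | h0
  · omega
  · exact (Finset.single_le_sum (f := dc) (fun _ _ => Nat.zero_le _)
      (Finset.mem_range.2 (h.lt g h0))).trans h.total

end Buckets

end Buckets
end RealRAM

namespace RealRAM
section Buckets

/-- Appends the piece in word register `8` to the list of the node in word register `11`. -/
def appendProg : Program :=
  .iput 8 (.add (.mul (.get 7 (.reg 11)) (.reg 7)) (.reg 11)) (.reg 8) ;;
  .iput 7 (.reg 11) (.add (.get 7 (.reg 11)) (.lit 1))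

/-- Word register `2`: position `t` in the order of slopes, `5` and `6`: number of nodes and size of
the nodes of the level. -/
def bucketStep : Program :=
  .ite (.ile (.reg 3) (.reg 6))
    (.iset 8 (.get 4 (.reg 2)) ;;
      .iset 9 (.div (.get 6 (.reg 8)) (.reg 6)) ;;
      .iset 10 (.div (.get 6 (.add (.reg 8) (.lit 1))) (.reg 6)) ;;
      .ite (.ilt (.add (.reg 9) (.lit 1)) (.reg 10))
        (.iset 11 (.add (.reg 5) (.add (.reg 9) (.lit 1))) ;; appendProg ;;
          .iset 11 (.add (.reg 5) (.sub (.reg 10) (.lit 1))) ;; appendProg) .skip ;;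
      .iset 5 (.mul (.lit 2) (.reg 5)) ;; .iset 6 (.div (.reg 6) (.lit 2)))
    (.iset 2 (.add (.reg 2) (.lit 1)) ;; .iset 5 (.lit 1) ;; .iset 6 (.reg 4))

def bucketInit : Program := .iset 2 (.lit 0) ;; .iset 5 (.lit 1) ;; .iset 6 (.reg 4)

/-- Distributes the pieces to the nodes of the tree next to their ends. -/
def bucketProg : Program := bucketInit ;; .loop (.ilt (.reg 2) (.reg 1)) bucketStep

def bucketCost (N L : ℕ) : ℕ :=
  bucketInit.maxCost + (N * (L + 3) + 1) * iterCost (.ilt (.reg 2) (.reg 1)) bucketStep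

/-- The piece `q` is in the lists of the nodes of level `l` next to its ends. -/
def InBuckets (T Z : ℕ) (rk dc db : ℕ → ℕ) (l q : ℕ) : Prop :=
  rk q / (T / 2 ^ l) + 1 < rk (q + 1) / (T / 2 ^ l) →
    (∃ d < dc (2 ^ l + (rk q / (T / 2 ^ l) + 1)),
      db (d * Z + (2 ^ l + (rk q / (T / 2 ^ l) + 1))) = q) ∧
    (∃ d < dc (2 ^ l + (rk (q + 1) / (T / 2 ^ l) - 1)),
      db (d * Z + (2 ^ l + (rk (q + 1) / (T / 2 ^ l) - 1))) = q)

/-- The lists after the levels `< l` of the piece `ps t` and all levels of the pieces before. -/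
structure BucketInv (N L T Z : ℕ) (rk ps : ℕ → ℕ) (sl : ℕ → ℝ) (dc db : ℕ → ℕ) (t l : ℕ) :
    Prop where
  lists : ∃ b, Buckets N T Z rk sl dc db b (2 * (t * (L + 2) + l)) ∧
    ∀ t', t ≤ t' → t' < N → b ≤ sl (ps t')
  complete : ∀ t' l', t' < N → (t' < t ∨ t' = t ∧ l' < l) → L ≤ T / 2 ^ l' →
    InBuckets T Z rk dc db l' (ps t')

variable {N L T Z : ℕ} {rk ps : ℕ → ℕ} {sl : ℕ → ℝ} {dc db : ℕ → ℕ} {t l : ℕ}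

/-- Node sizes decrease with the level. Once the nodes are smaller than `L`, nothing is demanded for
the remaining levels. -/
theorem BucketInv.nextPiece (h : BucketInv N L T Z rk ps sl dc db t l) (hl : ¬ L ≤ T / 2 ^ l)
    (hl' : l ≤ L + 2) : BucketInv N L T Z rk ps sl dc db (t + 1) 0 where
  lists := by
    obtain ⟨b, hb, hb'⟩ := h.lists
    refine ⟨b, hb.mono (fun _ => le_rfl) ?_, fun t' ht' => hb' t' (by omega)⟩
    rw [Nat.add_mul]; omega
  complete t' l' ht' hlt hL := by
    refine h.complete t' l' ht' ?_ hL
    rcases hlt with h1 | h1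
    · rcases Nat.lt_succ_iff_lt_or_eq.1 h1 with h2 | h2
      · exact Or.inl h2
      · refine Or.inr ⟨h2, ?_⟩
        by_contra h3
        refine hl (hL.trans (Nat.div_le_div_left ?_ (by positivity)))
        exact Nat.pow_le_pow_right (by norm_num) (not_lt.1 h3)
    · omega

theorem BucketInv.skip (h : BucketInv N L T Z rk ps sl dc db t l)
    (hq : ¬ rk (ps t) / (T / 2 ^ l) + 1 < rk (ps t + 1) / (T / 2 ^ l)) :
    BucketInv N L T Z rk ps sl dc db t (l + 1) where
  lists := by
    obtain ⟨b, hb, hb'⟩ := h.lists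
    exact ⟨b, hb.mono (fun _ => le_rfl) (by omega), hb'⟩
  complete t' l' ht' hlt hL := by
    by_cases e : t' = t ∧ l' = l
    · obtain ⟨rfl, rfl⟩ := e
      exact fun h => absurd h hq
    · exact h.complete t' l' ht' (by omega) hL

/-- The pieces arrive in the order of their slopes, so appending keeps each list sorted. The two
nodes may coincide; the piece then appears twice in the list, which is harmless for the envelope and
is included in the bound for the total length. -/
theorem BucketInv.push (h : BucketInv N L T Z rk ps sl dc db t l) (ht : t < N)
    (hps : ps t < N) (hsort : ∀ a b, a ≤ b → b < N → sl (ps a) ≤ sl (ps b)) {a b g₁ g₂ : ℕ}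
    (ha : a = rk (ps t) / (T / 2 ^ l)) (hb : b = rk (ps t + 1) / (T / 2 ^ l)) (hab : a + 1 < b)
    (hbl : b < 2 ^ l) (hZ : 2 ^ (l + 1) ≤ Z) (e₁ : g₁ = 2 ^ l + (a + 1))
    (e₂ : g₂ = 2 ^ l + (b - 1)) {dc' db' : ℕ → ℕ}
    (hdc : dc' = Function.update dc g₁ (dc g₁ + 1))
    (hdb : db' = Function.update db (dc g₁ * Z + g₁) (ps t)) :
    BucketInv N L T Z rk ps sl (Function.update dc' g₂ (dc' g₂ + 1))
      (Function.update db' (dc' g₂ * Z + g₂) (ps t)) t (l + 1) := by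
  obtain ⟨β, hβ, hβ'⟩ := h.lists
  have hpow : 2 ^ (l + 1) = 2 * 2 ^ l := by rw [pow_succ, Nat.mul_comm]
  have B₀ := hβ.mono (fun _ => hβ' t le_rfl ht) le_rfl
  have hg₁ : g₁ < Z := by omega
  have hg₂ : g₂ < Z := by omega
  have B₁ : Buckets N T Z rk sl dc' db' (sl (ps t)) (2 * (t * (L + 2) + l) + 1) := by
    rw [hdc, hdb]
    refine B₀.append hg₁ ?_ rfl
    rw [e₁, nodeSpans_add (by omega)]
    exact ⟨hps, by omega, by omega⟩
  have B₂ := B₁.append (q := ps t) hg₂ (by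
    rw [e₂, nodeSpans_add (by omega)]
    exact ⟨hps, by omega, by omega⟩) rfl
  refine ⟨⟨_, B₂.mono (fun _ => le_rfl) (by omega), fun t' h₁ h₂ => hsort t t' h₁ h₂⟩, ?_⟩
  intro t' l' ht' hlt hL hspan
  have two : ∀ g' q', ((∃ d < dc g', db (d * Z + g') = q') ∨ (g' = g₁ ∨ g' = g₂) ∧ q' = ps t) →
      ∃ d < Function.update dc' g₂ (dc' g₂ + 1) g',
        Function.update db' (dc' g₂ * Z + g₂) (ps t) (d * Z + g') = q' := by
    intro g' q' hh
    refine B₁.mem_append hg₂ ?_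
    rcases hh with hh | ⟨hh | hh, rfl⟩
    · exact Or.inl (by rw [hdc, hdb]; exact B₀.mem_append hg₁ (Or.inl hh))
    · exact Or.inl (by rw [hdc, hdb]; exact B₀.mem_append hg₁ (Or.inr ⟨hh, rfl⟩))
    · exact Or.inr ⟨hh, rfl⟩
  by_cases e : t' = t ∧ l' = l
  · obtain ⟨rfl, rfl⟩ := e
    rw [← ha, ← hb, ← e₁, ← e₂]
    exact ⟨two _ _ (Or.inr ⟨Or.inl rfl, rfl⟩), two _ _ (Or.inr ⟨Or.inr rfl, rfl⟩)⟩
  · obtain ⟨h1, h2⟩ := h.complete t' l' ht' (by omega) hL hspan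
    exact ⟨two _ _ (Or.inl h1), two _ _ (Or.inl h2)⟩

/-- The parameters of the tree in the registers, and the word size. -/
structure TreeState (W N L T Z : ℕ) (s : State) : Prop where
  word : 16 * ((N + 1) * (L + 3)) < W
  size : TreeSize N L T
  pos : 0 < N
  iv1 : s.iv 1 = N
  iv3 : s.iv 3 = L
  iv4 : s.iv 4 = T
  iv7 : s.iv 7 = Z
  eqZ : Z = 2 * T

theorem TreeState.congr {W : ℕ} {s s' : State} (h : TreeState W N L T Z s)
    (h1 : s'.iv 1 = s.iv 1) (h3 : s'.iv 3 = s.iv 3) (h4 : s'.iv 4 = s.iv 4)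
    (h7 : s'.iv 7 = s.iv 7) : TreeState W N L T Z s' :=
  ⟨h.word, h.size, h.pos, h1.trans h.iv1, h3.trans h.iv3, h4.trans h.iv4, h7.trans h.iv7, h.eqZ⟩

/-- Below level `L` the quotient `T / 2 ^ l` is `0`, which is less than `L` because `1 ≤ L`. Up to
level `L` the division is exact. -/
theorem TreeSize.level_le (h : TreeSize N L T) (hl : L ≤ T / 2 ^ l) :
    l ≤ L ∧ 2 ^ l * (T / 2 ^ l) = T := by
  have hlL : l ≤ L := by
    by_contra h1
    rw [h.eq, Nat.div_eq_of_lt (Nat.pow_lt_pow_right (by norm_num) (not_le.1 h1))] at hl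
    have := h.pos
    omega
  refine ⟨hlL, Nat.mul_div_cancel' ?_⟩
  rw [h.eq]
  exact pow_dvd_pow 2 hlL

theorem bucketStep_spec {W : ℕ} {s : State} (hs : TreeState W N L T Z s)
    (hrk : ∀ q ≤ N, s.ia 6 q < N) (hps : ∀ t < N, s.ia 4 t < N)
    (hsort : ∀ a b, a ≤ b → b < N → s.ra 4 (s.ia 4 a) ≤ s.ra 4 (s.ia 4 b))
    (ht : t < N) (h2 : s.iv 2 = t) (h5 : s.iv 5 = 2 ^ l) (h6 : s.iv 6 = T / 2 ^ l)
    (hl : l ≤ L + 1)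
    (hI : BucketInv N L T Z (s.ia 6) (s.ia 4) (s.ra 4) (s.ia 7) (s.ia 8) t l) :
    bucketStep.wp W (fun s' => ∃ t' l', s'.iv 2 = t' ∧ s'.iv 5 = 2 ^ l' ∧ s'.iv 6 = T / 2 ^ l' ∧
      l' ≤ L + 1 ∧ BucketInv N L T Z (s.ia 6) (s.ia 4) (s.ra 4) (s'.ia 7) (s'.ia 8) t' l' ∧
      (t' = t ∧ l' = l + 1 ∨ t' = t + 1 ∧ l' = 0)) s := by
  have hw := hs.word
  have hX : (N + 1) * (L + 3) = N * (L + 2) + N + L + 3 := by ring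
  have htL : t * (L + 2) + (L + 2) ≤ N * (L + 2) := by
    have := Nat.mul_le_mul_right (L + 2) ht
    rwa [Nat.succ_mul] at this
  have hT := hs.size.ge
  have hpt := hps t ht
  have hZ := hs.eqZ
  simp only [bucketStep, appendProg, Program.wp, Test.holds, IExp.eval, Function.update_self,
    ne_eq, Nat.reduceEqDiff, not_false_eq_true, Function.update_of_ne, h2, h5, h6, hs.iv3,
    hs.iv4, hs.iv7]
  refine ⟨fun hL => ?_, fun hL => ?_⟩
  · obtain ⟨hlL, hmul⟩ := hs.size.level_le hL
    have hS : 0 < T / 2 ^ l := by have := hs.size.pos; omega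
    have hpl : 2 ^ l ≤ T := by rw [hs.size.eq]; exact Nat.pow_le_pow_right (by norm_num) hlL
    have hpow : 2 ^ (l + 1) = 2 * 2 ^ l := by rw [pow_succ, Nat.mul_comm]
    have hlt : ∀ q ≤ N, s.ia 6 q / (T / 2 ^ l) < 2 ^ l := fun q hq =>
      (Nat.div_lt_iff_lt_mul hS).2 ((hrk q hq).trans_le (by rw [hmul]; exact hs.size.le))
    have ha := hlt (s.ia 4 t) hpt.le
    have hb := hlt (s.ia 4 t + 1) hpt
    have hhalf : T / 2 ^ l / 2 = T / 2 ^ (l + 1) := by rw [Nat.div_div_eq_div_mul, pow_succ]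
    have hdl : T / 2 ^ l / 2 ≤ T := (Nat.div_le_self _ _).trans (Nat.div_le_self _ _)
    obtain ⟨β, hβ, -⟩ := hI.lists
    have hdc := fun g => hβ.dc_le g
    refine ⟨by omega, by omega, by omega, fun hab => ?_, fun hab => ?_⟩
    · have key := hI.push ht hpt hsort rfl rfl hab hb (by omega) rfl rfl rfl rfl
      obtain ⟨β₂, hβ₂, -⟩ := key.lists
      have hdc₂ := hβ₂.dc_le (2 ^ l + (s.ia 6 (s.ia 4 t + 1) / (T / 2 ^ l) - 1))
      rw [Function.update_self] at hdc₂
      refine ⟨by omega, by omega, ?_, by omega, by omega, by omega, by omega, by omega,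
        t, l + 1, rfl, hpow.symm, hhalf, by omega, key, Or.inl ⟨rfl, rfl⟩⟩
      have := hdc (2 ^ l + (s.ia 6 (s.ia 4 t) / (T / 2 ^ l) + 1))
      omega
    · exact ⟨by omega, by omega, t, l + 1, rfl, hpow.symm, hhalf, by omega, hI.skip hab,
        Or.inl ⟨rfl, rfl⟩⟩
  · exact ⟨by omega, by omega, by omega, t + 1, 0, rfl, (pow_zero 2).symm,
      by rw [pow_zero, Nat.div_one], by omega, hI.nextPiece hL (by omega), Or.inr ⟨rfl, rfl⟩⟩

/-- The lists of all nodes of size at least `L` are complete. -/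
structure BucketsDone (N L T Z : ℕ) (rk : ℕ → ℕ) (sl : ℕ → ℝ) (dc db : ℕ → ℕ) : Prop where
  lists : ∃ b, Buckets N T Z rk sl dc db b (2 * ((N + 1) * (L + 2)))
  complete : ∀ l q, q < N → L ≤ T / 2 ^ l → InBuckets T Z rk dc db l q

theorem bucketProg_spec {W : ℕ} {s : State} (hs : TreeState W N L T Z s)
    (hrk : ∀ q ≤ N, s.ia 6 q < N) (hps : IsPermOn (s.ia 4) N)
    (hsort : ∀ a b, a ≤ b → b < N → s.ra 4 (s.ia 4 a) ≤ s.ra 4 (s.ia 4 b))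
    (h7 : ∀ g, s.ia 7 g = 0) :
    Tri W bucketProg s (bucketCost N L) fun s' =>
      BucketsDone N L T Z (s.ia 6) (s.ra 4) (s'.ia 7) (s'.ia 8) := by
  have hw := hs.word
  have hX : (N + 1) * (L + 3) = N * (L + 2) + N + L + 3 := by ring
  have hT := hs.size.ge
  refine Tri.seq (R := fun s' => s'.iv 2 = 0 ∧ s'.iv 5 = 1 ∧ s'.iv 6 = T) (Tri.of_wp ?_)
    fun s₁ f₁ hs₁ => ?_
  · simp only [bucketInit, Program.wp, IExp.eval, Function.update_apply, reduceIte,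
      Nat.reduceEqDiff, hs.iv4]
    exact ⟨by omega, by omega, by omega, trivial, trivial, trivial⟩
  have H₁ := hs.congr (f₁.iv 1 rfl) (f₁.iv 3 rfl) (f₁.iv 4 rfl) (f₁.iv 7 rfl)
  have g4 : s₁.ia 4 = s.ia 4 := f₁.ia 4 rfl
  have g6 : s₁.ia 6 = s.ia 6 := f₁.ia 6 rfl
  have gr4 : s₁.ra 4 = s.ra 4 := f₁.ra 4 rfl
  have g7 : ∀ g, s₁.ia 7 g = 0 := fun g => by rw [f₁.ia 7 rfl]; exact h7 g
  -- The measure allows `L + 3` steps for each piece. The level is recovered as the logarithm of the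
  -- number of nodes in word register `5`.
  refine (Tri.loop (fun s' => ∃ t l, t ≤ N ∧ s'.iv 2 = t ∧ s'.iv 5 = 2 ^ l ∧ s'.iv 6 = T / 2 ^ l ∧
      l ≤ L + 1 ∧ BucketInv N L T Z (s.ia 6) (s.ia 4) (s.ra 4) (s'.ia 7) (s'.ia 8) t l)
      (fun s' => (N - s'.iv 2) * (L + 3) - Nat.log 2 (s'.iv 5)) ?_ fun s₂ f₂ hI hb => ?_).mono
      (Nat.mul_le_mul_right _ ?_) fun s' f' hs' => ?_
  · refine ⟨0, 0, by omega, hs₁.1, hs₁.2.1, by rw [hs₁.2.2, pow_zero, Nat.div_one], by omega, ?_⟩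
    refine ⟨⟨s.ra 4 (s.ia 4 0), ?_, fun t' _ ht' => hsort 0 t' (by omega) ht'⟩, ?_⟩
    · refine ⟨fun g hg => ?_, fun g d hd => ?_, fun g d d' _ hd => ?_, fun g d hd => ?_, ?_⟩
      · rw [g7] at hg; omega
      · rw [g7] at hd; omega
      · rw [g7] at hd; omega
      · rw [g7] at hd; omega
      · simp [g7]
    · rintro t' l' - (h | ⟨-, h⟩) <;> omega
  · obtain ⟨t, l, -, h2, h5, h6, hl, hB⟩ := hI
    have H₂ := H₁.congr (f₂.iv 1 rfl) (f₂.iv 3 rfl) (f₂.iv 4 rfl) (f₂.iv 7 rfl)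
    have k4 := (f₂.ia 4 rfl).trans g4
    have k6 := (f₂.ia 6 rfl).trans g6
    have kr4 := (f₂.ra 4 rfl).trans gr4
    simp only [Test.holds, IExp.eval, H₂.iv1, h2] at hb
    have := bucketStep_spec H₂ (by rwa [k6]) (by rw [k4]; exact fun a ha => hps.lt ha)
      (by rwa [k4, kr4]) hb h2 h5 h6 hl (by rwa [k4, k6, kr4])
    refine Program.wp_mono this fun s' hs' => ?_
    obtain ⟨t', l', h2', h5', h6', hl', hB', hor⟩ := hs'
    rw [k4, k6, kr4] at hB'
    refine ⟨⟨t', l', by omega, h2', h5', h6', hl', hB'⟩, ?_⟩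
    rw [h2', h5', h2, h5, Nat.log_pow (by norm_num), Nat.log_pow (by norm_num)]
    obtain ⟨d, hd⟩ := Nat.exists_eq_add_of_lt hb
    have e1 : N - t = d + 1 := by omega
    rcases hor with ⟨rfl, rfl⟩ | ⟨rfl, rfl⟩
    · rw [e1, Nat.add_mul]; omega
    · rw [e1, show N - (t + 1) = d by omega, Nat.add_mul]; omega
  · rw [hs₁.1]; exact Nat.succ_le_succ (Nat.sub_le _ _)
  · obtain ⟨⟨t, l, htN, h2, -, -, hl, hB⟩, hb⟩ := hs'
    simp only [Test.holds, IExp.eval, (f'.iv 1 rfl).trans H₁.iv1, h2] at hb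
    obtain rfl : t = N := by omega
    obtain ⟨b, hb', -⟩ := hB.lists
    refine ⟨⟨b, hb'.mono (fun _ => le_rfl) (by rw [Nat.add_mul]; omega)⟩, fun l' q hq hL => ?_⟩
    obtain ⟨t', ht', rfl⟩ := (hps q).2 hq
    exact hB.complete t' l' ht' (Or.inl ht') hL

end Buckets
end RealRAM

/-! ### Envelopes under construction: inserting lines by increasing slope. -/

section Envelope

variable {sl ic : ℕ → ℝ} {k : ℕ} {sq : ℕ → ℕ} {ss : ℕ → ℝ} {xl xr : ℝ} {Q R : ℕ → Prop}

theorem IsEnvelope.congr (h : IsEnvelope sl ic k sq ss xl xr Q) {sq' : ℕ → ℕ} {ss' : ℕ → ℝ}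
    (h₁ : ∀ d < k, sq' d = sq d) (h₂ : ∀ d < k, ss' d = ss d) :
    IsEnvelope sl ic k sq' ss' xl xr Q where
  toIsLineChain := h.toIsLineChain.congr h₁ h₂
  mem d hd := by rw [h₁ d hd]; exact h.mem d hd
  cover q hq x hx hx' := by
    obtain ⟨d, hd, hle⟩ := h.cover q hq x hx hx'
    exact ⟨d, hd, by rwa [h₁ d hd]⟩

theorem IsLineChain.length_le {N : ℕ} (h : IsLineChain sl ic k sq ss xl xr)
    (hm : ∀ d < k, sq d < N) : k ≤ N := by
  rw [← Finset.card_range k, ← Finset.card_range N]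
  refine Finset.card_le_card_of_injOn sq (fun d hd => ?_) fun d hd d' hd' e => ?_
  · simp only [Finset.coe_range, Set.mem_Iio] at hd ⊢
    exact hm d hd
  · simp only [Finset.coe_range, Set.mem_Iio] at hd hd'
    exact h.sq_injOn hd hd' e

variable (sl ic k sq ss xl xr Q R) in
/-- An incomplete envelope of the lines in `Q`: those in `R` have still to be inserted, and have
slopes at least as large as those of the chain. -/
structure PartialEnvelope : Prop where
  chain : IsLineChain sl ic k sq ss xl xr
  mem : ∀ d < k, Q (sq d)
  rem : ∀ q, R q → Q q
  cover : ∀ q, Q q → ∀ x, xl ≤ x → x < xr →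
    (∃ d < k, lineAt sl ic q x ≤ lineAt sl ic (sq d) x) ∨
      ∃ q', R q' ∧ lineAt sl ic q x ≤ lineAt sl ic q' x
  le : ∀ d < k, ∀ q, R q → sl (sq d) ≤ sl q

namespace PartialEnvelope

theorem finish (h : PartialEnvelope sl ic k sq ss xl xr Q R) (hR : ∀ q, ¬ R q) :
    IsEnvelope sl ic k sq ss xl xr Q where
  toIsLineChain := h.chain
  mem := h.mem
  cover q hq x hx hx' := (h.cover q hq x hx hx').resolve_right fun ⟨q', hq', _⟩ => hR q' hq'

/-- Whatever the removed line covered is taken over by a line left in the chain or by the candidate,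
which is not consumed and stays in `R`. -/
theorem pop {cand : ℕ} (h : PartialEnvelope sl ic (k + 1) sq ss xl xr Q R) (hc : R cand)
    (hle : lineAt sl ic (sq k) (ss k) ≤ lineAt sl ic cand (ss k)) :
    PartialEnvelope sl ic k sq ss xl xr Q R where
  chain := h.chain.pop
  mem d hd := h.mem d (by omega)
  rem := h.rem
  cover q hq x hx hx' := by
    rcases h.cover q hq x hx hx' with ⟨d, hd, h1⟩ | h1
    · rcases Nat.lt_succ_iff_lt_or_eq.1 hd with h2 | rfl
      · exact Or.inl ⟨d, h2, h1⟩
      · rcases h.chain.pop_cover (h.le d hd _ hc) hle hx with ⟨d', hd', h2⟩ | h2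
        · exact Or.inl ⟨d', hd', h1.trans h2⟩
        · exact Or.inr ⟨cand, hc, h1.trans h2⟩
    · exact Or.inr h1
  le d hd := h.le d (by omega)

variable {R' : ℕ → Prop} {cand : ℕ}

/-- The candidate is nowhere above the chain. -/
theorem discard (h : PartialEnvelope sl ic k sq ss xl xr Q R) (hR' : ∀ q, R' q → R q)
    (hR : ∀ q, R q → q = cand ∨ R' q)
    (hle : ∀ x, xl ≤ x → x < xr → ∃ d < k, lineAt sl ic cand x ≤ lineAt sl ic (sq d) x) :
    PartialEnvelope sl ic k sq ss xl xr Q R' where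
  chain := h.chain
  mem := h.mem
  rem q hq := h.rem q (hR' q hq)
  cover q hq x hx hx' := by
    rcases h.cover q hq x hx hx' with h1 | ⟨q', hq', h1⟩
    · exact Or.inl h1
    · rcases hR q' hq' with rfl | h2
      · obtain ⟨d, hd, h3⟩ := hle x hx hx'
        exact Or.inl ⟨d, hd, h1.trans h3⟩
      · exact Or.inr ⟨q', h2, h1⟩
  le d hd q hq := h.le d hd q (hR' q hq)

/-- The candidate is put on top of the chain. -/
theorem insert (h : PartialEnvelope sl ic k sq ss xl xr Q R) (hc : R cand)
    (hR' : ∀ q, R' q → R q) (hR : ∀ q, R q → q = cand ∨ R' q) (hmin : ∀ q, R q → sl cand ≤ sl q)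
    {sq' : ℕ → ℕ} {ss' : ℕ → ℝ} (hsq : ∀ d < k, sq' d = sq d) (hk : sq' k = cand)
    (hchain : IsLineChain sl ic (k + 1) sq' ss' xl xr) :
    PartialEnvelope sl ic (k + 1) sq' ss' xl xr Q R' where
  chain := hchain
  mem d hd := by
    rcases Nat.lt_succ_iff_lt_or_eq.1 hd with h2 | rfl
    · rw [hsq d h2]; exact h.mem d h2
    · rw [hk]; exact h.rem _ hc
  rem q hq := h.rem q (hR' q hq)
  cover q hq x hx hx' := by
    rcases h.cover q hq x hx hx' with ⟨d, hd, h1⟩ | ⟨q', hq', h1⟩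
    · exact Or.inl ⟨d, by omega, by rwa [hsq d hd]⟩
    · rcases hR q' hq' with rfl | h2
      · exact Or.inl ⟨k, by omega, by rwa [hk]⟩
      · exact Or.inr ⟨q', h2, h1⟩
  le d hd q hq := by
    rcases Nat.lt_succ_iff_lt_or_eq.1 hd with h2 | rfl
    · rw [hsq d h2]; exact h.le d h2 q (hR' q hq)
    · rw [hk]; exact hmin q (hR' q hq)

end PartialEnvelope

end Envelope

namespace RealRAM
-- Construction of the envelopes of all nodes, from the root downwards.
section Hull

/-- The abscissae between which the node `g` lies. -/
def nodeLeft (T : ℕ) (xs : ℕ → ℝ) (g : ℕ) : ℝ :=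
  xs ((g - 2 ^ Nat.log 2 g) * (T / 2 ^ Nat.log 2 g))

def nodeRight (T : ℕ) (xs : ℕ → ℝ) (g : ℕ) : ℝ :=
  xs ((g - 2 ^ Nat.log 2 g + 1) * (T / 2 ^ Nat.log 2 g))

/-- The lines of the parent with positions `≥ p₁` and of the list of the node with positions
`≥ p₂`. -/
def Remaining (Z : ℕ) (dc db sp sq : ℕ → ℕ) (g p₁ p₂ : ℕ) (q : ℕ) : Prop :=
  (∃ a, p₁ ≤ a ∧ a < sp (g / 2) ∧ sq (a * Z + g / 2) = q) ∨
    ∃ b, p₂ ≤ b ∧ b < dc g ∧ db (b * Z + g) = q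

/-- The fixed data of the construction of the envelopes. -/
structure TreeData (N L T Z : ℕ) (rk : ℕ → ℕ) (xs sl : ℕ → ℝ) (dc db : ℕ → ℕ) : Prop where
  pos : 0 < N
  size : TreeSize N L T
  eqZ : Z = 2 * T
  rk_lt : ∀ q ≤ N, rk q < N
  mono : ∀ a b, a ≤ b → b < N → xs a ≤ xs b
  buckets : BucketsDone N L T Z rk sl dc db

/-- The envelopes of the nodes `< g` are complete, and that of `g` lacks the remaining lines. -/
structure HullInv (N L T Z : ℕ) (rk : ℕ → ℕ) (xs sl ic : ℕ → ℝ) (dc db sp sq : ℕ → ℕ)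
    (ss : ℕ → ℝ) (g p₁ p₂ : ℕ) : Prop where
  done : ∀ g', 1 ≤ g' → g' < g → L ≤ T / 2 ^ Nat.log 2 g' ∧
    IsEnvelope sl ic (sp g') (fun d => sq (d * Z + g')) (fun d => ss (d * Z + g'))
      (nodeLeft T xs g') (nodeRight T xs g') (NodeSpans N T rk g')
  zero : ∀ g', g' = 0 ∨ g < g' → sp g' = 0
  node : L ≤ T / 2 ^ Nat.log 2 g → PartialEnvelope sl ic (sp g) (fun d => sq (d * Z + g))
    (fun d => ss (d * Z + g)) (nodeLeft T xs g) (nodeRight T xs g) (NodeSpans N T rk g)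
    (Remaining Z dc db sp sq g p₁ p₂)
  le₁ : p₁ ≤ sp (g / 2)
  le₂ : p₂ ≤ dc g

variable {N L T Z : ℕ} {rk : ℕ → ℕ} {xs sl ic : ℕ → ℝ} {dc db sp sq : ℕ → ℕ} {ss : ℕ → ℝ}
  {g p₁ p₂ : ℕ}

theorem TreeData.lt_Z (hd : TreeData N L T Z rk xs sl dc db)
    (hL : L ≤ T / 2 ^ Nat.log 2 g) : g < Z := by
  have h1 := (hd.size.level_le hL).1
  have h2 := Nat.lt_pow_succ_log_self (b := 2) (by norm_num) g
  have h3 : 2 ^ (Nat.log 2 g).succ ≤ 2 ^ (L + 1) := Nat.pow_le_pow_right (by norm_num) (by omega)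
  rw [hd.eqZ, hd.size.eq, Nat.mul_comm, ← pow_succ]
  omega

theorem nodeSpans_parent (hd : TreeData N L T Z rk xs sl dc db) (hg : 2 ≤ g)
    (hL : L ≤ T / 2 ^ Nat.log 2 g) :
    Nat.log 2 (g / 2) + 1 = Nat.log 2 g ∧
    T / 2 ^ Nat.log 2 (g / 2) = 2 * (T / 2 ^ Nat.log 2 g) ∧
    g / 2 - 2 ^ Nat.log 2 (g / 2) = (g - 2 ^ Nat.log 2 g) / 2 := by
  have h1 : Nat.log 2 (g / 2) + 1 = Nat.log 2 g := by
    rw [Nat.log_div_base]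
    have : 1 ≤ Nat.log 2 g := Nat.log_pos (by norm_num) hg
    omega
  have h2 := (hd.size.level_le hL)
  have hlt : Nat.log 2 (g / 2) + 1 ≤ L := by omega
  refine ⟨h1, ?_, ?_⟩
  · rw [hd.size.eq, ← h1, Nat.pow_div (by omega) (by norm_num), Nat.pow_div hlt (by norm_num),
      ← pow_succ']
    congr 1
    omega
  · rw [← h1, pow_succ]
    omega

theorem HullInv.parent (hI : HullInv N L T Z rk xs sl ic dc db sp sq ss g p₁ p₂) (hg : 2 ≤ g) :
    IsEnvelope sl ic (sp (g / 2)) (fun d => sq (d * Z + g / 2)) (fun d => ss (d * Z + g / 2))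
      (nodeLeft T xs (g / 2)) (nodeRight T xs (g / 2)) (NodeSpans N T rk (g / 2)) :=
  (hI.done (g / 2) (by omega) (by omega)).2

theorem not_nodeSpans_one {q : ℕ} : ¬ NodeSpans N T rk 1 q := by
  rintro ⟨-, h, -⟩
  simp at h

theorem NodeSpans.child (hd : TreeData N L T Z rk xs sl dc db) (hg : 2 ≤ g)
    (hL : L ≤ T / 2 ^ Nat.log 2 g) {q : ℕ} (h : NodeSpans N T rk (g / 2) q) :
    NodeSpans N T rk g q := by
  obtain ⟨-, h1, h2⟩ := nodeSpans_parent hd hg hL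
  rw [NodeSpans, h1, h2] at h
  exact h.child

/-- At the beginning, every line of a node remains or is covered by a remaining one. -/
theorem partialEnvelope_init (hd : TreeData N L T Z rk xs sl dc db) (hg : 1 ≤ g)
    (hL : L ≤ T / 2 ^ Nat.log 2 g) (hsp : sp g = 0) (hsp0 : sp 0 = 0)
    (hpar : 2 ≤ g → IsEnvelope sl ic (sp (g / 2)) (fun d => sq (d * Z + g / 2))
      (fun d => ss (d * Z + g / 2)) (nodeLeft T xs (g / 2)) (nodeRight T xs (g / 2))
      (NodeSpans N T rk (g / 2))) :
    PartialEnvelope sl ic (sp g) (fun d => sq (d * Z + g))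
      (fun d => ss (d * Z + g)) (nodeLeft T xs g) (nodeRight T xs g) (NodeSpans N T rk g)
      (Remaining Z dc db sp sq g 0 0) := by
  rw [hsp]
  obtain ⟨β, hβ⟩ := hd.buckets.lists
  refine ⟨⟨fun h => by omega, fun d h => by omega, fun d h => by omega⟩, fun d h => by omega,
    ?_, ?_, fun d h => by omega⟩
  · rintro q (⟨a, -, ha, rfl⟩ | ⟨b, -, hb, rfl⟩)
    · rcases hg.eq_or_lt with rfl | hg
      · simp [hsp0] at ha
      · exact ((hpar hg).mem a ha).child hd hg hL
    · exact hβ.mem g b hb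
  · intro q hq x hx hx'
    refine Or.inr ?_
    rcases hg.eq_or_lt with rfl | hg
    · exact absurd hq not_nodeSpans_one
    obtain ⟨h1, h2, h3⟩ := nodeSpans_parent hd hg hL
    have hpow := Nat.pow_log_le_self 2 (x := g) (by omega)
    -- A piece that passes over the parent is covered by the parent's envelope, which is valid on a
    -- larger interval. Otherwise the node is next to one of its ends, and the list of the node
    -- contains the piece.
    rcases Spans.parent_or hq with h4 | h4
    · obtain ⟨q1, q2, q3⟩ := h4
      have hlt := hd.rk_lt (q + 1) q1
      set S := T / 2 ^ Nat.log 2 g with hS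
      set v := g - 2 ^ Nat.log 2 g with hv
      have hq3 : (v / 2 + 1) * (2 * S) ≤ rk (q + 1) := Nat.mul_le_of_le_div _ _ _ q3
      have e1 : (v / 2 + 1) * (2 * S) = (v / 2 * 2 + 2) * S := by ring
      have e2 : v / 2 * (2 * S) = (v / 2 * 2) * S := by ring
      have l1 : (v / 2 * 2) * S ≤ v * S := Nat.mul_le_mul_right _ (by omega)
      have l2 : (v + 1) * S ≤ (v / 2 * 2 + 2) * S := Nat.mul_le_mul_right _ (by omega)
      have l3 : v * S ≤ (v + 1) * S := Nat.mul_le_mul_right _ (by omega)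
      obtain ⟨d, hd', hle⟩ := (hpar hg).cover q (by rw [NodeSpans, h2, h3]; exact ⟨q1, q2, q3⟩) x
        (by
          refine le_trans ?_ hx
          rw [nodeLeft, nodeLeft, h2, h3, ← hS, ← hv]
          exact hd.mono _ _ (by omega) (by omega))
        (by
          refine hx'.trans_le ?_
          rw [nodeRight, nodeRight, h2, h3, ← hS, ← hv]
          exact hd.mono _ _ (by omega) (by omega))
      exact ⟨_, Or.inl ⟨d, Nat.zero_le _, hd', rfl⟩, hle⟩
    · obtain ⟨q1, q2, q3⟩ := hq
      obtain ⟨⟨d₁, hd₁, e₁⟩, d₂, hd₂, e₂⟩ := hd.buckets.complete (Nat.log 2 g) q q1 hL (by omega)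
      refine ⟨q, Or.inr ?_, le_rfl⟩
      rcases h4 with h4 | h4
      · rw [← h4, Nat.add_sub_cancel' hpow] at hd₁ e₁
        exact ⟨d₁, Nat.zero_le _, hd₁, e₁⟩
      · rw [← h4, Nat.add_sub_cancel, Nat.add_sub_cancel' hpow] at hd₂ e₂
        exact ⟨d₂, Nat.zero_le _, hd₂, e₂⟩

/-- A step within the node `g` keeps the other nodes. -/
theorem HullInv.update (hI : HullInv N L T Z rk xs sl ic dc db sp sq ss g p₁ p₂)
    (hd : TreeData N L T Z rk xs sl dc db) (hg : 1 ≤ g) {sp' sq' : ℕ → ℕ} {ss' : ℕ → ℝ}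
    {p₁' p₂' : ℕ} (hsp : ∀ g', g' ≠ g → sp' g' = sp g')
    (hsq : ∀ d g', g' < Z → g' ≠ g → sq' (d * Z + g') = sq (d * Z + g'))
    (hss : ∀ d g', g' < Z → g' ≠ g → ss' (d * Z + g') = ss (d * Z + g'))
    (hL : L ≤ T / 2 ^ Nat.log 2 g)
    (hnode : PartialEnvelope sl ic (sp' g) (fun d => sq' (d * Z + g))
      (fun d => ss' (d * Z + g)) (nodeLeft T xs g) (nodeRight T xs g) (NodeSpans N T rk g)
      (Remaining Z dc db sp sq g p₁' p₂')) (h₁ : p₁' ≤ sp (g / 2)) (h₂ : p₂' ≤ dc g) :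
    HullInv N L T Z rk xs sl ic dc db sp' sq' ss' g p₁' p₂' := by
  have hZ := hd.lt_Z hL
  -- The remaining lines refer to the chain of the parent, which lies in another column than that of
  -- `g` because `g / 2 ≠ g`.
  have hR : Remaining Z dc db sp' sq' g p₁' p₂' = Remaining Z dc db sp sq g p₁' p₂' := by
    funext q
    simp only [Remaining, hsp (g / 2) (by omega), hsq _ (g / 2) (by omega) (by omega : g / 2 ≠ g)]
  refine ⟨fun g' hg' hlt => ?_, fun g' hg' => ?_, fun _ => by rwa [hR], ?_, h₂⟩
  · obtain ⟨h3, h4⟩ := hI.done g' hg' hlt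
    rw [hsp g' (by omega)]
    exact ⟨h3, h4.congr (fun d _ => hsq d g' (by omega) (by omega))
      (fun d _ => hss d g' (by omega) (by omega))⟩
  · rw [hsp g' (by omega)]
    exact hI.zero g' hg'
  · rwa [hsp _ (by omega)]

/-- A node is complete if no lines remain. -/
theorem HullInv.next (hI : HullInv N L T Z rk xs sl ic dc db sp sq ss g p₁ p₂)
    (hd : TreeData N L T Z rk xs sl dc db) (hg : 1 ≤ g) (hL : L ≤ T / 2 ^ Nat.log 2 g)
    (h₁ : sp (g / 2) ≤ p₁) (h₂ : dc g ≤ p₂) :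
    HullInv N L T Z rk xs sl ic dc db sp sq ss (g + 1) 0 0 := by
  have hdone : ∀ g', 1 ≤ g' → g' < g + 1 → L ≤ T / 2 ^ Nat.log 2 g' ∧
    IsEnvelope sl ic (sp g') (fun d => sq (d * Z + g')) (fun d => ss (d * Z + g'))
      (nodeLeft T xs g') (nodeRight T xs g') (NodeSpans N T rk g') := by
    intro g' hg' hlt
    rcases Nat.lt_succ_iff_lt_or_eq.1 hlt with h | rfl
    · exact hI.done g' hg' h
    · refine ⟨hL, (hI.node hL).finish ?_⟩
      rintro q (⟨a, ha, ha', -⟩ | ⟨b, hb, hb', -⟩) <;> omega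
  refine ⟨hdone, fun g' hg' => hI.zero g' (by omega), fun hL' => ?_, Nat.zero_le _, Nat.zero_le _⟩
  exact partialEnvelope_init hd (by omega) hL' (hI.zero _ (by omega)) (hI.zero 0 (Or.inl rfl))
    fun hg' => (hdone _ (by omega) (by omega)).2

end Hull
end RealRAM

namespace RealRAM
section Hull

variable {N L T Z : ℕ} {rk : ℕ → ℕ} {xs sl ic : ℕ → ℝ} {dc db sp sq : ℕ → ℕ} {ss : ℕ → ℝ}
  {g p₁ p₂ : ℕ}

/-- Here the threshold for the node size enters: `l ≤ L ≤ T / 2 ^ l` bounds the term `2 ^ l * l` of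
the envelope count by `T`. -/
theorem HullInv.level_sum_le (hI : HullInv N L T Z rk xs sl ic dc db sp sq ss g p₁ p₂)
    (hd : TreeData N L T Z rk xs sl dc db) (l : ℕ) :
    ∑ v ∈ Finset.range (2 ^ l), (if 2 ^ l + v < g then sp (2 ^ l + v) else 0) ≤ 4 * N + T := by
  by_cases hl : 2 ^ l < g
  · have hpos : 1 ≤ 2 ^ l := Nat.one_le_two_pow
    have hL := (hI.done (2 ^ l) hpos hl).1
    rw [Nat.log_pow (by norm_num)] at hL
    obtain ⟨h1, h2⟩ := hd.size.level_le hL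
    have h3 : 2 ^ l * l ≤ T :=
      (Nat.mul_le_mul_left (2 ^ l) (h1.trans hL)).trans_eq h2
    refine (sum_envelope_le (sl := sl) (ic := ic) (S := T / 2 ^ l) (rk := rk) (xs := xs)
      (sq := fun v d => sq (d * Z + (2 ^ l + v))) (ss := fun v d => ss (d * Z + (2 ^ l + v)))
      hd.pos (by rw [h2]; exact hd.size.le) hd.rk_lt hd.mono fun v hv => ?_).trans
      (Nat.add_le_add_left h3 _)
    by_cases hvg : 2 ^ l + v < g
    · refine Or.inr ?_
      rw [if_pos hvg]
      have h4 := (hI.done (2 ^ l + v) (by omega) hvg).2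
      have h5 : NodeSpans N T rk (2 ^ l + v) = Spans N rk (T / 2 ^ l) v :=
        funext fun q => propext (nodeSpans_add hv)
      rw [nodeLeft, nodeRight, h5, log_two_add hv, Nat.add_sub_cancel_left] at h4
      exact h4
    · exact Or.inl (if_neg hvg)
  · rw [Finset.sum_eq_zero fun v _ => if_neg (by omega)]
    exact Nat.zero_le _

/-- The nodes below `2 ^ (m + 1)` are those below `2 ^ m` together with the level `m`, and there are
at most `L + 1` levels. -/
theorem HullInv.sum_le (hI : HullInv N L T Z rk xs sl ic dc db sp sq ss g p₁ p₂)
    (hd : TreeData N L T Z rk xs sl dc db) (hg : g ≤ Z) :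
    ∑ p ∈ Finset.range g, sp p ≤ (L + 1) * (4 * N + T) := by
  have key : ∀ m, ∑ p ∈ Finset.range (2 ^ m), (if p < g then sp p else 0) ≤ m * (4 * N + T) := by
    intro m
    induction m with
    | zero => simp [hI.zero 0 (Or.inl rfl)]
    | succ m ih =>
      rw [pow_succ, Nat.mul_two, Finset.sum_range_add, Nat.add_mul, one_mul]
      exact Nat.add_le_add ih (hI.level_sum_le hd m)
  refine le_trans ?_ (key (L + 1))
  have hgL : g ≤ 2 ^ (L + 1) := by
    rw [pow_succ, ← hd.size.eq]
    have := hd.eqZ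
    omega
  calc ∑ p ∈ Finset.range g, sp p = ∑ p ∈ Finset.range g, (if p < g then sp p else 0) :=
        Finset.sum_congr rfl fun p hp => (if_pos (Finset.mem_range.1 hp)).symm
    _ ≤ _ := Finset.sum_le_sum_of_subset (Finset.range_subset_range.2 hgL)

theorem sum_range_half (f : ℕ → ℕ) (m : ℕ) :
    ∑ i ∈ Finset.range (2 * m), f (i / 2) = 2 * ∑ i ∈ Finset.range m, f i := by
  induction m with
  | zero => simp
  | succ m ih =>
    rw [Nat.mul_succ, Finset.sum_range_succ, Finset.sum_range_succ, ih, Finset.sum_range_succ,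
      show 2 * m / 2 = m by omega, show (2 * m + 1) / 2 = m by omega]
    ring

/-- The number of steps done so far, plus the length of the current chain. -/
def hullWork (dc sp : ℕ → ℕ) (g p₁ p₂ : ℕ) : ℕ :=
  g + 2 * (p₁ + p₂) + 2 * ∑ i ∈ Finset.range g, (sp (i / 2) + dc i)

/-- Reading the chains contributes at most `24 * N * (L + 1)`, the lists at most `4 * (N + 1) * (L +
2)` and the nodes at most `4 * N`; the factor `32` covers the sum. -/
def hullBound (N L : ℕ) : ℕ := 32 * ((N + 1) * (L + 3))

/-- A finished chain is read once for each of at most two children, so the chains read have total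
length at most twice that of the finished chains. The lists are bounded by the total of `Buckets`.
-/
theorem HullInv.work_le (hI : HullInv N L T Z rk xs sl ic dc db sp sq ss g p₁ p₂)
    (hd : TreeData N L T Z rk xs sl dc db) (hg : 1 ≤ g) (hgZ : g ≤ Z) :
    hullWork dc sp g p₁ p₂ ≤ hullBound N L := by
  obtain ⟨b, hb⟩ := hd.buckets.lists
  have h1 : ∑ i ∈ Finset.range (g + 1), dc i ≤ 2 * ((N + 1) * (L + 2)) := by
    refine (Finset.sum_le_sum_of_ne_zero fun i _ hi => ?_).trans hb.total
    exact Finset.mem_range.2 (hb.lt i (Nat.pos_of_ne_zero hi))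
  have h2 : ∑ i ∈ Finset.range (g + 1), sp (i / 2) ≤ 2 * ((L + 1) * (4 * N + T)) := by
    calc ∑ i ∈ Finset.range (g + 1), sp (i / 2)
        ≤ ∑ i ∈ Finset.range (2 * (g / 2 + 1)), sp (i / 2) :=
          Finset.sum_le_sum_of_subset (Finset.range_subset_range.2 (by omega))
      _ = 2 * ∑ p ∈ Finset.range (g / 2 + 1), sp p := sum_range_half sp _
      _ ≤ 2 * ∑ p ∈ Finset.range g, sp p := by
          refine Nat.mul_le_mul_left _ ?_
          rcases hg.eq_or_lt with rfl | hg
          · simp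
          · exact Finset.sum_le_sum_of_subset (Finset.range_subset_range.2 (by omega))
      _ ≤ _ := Nat.mul_le_mul_left _ (hI.sum_le hd hgZ)
  have h3 : (L + 1) * (4 * N + T) ≤ (L + 1) * (6 * N) :=
    Nat.mul_le_mul_left _ (by have := hd.size.ge; omega)
  have h4 := hI.le₁
  have h5 := hI.le₂
  have h6 := hd.eqZ
  have h7 := hd.size.ge
  have h8 : hullWork dc sp g p₁ p₂ ≤ g + 2 * (∑ i ∈ Finset.range (g + 1), sp (i / 2) +
      ∑ i ∈ Finset.range (g + 1), dc i) := by
    rw [hullWork, ← Finset.sum_add_distrib, Finset.sum_range_succ]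
    omega
  have e1 : (L + 1) * (6 * N) = 6 * (N * L) + 6 * N := by ring
  have e2 : (N + 1) * (L + 2) = N * L + 2 * N + L + 2 := by ring
  have e3 : (N + 1) * (L + 3) = N * L + 3 * N + L + 3 := by ring
  rw [hullBound]
  omega

/-- Selects the remaining line of smallest slope into word register `11`; word register `12` tells
where it comes from (`0`: there is none). -/
def chooseProg : Program :=
  .iset 10 (.sub (.reg 2) (.reg 5)) ;;
  .ite (.and (.ilt (.reg 8) (.get 9 (.div (.reg 2) (.lit 2))))
      (.not (.and (.ilt (.reg 9) (.get 7 (.reg 2)))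
        (.rlt (.get 4 (.get 8 (.add (.mul (.reg 9) (.reg 7)) (.reg 2))))
          (.get 4 (.get 10 (.add (.mul (.reg 8) (.reg 7)) (.div (.reg 2) (.lit 2)))))))))
    (.iset 11 (.get 10 (.add (.mul (.reg 8) (.reg 7)) (.div (.reg 2) (.lit 2)))) ;;
      .iset 12 (.lit 1))
    (.ite (.ilt (.reg 9) (.get 7 (.reg 2)))
      (.iset 11 (.get 8 (.add (.mul (.reg 9) (.reg 7)) (.reg 2))) ;; .iset 12 (.lit 2))
      (.iset 12 (.lit 0)))

/-- Proceeds to the next node. -/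
def nextNode : Program :=
  .iset 2 (.add (.reg 2) (.lit 1)) ;; .iset 8 (.lit 0) ;; .iset 9 (.lit 0) ;;
  .ite (.ile (.mul (.lit 2) (.reg 5)) (.reg 2))
    (.iset 5 (.mul (.lit 2) (.reg 5)) ;; .iset 6 (.div (.reg 6) (.lit 2))) .skip

/-- Removes the selected line from the remaining ones. -/
def advanceProg : Program :=
  .ite (.ile (.reg 12) (.lit 1)) (.iset 8 (.add (.reg 8) (.lit 1)))
    (.iset 9 (.add (.reg 9) (.lit 1)))

/-- Puts the selected line on top of the chain; it starts at the value of real register `3`. -/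
def pushProg : Program :=
  .iput 10 (.add (.mul (.reg 13) (.reg 7)) (.reg 2)) (.reg 11) ;;
  .rput 7 (.add (.mul (.reg 13) (.reg 7)) (.reg 2)) (.reg 3) ;;
  .iput 9 (.reg 2) (.add (.reg 13) (.lit 1))

/-- The value of the line `q` at `x`. -/
def lineExp (q : IExp) (x : RExp) : RExp := .add (.get 5 q) (.mul (.get 4 q) x)

def insertFirst : Program :=
  .ite (.rlt (.reg 3) (.reg 4)) pushProg .skip ;; advanceProg

def insertNext : Program :=
  .iset 14 (.get 10 (.add (.mul (.sub (.reg 13) (.lit 1)) (.reg 7)) (.reg 2))) ;;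
  .rset 5 (.get 7 (.add (.mul (.sub (.reg 13) (.lit 1)) (.reg 7)) (.reg 2))) ;;
  .ite (.rle (lineExp (.reg 14) (.reg 5)) (lineExp (.reg 11) (.reg 5)))
    (.iput 9 (.reg 2) (.sub (.reg 13) (.lit 1)))
    (.ite (.rlt (lineExp (.reg 14) (.reg 4)) (lineExp (.reg 11) (.reg 4)))
      (.rset 3 (.div (.sub (.get 5 (.reg 14)) (.get 5 (.reg 11)))
        (.sub (.get 4 (.reg 11)) (.get 4 (.reg 14)))) ;; pushProg) .skip ;;
    advanceProg)

/-- Inserts the selected line, or removes the top of the chain. -/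
def insertProg : Program :=
  .iset 13 (.get 9 (.reg 2)) ;;
  .rset 3 (.get 6 (.mul (.reg 10) (.reg 6))) ;;
  .rset 4 (.get 6 (.mul (.add (.reg 10) (.lit 1)) (.reg 6))) ;;
  .ite (.ile (.reg 13) (.lit 0)) insertFirst insertNext

def hullStep : Program :=
  chooseProg ;; .ite (.ile (.reg 12) (.lit 0)) nextNode insertProg

def hullInit : Program :=
  .iset 2 (.lit 1) ;; .iset 5 (.lit 1) ;; .iset 6 (.reg 4) ;; .iset 8 (.lit 0) ;; .iset 9 (.lit 0)

/-- Constructs the envelopes of all nodes of size at least `L`. -/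
def hullProg : Program := hullInit ;; .loop (.ile (.reg 3) (.reg 6)) hullStep

def hullCost (N L : ℕ) : ℕ :=
  hullInit.maxCost + (hullBound N L + 1) * iterCost (.ile (.reg 3) (.reg 6)) hullStep

/-- The registers of the hull construction at the node `g`. -/
structure HullRegs (W N L T Z g p₁ p₂ : ℕ) (s : State) : Prop extends TreeState W N L T Z s where
  iv2 : s.iv 2 = g
  iv5 : s.iv 5 = 2 ^ Nat.log 2 g
  iv6 : s.iv 6 = T / 2 ^ Nat.log 2 g
  iv8 : s.iv 8 = p₁
  iv9 : s.iv 9 = p₂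

/-- The candidate `q` is the remaining line of smallest slope. -/
structure IsNext (Z : ℕ) (dc db sp sq : ℕ → ℕ) (sl : ℕ → ℝ) (g p₁ p₂ q p₁' p₂' : ℕ) : Prop where
  mem : Remaining Z dc db sp sq g p₁ p₂ q
  sub : ∀ q', Remaining Z dc db sp sq g p₁' p₂' q' → Remaining Z dc db sp sq g p₁ p₂ q'
  eq_or : ∀ q', Remaining Z dc db sp sq g p₁ p₂ q' →
    q' = q ∨ Remaining Z dc db sp sq g p₁' p₂' q'
  min : ∀ q', Remaining Z dc db sp sq g p₁ p₂ q' → sl q ≤ sl q'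
  le₁ : p₁' ≤ sp (g / 2)
  le₂ : p₂' ≤ dc g
  sum : p₁' + p₂' = p₁ + p₂ + 1

/-- The chain of the parent and the list of the node are both sorted by slope, so the flatter of the
two heads is the overall minimum. The empty column `0` plays the role of the parent of the root. -/
theorem isNext_left (hI : HullInv N L T Z rk xs sl ic dc db sp sq ss g p₁ p₂)
    (hd : TreeData N L T Z rk xs sl dc db) (hg : 1 ≤ g)
    (h : p₁ < sp (g / 2)) (hc : ¬ (p₂ < dc g ∧
      sl (db (p₂ * Z + g)) < sl (sq (p₁ * Z + g / 2)))) :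
    IsNext Z dc db sp sq sl g p₁ p₂ (sq (p₁ * Z + g / 2)) (p₁ + 1) p₂ where
  mem := Or.inl ⟨p₁, le_rfl, h, rfl⟩
  sub := by
    rintro q (⟨a, ha, h'⟩ | h')
    · exact Or.inl ⟨a, by omega, h'⟩
    · exact Or.inr h'
  eq_or := by
    rintro q (⟨a, ha, ha', rfl⟩ | h')
    · rcases ha.eq_or_lt with rfl | ha
      · exact Or.inl rfl
      · exact Or.inr (Or.inl ⟨a, ha, ha', rfl⟩)
    · exact Or.inr (Or.inr h')
  min := by
    obtain ⟨β, hβ⟩ := hd.buckets.lists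
    rintro q (⟨a, ha, ha', rfl⟩ | ⟨b, hb, hb', rfl⟩)
    · rcases ha.eq_or_lt with rfl | ha
      · exact le_rfl
      · rcases hg.eq_or_lt with rfl | hg
        · simp [hI.zero 0 (Or.inl rfl)] at h
        · exact ((hI.parent hg).start_lt ha ha').2.le
    · exact (not_lt.1 fun h1 => hc ⟨by omega, h1⟩).trans (hβ.sorted g p₂ b hb hb')
  le₁ := h
  le₂ := hI.le₂
  sum := by omega

theorem isNext_right (hI : HullInv N L T Z rk xs sl ic dc db sp sq ss g p₁ p₂)
    (hd : TreeData N L T Z rk xs sl dc db) (hg : 1 ≤ g)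
    (hc : ¬ (p₁ < sp (g / 2) ∧ ¬ (p₂ < dc g ∧
      sl (db (p₂ * Z + g)) < sl (sq (p₁ * Z + g / 2))))) (h : p₂ < dc g) :
    IsNext Z dc db sp sq sl g p₁ p₂ (db (p₂ * Z + g)) p₁ (p₂ + 1) where
  mem := Or.inr ⟨p₂, le_rfl, h, rfl⟩
  sub := by
    rintro q (h' | ⟨a, ha, h'⟩)
    · exact Or.inl h'
    · exact Or.inr ⟨a, by omega, h'⟩
  eq_or := by
    rintro q (h' | ⟨a, ha, ha', rfl⟩)
    · exact Or.inr (Or.inl h')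
    · rcases ha.eq_or_lt with rfl | ha
      · exact Or.inl rfl
      · exact Or.inr (Or.inr ⟨a, ha, ha', rfl⟩)
  min := by
    obtain ⟨β, hβ⟩ := hd.buckets.lists
    rintro q (⟨a, ha, ha', rfl⟩ | ⟨b, hb, hb', rfl⟩)
    · have h1 : sl (db (p₂ * Z + g)) < sl (sq (p₁ * Z + g / 2)) := by
        by_contra h1
        exact hc ⟨by omega, fun h2 => h1 h2.2⟩
      refine h1.le.trans ?_
      rcases ha.eq_or_lt with rfl | ha
      · exact le_rfl
      · rcases hg.eq_or_lt with rfl | hg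
        · simp [hI.zero 0 (Or.inl rfl)] at ha'
        · exact ((hI.parent hg).start_lt ha ha').2.le
    · exact hβ.sorted g p₂ b hb hb'
  le₁ := hI.le₁
  le₂ := h
  sum := by omega

/-- The result of `chooseProg`. -/
def Chosen (Z : ℕ) (dc db sp sq : ℕ → ℕ) (sl : ℕ → ℝ) (g p₁ p₂ : ℕ) (s : State) : Prop :=
  s.iv 12 = 0 ∧ sp (g / 2) ≤ p₁ ∧ dc g ≤ p₂ ∨
  s.iv 12 = 1 ∧ IsNext Z dc db sp sq sl g p₁ p₂ (s.iv 11) (p₁ + 1) p₂ ∨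
  s.iv 12 = 2 ∧ IsNext Z dc db sp sq sl g p₁ p₂ (s.iv 11) p₁ (p₂ + 1)

theorem HullInv.remaining_lt (hI : HullInv N L T Z rk xs sl ic dc db sp sq ss g p₁ p₂)
    (hL : L ≤ T / 2 ^ Nat.log 2 g) {q : ℕ} (h : Remaining Z dc db sp sq g p₁ p₂ q) : q < N :=
  ((hI.node hL).rem q h).1

theorem chooseProg_spec {W : ℕ} {s : State} (hs : HullRegs W N L T Z g p₁ p₂ s)
    (hI : HullInv N L T Z rk xs (s.ra 4) ic (s.ia 7) (s.ia 8) (s.ia 9) (s.ia 10) ss g p₁ p₂)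
    (hd : TreeData N L T Z rk xs (s.ra 4) (s.ia 7) (s.ia 8)) (hg : 1 ≤ g)
    (hL : L ≤ T / 2 ^ Nat.log 2 g) :
    chooseProg.wp W (fun s' => Chosen Z (s.ia 7) (s.ia 8) (s.ia 9) (s.ia 10) (s.ra 4) g p₁ p₂ s' ∧
      s'.iv 10 = g - 2 ^ Nat.log 2 g) s := by
  have hw := hs.word
  have e3 : N + 1 ≤ (N + 1) * (L + 3) := Nat.le_mul_of_pos_right _ (by omega)
  have hsub := Nat.sub_le g (2 ^ Nat.log 2 g)
  have hZ := hd.lt_Z hL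
  have hZe := hd.eqZ
  have hT := hd.size.ge
  simp only [chooseProg, Program.wp, Test.holds, IExp.eval, RExp.eval, Function.update_apply,
    reduceIte, Nat.reduceEqDiff, hs.iv2, hs.iv5, hs.iv8, hs.iv9, hs.iv7]
  refine ⟨by omega, fun h => ?_, fun h => ⟨fun h' => ?_, fun h' => ?_⟩⟩
  · have key := isNext_left hI hd hg h.1 h.2
    have := hI.remaining_lt hL key.mem
    exact ⟨by omega, by omega, Or.inr (Or.inl ⟨rfl, key⟩), trivial⟩
  · have key := isNext_right hI hd hg h h'
    have := hI.remaining_lt hL key.mem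
    exact ⟨by omega, by omega, Or.inr (Or.inr ⟨rfl, key⟩), trivial⟩
  · refine ⟨by omega, Or.inl ⟨rfl, ?_, by omega⟩, trivial⟩
    by_contra h1
    exact h ⟨by omega, fun h2 => h' h2.1⟩

end Hull
end RealRAM

namespace RealRAM
section Hull

variable {N L T Z : ℕ} {rk : ℕ → ℕ} {xs sl ic : ℕ → ℝ} {dc db sp sq : ℕ → ℕ} {ss : ℕ → ℝ}
  {g p₁ p₂ q p₁' p₂' : ℕ} {x : ℝ}

theorem HullInv.sp_le (hI : HullInv N L T Z rk xs sl ic dc db sp sq ss g p₁ p₂)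
    (hL : L ≤ T / 2 ^ Nat.log 2 g) {g' : ℕ} (hg' : g' ≤ g) : sp g' ≤ N := by
  rcases Nat.eq_zero_or_pos g' with rfl | h0
  · rw [hI.zero 0 (Or.inl rfl)]
    exact Nat.zero_le _
  rcases hg'.eq_or_lt with rfl | h
  · exact (hI.node hL).chain.length_le fun d hd => ((hI.node hL).mem d hd).1
  · have h1 := (hI.done g' h0 h).2
    exact h1.toIsLineChain.length_le fun d hd => (h1.mem d hd).1

theorem HullInv.pop (hI : HullInv N L T Z rk xs sl ic dc db sp sq ss g p₁ p₂)
    (hd : TreeData N L T Z rk xs sl dc db) (hg : 1 ≤ g) (hL : L ≤ T / 2 ^ Nat.log 2 g)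
    (hn : IsNext Z dc db sp sq sl g p₁ p₂ q p₁' p₂') {m : ℕ} (hm : sp g = m + 1)
    (hle : lineAt sl ic (sq (m * Z + g)) (ss (m * Z + g)) ≤ lineAt sl ic q (ss (m * Z + g))) :
    HullInv N L T Z rk xs sl ic dc db (Function.update sp g m) sq ss g p₁ p₂ := by
  refine hI.update hd hg (fun g' h => Function.update_of_ne h _ _) (fun _ _ _ _ => rfl)
    (fun _ _ _ _ => rfl) hL ?_ hI.le₁ hI.le₂
  have h1 := hI.node hL
  rw [hm] at h1
  rw [Function.update_self]
  exact h1.pop hn.mem hle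

theorem HullInv.discard (hI : HullInv N L T Z rk xs sl ic dc db sp sq ss g p₁ p₂)
    (hd : TreeData N L T Z rk xs sl dc db) (hg : 1 ≤ g) (hL : L ≤ T / 2 ^ Nat.log 2 g)
    (hn : IsNext Z dc db sp sq sl g p₁ p₂ q p₁' p₂')
    (hle : ∀ x, nodeLeft T xs g ≤ x → x < nodeRight T xs g →
      ∃ d < sp g, lineAt sl ic q x ≤ lineAt sl ic (sq (d * Z + g)) x) :
    HullInv N L T Z rk xs sl ic dc db sp sq ss g p₁' p₂' :=
  hI.update hd hg (fun _ _ => rfl) (fun _ _ _ _ => rfl) (fun _ _ _ _ => rfl) hL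
    ((hI.node hL).discard hn.sub hn.eq_or hle) hn.le₁ hn.le₂

theorem HullInv.push (hI : HullInv N L T Z rk xs sl ic dc db sp sq ss g p₁ p₂)
    (hd : TreeData N L T Z rk xs sl dc db) (hg : 1 ≤ g) (hL : L ≤ T / 2 ^ Nat.log 2 g)
    (hn : IsNext Z dc db sp sq sl g p₁ p₂ q p₁' p₂')
    (hchain : IsLineChain sl ic (sp g + 1)
      (fun d => Function.update sq (sp g * Z + g) q (d * Z + g))
      (fun d => Function.update ss (sp g * Z + g) x (d * Z + g))
      (nodeLeft T xs g) (nodeRight T xs g)) :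
    HullInv N L T Z rk xs sl ic dc db (Function.update sp g (sp g + 1))
      (Function.update sq (sp g * Z + g) q) (Function.update ss (sp g * Z + g) x) g p₁' p₂' := by
  have hgZ := hd.lt_Z hL
  refine hI.update hd hg (fun g' h => Function.update_of_ne h _ _)
    (fun d g' h h' => Function.update_of_ne (fun e => h' (cell_inj h hgZ e).2) _ _)
    (fun d g' h h' => Function.update_of_ne (fun e => h' (cell_inj h hgZ e).2) _ _) hL ?_
    hn.le₁ hn.le₂
  rw [Function.update_self]
  refine (hI.node hL).insert hn.mem hn.sub hn.eq_or hn.min (fun d h => ?_)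
    (Function.update_self _ _ _) hchain
  exact Function.update_of_ne (fun e => h.ne (cell_inj hgZ hgZ e).1) _ _

theorem HullInv.push_first (hI : HullInv N L T Z rk xs sl ic dc db sp sq ss g p₁ p₂)
    (hd : TreeData N L T Z rk xs sl dc db) (hg : 1 ≤ g) (hL : L ≤ T / 2 ^ Nat.log 2 g)
    (hn : IsNext Z dc db sp sq sl g p₁ p₂ q p₁' p₂') (hm : sp g = 0)
    (hlt : nodeLeft T xs g < nodeRight T xs g) :
    HullInv N L T Z rk xs sl ic dc db (Function.update sp g (sp g + 1))
      (Function.update sq (sp g * Z + g) q)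
      (Function.update ss (sp g * Z + g) (nodeLeft T xs g)) g p₁' p₂' := by
  refine hI.push hd hg hL hn ?_
  rw [hm]
  exact IsLineChain.singleton hlt (Function.update_self _ _ _)

theorem HullInv.push_next (hI : HullInv N L T Z rk xs sl ic dc db sp sq ss g p₁ p₂)
    (hd : TreeData N L T Z rk xs sl dc db) (hg : 1 ≤ g) (hL : L ≤ T / 2 ^ Nat.log 2 g)
    (hn : IsNext Z dc db sp sq sl g p₁ p₂ q p₁' p₂') {m : ℕ} (hm : sp g = m + 1)
    (hlt : lineAt sl ic q (ss (m * Z + g)) < lineAt sl ic (sq (m * Z + g)) (ss (m * Z + g)))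
    (hlt' : lineAt sl ic (sq (m * Z + g)) (nodeRight T xs g) < lineAt sl ic q (nodeRight T xs g))
    (hx : x = (ic (sq (m * Z + g)) - ic q) / (sl q - sl (sq (m * Z + g)))) :
    HullInv N L T Z rk xs sl ic dc db (Function.update sp g (sp g + 1))
      (Function.update sq (sp g * Z + g) q) (Function.update ss (sp g * Z + g) x) g p₁' p₂' := by
  have hgZ := hd.lt_Z hL
  refine hI.push hd hg hL hn ?_
  have hne : ∀ d < m + 1, d * Z + g ≠ (m + 1) * Z + g := fun d h e =>
    h.ne (cell_inj hgZ hgZ e).1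
  have h1 := (hI.node hL).chain
  rw [hm] at h1 ⊢
  refine IsLineChain.push (h1.congr (fun d h => Function.update_of_ne (hne d h) _ _)
    fun d h => Function.update_of_ne (hne d h) _ _) ?_ ?_ ?_ <;>
    simp only [Function.update_self, Function.update_of_ne (hne m (Nat.lt_succ_self m))]
  · exact hlt
  · exact hlt'
  · exact hx

/-- The candidate is at least as steep as the top line. Being no higher at the right border, it is
no higher anywhere to the left of it. -/
theorem HullInv.discard_next (hI : HullInv N L T Z rk xs sl ic dc db sp sq ss g p₁ p₂)
    (hd : TreeData N L T Z rk xs sl dc db) (hg : 1 ≤ g) (hL : L ≤ T / 2 ^ Nat.log 2 g)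
    (hn : IsNext Z dc db sp sq sl g p₁ p₂ q p₁' p₂') {m : ℕ} (hm : sp g = m + 1)
    (hle : lineAt sl ic q (nodeRight T xs g) ≤
      lineAt sl ic (sq (m * Z + g)) (nodeRight T xs g)) :
    HullInv N L T Z rk xs sl ic dc db sp sq ss g p₁' p₂' :=
  hI.discard hd hg hL hn fun _ _ hx' => ⟨m, by omega,
    lineAt_le_of_ge hle ((hI.node hL).le m (by omega) q hn.mem) hx'.le⟩

/-- The state of the hull construction. -/
structure HullState (W N L T Z g p₁ p₂ : ℕ) (s : State) : Prop
    extends HullRegs W N L T Z g p₁ p₂ s where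
  data : TreeData N L T Z (s.ia 6) (s.ra 6) (s.ra 4) (s.ia 7) (s.ia 8)
  inv : HullInv N L T Z (s.ia 6) (s.ra 6) (s.ra 4) (s.ra 5) (s.ia 7) (s.ia 8) (s.ia 9)
    (s.ia 10) (s.ra 7) g p₁ p₂
  one_le : 1 ≤ g

/-- Amortization: removing a line shortens the current chain, inserting one lengthens it by one but
consumes a candidate that counts twice, and proceeding to the next node adds one to the work. The
truncated subtraction is harmless because the work never exceeds `hullBound`. -/
def hullMeasure (N L : ℕ) (s : State) : ℕ :=
  hullBound N L + s.ia 9 (s.iv 2) - hullWork (s.ia 7) (s.ia 9) (s.iv 2) (s.iv 8) (s.iv 9)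

variable {W : ℕ} {s : State}

theorem HullState.le_Z (hs : HullState W N L T Z g p₁ p₂ s) : g ≤ Z := by
  rcases hs.one_le.eq_or_lt with rfl | h
  · have := hs.data.eqZ
    have := hs.data.size.le
    have := hs.data.pos
    omega
  · have := hs.data.lt_Z (hs.inv.done (g - 1) (by omega) (by omega)).1
    omega

theorem HullState.work_le (hs : HullState W N L T Z g p₁ p₂ s) :
    hullWork (s.ia 7) (s.ia 9) g p₁ p₂ ≤ hullBound N L :=
  hs.inv.work_le hs.data hs.one_le hs.le_Z

theorem nextNode_spec (hs : HullState W N L T Z g p₁ p₂ s) (hL : L ≤ T / 2 ^ Nat.log 2 g)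
    (h₁ : s.ia 9 (g / 2) ≤ p₁) (h₂ : s.ia 7 g ≤ p₂) :
    nextNode.wp W (fun s' => HullState W N L T Z (g + 1) 0 0 s' ∧
      hullMeasure N L s' < hullMeasure N L s) s := by
  have hw := hs.word
  have e3 : N + 1 ≤ (N + 1) * (L + 3) := Nat.le_mul_of_pos_right _ (by omega)
  have hZ := hs.data.lt_Z hL
  have hZe := hs.data.eqZ
  have hT := hs.data.size.ge
  have hTp := hs.data.size.le
  have hp := hs.data.pos
  have hg := hs.one_le
  have hlo := Nat.pow_log_le_self 2 (x := g) (by omega)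
  have hhi := Nat.lt_pow_succ_log_self (b := 2) (by norm_num) g
  have hS := Nat.div_le_self T (2 ^ Nat.log 2 g)
  have key : ∀ s', s'.iv 1 = N → s'.iv 3 = L → s'.iv 4 = T → s'.iv 7 = Z → s'.iv 2 = g + 1 →
      s'.iv 5 = 2 ^ Nat.log 2 (g + 1) → s'.iv 6 = T / 2 ^ Nat.log 2 (g + 1) → s'.iv 8 = 0 →
      s'.iv 9 = 0 → s'.ia = s.ia → s'.ra = s.ra → HullState W N L T Z (g + 1) 0 0 s' ∧
      hullMeasure N L s' < hullMeasure N L s := by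
    intro s' i1 i3 i4 i7 i2 i5 i6 i8 i9 ha hr
    have h : HullState W N L T Z (g + 1) 0 0 s' :=
      { word := hs.word, size := hs.size, pos := hs.pos, iv1 := i1, iv3 := i3, iv4 := i4,
        iv7 := i7, eqZ := hs.eqZ, iv2 := i2, iv5 := i5, iv6 := i6, iv8 := i8, iv9 := i9,
        data := by rw [ha, hr]; exact hs.data
        inv := by rw [ha, hr]; exact hs.inv.next hs.data hs.one_le hL h₁ h₂
        one_le := by omega }
    refine ⟨h, ?_⟩
    have h3 := h.work_le
    have h4 := hs.inv.le₁
    have h5 := hs.inv.le₂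
    have h6 := hs.inv.zero (g + 1) (Or.inr (by omega))
    simp only [hullMeasure, i2, i8, i9, hs.iv2, hs.iv8, hs.iv9]
    rw [ha] at h3 ⊢
    rw [hullWork, Finset.sum_range_succ] at *
    rw [hullWork]
    omega
  simp only [nextNode, Program.wp, Test.holds, IExp.eval, Function.update_apply, reduceIte,
    Nat.reduceEqDiff, hs.iv2, hs.iv5, hs.iv6]
  refine ⟨by omega, by omega, by omega, fun h => ⟨by omega, by omega, ?_⟩, fun h => ?_⟩
  -- Here `g + 1` is the first node of the next level.
  · have hlog : Nat.log 2 (g + 1) = Nat.log 2 g + 1 :=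
      Nat.log_eq_of_pow_le_of_lt_pow (by rw [pow_succ]; omega)
        (by rw [pow_succ, pow_succ] at *; omega)
    have e1 : 2 * 2 ^ Nat.log 2 g = 2 ^ Nat.log 2 (g + 1) := by rw [hlog, pow_succ']
    have e2 : T / 2 ^ Nat.log 2 g / 2 = T / 2 ^ Nat.log 2 (g + 1) := by
      rw [hlog, Nat.div_div_eq_div_mul, pow_succ]
    refine key _ ?_ ?_ ?_ ?_ ?_ ?_ ?_ ?_ ?_ rfl rfl <;>
      simp only [Function.update_apply, reduceIte, Nat.reduceEqDiff, hs.iv1, hs.iv3, hs.iv4,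
        hs.iv7, e1, e2]
  · have hlog : Nat.log 2 (g + 1) = Nat.log 2 g :=
      Nat.log_eq_of_pow_le_of_lt_pow (by omega) (by rw [pow_succ]; omega)
    refine key _ ?_ ?_ ?_ ?_ ?_ ?_ ?_ ?_ ?_ rfl rfl <;>
      simp only [Function.update_apply, reduceIte, Nat.reduceEqDiff, hs.iv1, hs.iv3, hs.iv4,
        hs.iv7, hs.iv5, hs.iv6, hlog]

theorem advanceProg_wp {Q : State → Prop} (h8 : s.iv 8 = p₁) (h9 : s.iv 9 = p₂)
    (hadv : s.iv 12 = 1 ∧ p₁' = p₁ + 1 ∧ p₂' = p₂ ∨ s.iv 12 = 2 ∧ p₁' = p₁ ∧ p₂' = p₂ + 1)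
    (hW₁ : p₁' < W) (hW₂ : p₂' < W)
    (hQ : ∀ s', s'.iv 8 = p₁' → s'.iv 9 = p₂' → s'.ia = s.ia → s'.ra = s.ra → Q s') :
    advanceProg.wp W Q s := by
  simp only [advanceProg, Program.wp, Test.holds, IExp.eval, h8, h9]
  refine ⟨fun h => ⟨by omega, hQ _ ?_ ?_ rfl rfl⟩, fun h => ⟨by omega, hQ _ ?_ ?_ rfl rfl⟩⟩ <;>
    simp only [Function.update_apply, reduceIte, Nat.reduceEqDiff, h8, h9] <;> omega

theorem pushProg_wp {Q : State → Prop} {d : ℕ} (h13 : s.iv 13 = d) (h7 : s.iv 7 = Z)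
    (h2 : s.iv 2 = g) (hW₁ : s.iv 11 < W) (hW₂ : d + 1 < W)
    (hQ : ∀ s', s'.iv = s.iv → s'.ia 9 = Function.update (s.ia 9) g (d + 1) →
      s'.ia 10 = Function.update (s.ia 10) (d * Z + g) (s.iv 11) →
      s'.ra 7 = Function.update (s.ra 7) (d * Z + g) (s.rv 3) → Q s') :
    pushProg.wp W Q s := by
  simp only [pushProg, Program.wp, IExp.eval, RExp.eval, h13, h7, h2]
  refine ⟨hW₁, hW₂, hQ _ rfl ?_ ?_ ?_⟩ <;>
    simp only [Function.update_self, ne_eq, Nat.reduceEqDiff, not_false_eq_true,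
      Function.update_of_ne]

/-- The result of `insertProg`. -/
def Inserted (N L T Z g p₁ p₂ : ℕ) (s s' : State) : Prop :=
  HullInv N L T Z (s.ia 6) (s.ra 6) (s.ra 4) (s.ra 5) (s.ia 7) (s.ia 8) (s'.ia 9)
    (s'.ia 10) (s'.ra 7) g (s'.iv 8) (s'.iv 9) ∧
  (∀ g', g' ≠ g → s'.ia 9 g' = s.ia 9 g') ∧
  s'.ia 9 g + 2 * (p₁ + p₂) < s.ia 9 g + 2 * (s'.iv 8 + s'.iv 9)

theorem insertProg_spec (hs : HullState W N L T Z g p₁ p₂ s) (hL : L ≤ T / 2 ^ Nat.log 2 g)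
    (hn : IsNext Z (s.ia 7) (s.ia 8) (s.ia 9) (s.ia 10) (s.ra 4) g p₁ p₂ (s.iv 11) p₁' p₂')
    (h10 : s.iv 10 = g - 2 ^ Nat.log 2 g)
    (hadv : s.iv 12 = 1 ∧ p₁' = p₁ + 1 ∧ p₂' = p₂ ∨ s.iv 12 = 2 ∧ p₁' = p₁ ∧ p₂' = p₂ + 1) :
    insertProg.wp W (Inserted N L T Z g p₁ p₂ s) s := by
  have hI := hs.inv
  have hd := hs.data
  have hg := hs.one_le
  have hw := hs.word
  have hq := hI.remaining_lt hL hn.mem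
  have hsp := hI.sp_le hL le_rfl
  have hsp' := hI.sp_le hL (Nat.div_le_self g 2)
  obtain ⟨β, hβ⟩ := hd.buckets.lists
  have hdc := hβ.dc_le g
  have l₁ := hn.le₁
  have l₂ := hn.le₂
  have l₃ := hn.sum
  have e3 : (N + 1) * (L + 3) = (N + 1) * (L + 2) + (N + 1) := by ring
  have hW₁ : p₁' < W := by omega
  have hW₂ : p₂' < W := by omega
  simp only [insertProg, Program.wp, Test.holds, IExp.eval, RExp.eval, Function.update_apply,
    reduceIte, Nat.reduceEqDiff, hs.iv2, hs.iv6, h10]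
  refine ⟨by omega, fun h => ?_, fun h => ?_⟩
  · have hm : s.ia 9 g = 0 := by omega
    simp only [insertFirst, Program.wp, Test.holds, RExp.eval, Function.update_apply,
      reduceIte, Nat.reduceEqDiff]
    refine ⟨fun hlt => ?_, fun hlt => ?_⟩
    · refine pushProg_wp (d := s.ia 9 g) rfl hs.iv7 hs.iv2 (by simpa using by omega) (by omega)
        fun s' i1 i2 i3 i4 => ?_
      refine advanceProg_wp (p₁ := p₁) (p₂ := p₂) (by rw [i1]; exact hs.iv8)
        (by rw [i1]; exact hs.iv9) (by rw [i1]; exact hadv) hW₁ hW₂ fun s'' j1 j2 j3 j4 => ?_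
      have h1 := hI.push_first hd hg hL hn hm hlt
      simp only [Inserted, j1, j2, j3, j4, i2, i3, i4]
      refine ⟨h1, fun g' hg' => Function.update_of_ne hg' _ _, ?_⟩
      rw [Function.update_self]
      omega
    -- Coinciding breakpoints can make the interval of the node empty; then every candidate may be
    -- dropped.
    · refine advanceProg_wp (p₁ := p₁) (p₂ := p₂) hs.iv8 hs.iv9 hadv hW₁ hW₂
        fun s'' j1 j2 j3 j4 => ?_
      simp only [Inserted, j1, j2, j3, j4]
      exact ⟨hI.discard hd hg hL hn fun x hx hx' => absurd (hx.trans_lt hx') hlt,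
        fun _ _ => trivial, by omega⟩
  · obtain ⟨m, hm⟩ : ∃ m, s.ia 9 g = m + 1 := ⟨s.ia 9 g - 1, by omega⟩
    have hrem := (hI.node hL).mem m (by omega)
    simp only [insertNext, lineExp, Program.wp, Test.holds, IExp.eval, RExp.eval,
      Function.update_apply, reduceIte, Nat.reduceEqDiff, hm, hs.iv7, hs.iv2, Nat.add_sub_cancel]
    refine ⟨hrem.1.trans (by omega), fun hle => ⟨by omega, ?_⟩, fun hle => ⟨fun hlt => ?_,
      fun hlt => ?_⟩⟩
    · have h1 := hI.pop hd hg hL hn hm hle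
      simp only [Inserted, Function.update_apply, reduceIte, Nat.reduceEqDiff, hs.iv8, hs.iv9]
      refine ⟨?_, fun g' hg' => if_neg hg', by omega⟩
      simpa only [Function.update_apply] using h1
    · refine pushProg_wp (d := s.ia 9 g) hm.symm hs.iv7 hs.iv2 (by simpa using by omega)
        (by omega) fun s' i1 i2 i3 i4 => ?_
      refine advanceProg_wp (p₁ := p₁) (p₂ := p₂) (by rw [i1]; exact hs.iv8)
        (by rw [i1]; exact hs.iv9) (by rw [i1]; exact hadv) hW₁ hW₂ fun s'' j1 j2 j3 j4 => ?_
      have h1 := hI.push_next hd hg hL hn hm (not_le.1 hle) hlt rfl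
      simp only [Inserted, j1, j2, j3, j4, i2, i3, i4]
      refine ⟨h1, fun g' hg' => Function.update_of_ne hg' _ _, ?_⟩
      rw [Function.update_self]
      omega
    · refine advanceProg_wp (p₁ := p₁) (p₂ := p₂) hs.iv8 hs.iv9 hadv hW₁ hW₂
        fun s'' j1 j2 j3 j4 => ?_
      simp only [Inserted, j1, j2, j3, j4]
      exact ⟨hI.discard_next hd hg hL hn hm (not_lt.1 hlt), fun _ _ => trivial, by omega⟩

end Hull
end RealRAM

namespace RealRAM
section Hull

variable {W N L T Z g p₁ p₂ : ℕ} {s : State}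

theorem HullRegs.congr {s' : State} (h : HullRegs W N L T Z g p₁ p₂ s)
    (hiv : ∀ r < 10, s'.iv r = s.iv r) : HullRegs W N L T Z g p₁ p₂ s' where
  toTreeState := h.toTreeState.congr (hiv 1 (by norm_num)) (hiv 3 (by norm_num))
    (hiv 4 (by norm_num)) (hiv 7 (by norm_num))
  iv2 := (hiv 2 (by norm_num)).trans h.iv2
  iv5 := (hiv 5 (by norm_num)).trans h.iv5
  iv6 := (hiv 6 (by norm_num)).trans h.iv6
  iv8 := (hiv 8 (by norm_num)).trans h.iv8
  iv9 := (hiv 9 (by norm_num)).trans h.iv9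

theorem hullStep_spec (hs : HullState W N L T Z g p₁ p₂ s) (hL : L ≤ T / 2 ^ Nat.log 2 g) :
    hullStep.wp W (fun s' => (∃ g' p₁' p₂', HullState W N L T Z g' p₁' p₂' s') ∧
      hullMeasure N L s' < hullMeasure N L s) s := by
  rw [hullStep, Program.wp]
  refine Program.wp_mono (Program.wp_frame
    (chooseProg_spec hs.toHullRegs hs.inv hs.data hs.one_le hL)) fun s₁ ⟨f, hc, h10⟩ => ?_
  have hia : s₁.ia = s.ia := funext fun a => f.ia a rfl
  have hra : s₁.ra = s.ra := funext fun a => f.ra a rfl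
  have hiv : ∀ r < 10, s₁.iv r = s.iv r := by
    intro r hr
    interval_cases r <;> exact f.iv _ rfl
  have hs₁ : HullState W N L T Z g p₁ p₂ s₁ :=
    { toHullRegs := hs.toHullRegs.congr hiv
      data := by rw [hia, hra]; exact hs.data
      inv := by rw [hia, hra]; exact hs.inv
      one_le := hs.one_le }
  have hm : hullMeasure N L s₁ = hullMeasure N L s := by
    rw [hullMeasure, hullMeasure, hia, hiv 2 (by norm_num), hiv 8 (by norm_num),
      hiv 9 (by norm_num)]
  rw [← hia, ← hra] at hc
  rw [← hm]
  simp only [Program.wp, Test.holds, IExp.eval]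
  have insert : ∀ p₁' p₂',
      IsNext Z (s₁.ia 7) (s₁.ia 8) (s₁.ia 9) (s₁.ia 10) (s₁.ra 4) g p₁ p₂ (s₁.iv 11) p₁' p₂' →
      (s₁.iv 12 = 1 ∧ p₁' = p₁ + 1 ∧ p₂' = p₂ ∨ s₁.iv 12 = 2 ∧ p₁' = p₁ ∧ p₂' = p₂ + 1) →
      insertProg.wp W (fun s' => (∃ g' p₁' p₂', HullState W N L T Z g' p₁' p₂' s') ∧
        hullMeasure N L s' < hullMeasure N L s₁) s₁ := by
    intro p₁' p₂' hn hadv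
    refine Program.wp_mono (Program.wp_frame (insertProg_spec hs₁ hL hn h10 hadv))
      fun s₂ ⟨f₂, hI, hsp, hlt⟩ => ?_
    have e4 := f₂.ra 4 rfl
    have e6 := f₂.ia 6 rfl
    have e7 := f₂.ia 7 rfl
    have e8 := f₂.ia 8 rfl
    have r5 := f₂.ra 5 rfl
    have r6 := f₂.ra 6 rfl
    have hs₂ : HullState W N L T Z g (s₂.iv 8) (s₂.iv 9) s₂ :=
      { toTreeState := hs₁.toTreeState.congr (f₂.iv 1 rfl) (f₂.iv 3 rfl) (f₂.iv 4 rfl)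
          (f₂.iv 7 rfl)
        iv2 := (f₂.iv 2 rfl).trans hs₁.iv2
        iv5 := (f₂.iv 5 rfl).trans hs₁.iv5
        iv6 := (f₂.iv 6 rfl).trans hs₁.iv6
        iv8 := rfl
        iv9 := rfl
        data := by rw [e6, e7, e8, e4, r6]; exact hs₁.data
        inv := by rw [e6, e7, e8, e4, r5, r6]; exact hI
        one_le := hs.one_le }
    refine ⟨⟨_, _, _, hs₂⟩, ?_⟩
    have hwork := hs₂.work_le
    have hsum : ∑ i ∈ Finset.range g, (s₂.ia 9 (i / 2) + s₂.ia 7 i) =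
        ∑ i ∈ Finset.range g, (s₁.ia 9 (i / 2) + s₁.ia 7 i) := by
      refine Finset.sum_congr rfl fun i hi => ?_
      have := Finset.mem_range.1 hi
      rw [hsp _ (by omega), e7]
    simp only [hullMeasure, hs₂.iv2, hs₁.iv2, hs₁.iv8, hs₁.iv9]
    simp only [hullWork, hsum] at hwork ⊢
    omega
  refine ⟨fun h0 => ?_, fun h0 => ?_⟩
  · rcases hc with ⟨-, h1, h2⟩ | ⟨h1, -⟩ | ⟨h1, -⟩
    · exact Program.wp_mono (nextNode_spec hs₁ hL h1 h2) fun s' h' => ⟨⟨_, _, _, h'.1⟩, h'.2⟩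
    · omega
    · omega
  · rcases hc with ⟨h1, -⟩ | ⟨h1, hn⟩ | ⟨h1, hn⟩
    · omega
    · exact insert _ _ hn (Or.inl ⟨h1, rfl, rfl⟩)
    · exact insert _ _ hn (Or.inr ⟨h1, rfl, rfl⟩)

/-- The envelopes of the nodes of the level `l` are complete; the nodes have size `S`. -/
structure HullDone (N L T Z l S : ℕ) (rk : ℕ → ℕ) (xs sl ic : ℕ → ℝ) (sp sq : ℕ → ℕ)
    (ss : ℕ → ℝ) : Prop where
  mul_eq : 2 ^ l * S = T
  le : L ≤ S
  lt : S < 2 * L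
  le_size : l ≤ S
  envelope : ∀ v < 2 ^ l, IsEnvelope sl ic (sp (2 ^ l + v)) (fun d => sq (d * Z + (2 ^ l + v)))
    (fun d => ss (d * Z + (2 ^ l + v))) (xs (v * S)) (xs ((v + 1) * S)) (Spans N rk S v)

/-- The nodes are treated level by level. When the first node smaller than `L` is reached, the level
above it is complete, and its nodes have size in `[L, 2 * L)`. The root is never too small since `L
< 2 ^ L`. -/
theorem HullState.hullDone (hs : HullState W N L T Z g p₁ p₂ s)
    (hL : ¬ L ≤ T / 2 ^ Nat.log 2 g) : ∃ l, 2 ^ Nat.log 2 g = 2 ^ (l + 1) ∧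
      HullDone N L T Z l (T / 2 ^ l) (s.ia 6) (s.ra 6) (s.ra 4) (s.ra 5) (s.ia 9) (s.ia 10)
        (s.ra 7) := by
  have hg := hs.one_le
  have hlog : Nat.log 2 g ≠ 0 := by
    intro h0
    rw [h0, pow_zero, Nat.div_one, hs.size.eq] at hL
    exact hL Nat.lt_two_pow_self.le
  obtain ⟨l, hl⟩ := Nat.exists_eq_succ_of_ne_zero hlog
  have hpow := Nat.pow_log_le_self 2 (x := g) (by omega)
  rw [hl, Nat.succ_eq_add_one] at hpow hL ⊢
  rw [pow_succ] at hpow hL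
  have h1 := Nat.one_le_two_pow (n := l)
  have h2 := hs.inv.done (2 ^ l) h1 (by omega)
  rw [Nat.log_pow (by norm_num)] at h2
  obtain ⟨h3, h4⟩ := hs.size.level_le h2.1
  refine ⟨l, rfl, h4, h2.1, ?_, h3.trans h2.1, fun v hv => ?_⟩
  · rw [← Nat.div_div_eq_div_mul] at hL
    omega
  · have h5 := (hs.inv.done (2 ^ l + v) (by omega) (by omega)).2
    have h6 : NodeSpans N T (s.ia 6) (2 ^ l + v) = Spans N (s.ia 6) (T / 2 ^ l) v :=
      funext fun q => propext (nodeSpans_add hv)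
    rw [nodeLeft, nodeRight, h6, log_two_add hv, Nat.add_sub_cancel_left] at h5
    exact h5

/-- On this level `2 ^ l * l ≤ 2 ^ l * S = T ≤ 2 * N`, which makes the stored lists linear in total.
-/
theorem HullDone.sum_le {l S : ℕ} {rk : ℕ → ℕ} {xs sl ic : ℕ → ℝ} {sp sq : ℕ → ℕ} {ss : ℕ → ℝ}
    (h : HullDone N L T Z l S rk xs sl ic sp sq ss) (hN : 0 < N) (ht : TreeSize N L T)
    (hrk : ∀ q ≤ N, rk q < N) (hxs : ∀ a b, a ≤ b → b < N → xs a ≤ xs b) :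
    ∑ v ∈ Finset.range (2 ^ l), sp (2 ^ l + v) ≤ 6 * N := by
  have h1 := sum_envelope_le (sl := sl) (ic := ic) (S := S) (k := fun v => sp (2 ^ l + v))
    hN (by rw [h.mul_eq]; exact ht.le) hrk hxs fun v hv => Or.inr (h.envelope v hv)
  have h2 : 2 ^ l * l ≤ 2 ^ l * S := Nat.mul_le_mul_left _ h.le_size
  have h3 := h.mul_eq
  have h4 := ht.ge
  omega

theorem hullProg_spec (hs : TreeState W N L T Z s)
    (hd : TreeData N L T Z (s.ia 6) (s.ra 6) (s.ra 4) (s.ia 7) (s.ia 8))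
    (h9 : ∀ i, s.ia 9 i = 0) :
    Tri W hullProg s (hullCost N L) fun s' => ∃ l, s'.iv 5 = 2 ^ (l + 1) ∧
      HullDone N L T Z l (T / 2 ^ l) (s.ia 6) (s.ra 6) (s.ra 4) (s.ra 5) (s'.ia 9) (s'.ia 10)
        (s'.ra 7) := by
  have hw := hs.word
  have e3 : N + 1 ≤ (N + 1) * (L + 3) := Nat.le_mul_of_pos_right _ (by omega)
  have hT := hd.size.ge
  refine Tri.seq (R := fun s' => s'.ia = s.ia ∧ s'.ra = s.ra ∧ HullState W N L T Z 1 0 0 s')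
    (Tri.of_wp ?_) fun s₁ f₁ ⟨ha, hr, hs₁⟩ => ?_
  · simp only [hullInit, Program.wp, IExp.eval, Function.update_apply, reduceIte,
      Nat.reduceEqDiff, hs.iv4]
    refine ⟨by omega, by omega, by omega, by omega, by omega, trivial, trivial, ?_⟩
    exact
      { toTreeState := hs.congr rfl rfl rfl rfl
        iv2 := rfl
        iv5 := rfl
        iv6 := by simp
        iv8 := rfl
        iv9 := rfl
        data := hd
        inv := ⟨fun g' h1 h2 => by omega, fun g' _ => h9 g', fun hL =>
          partialEnvelope_init hd le_rfl hL (h9 1) (h9 0) fun h => by omega, Nat.zero_le _,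
          Nat.zero_le _⟩
        one_le := le_rfl }
  · have hlen : hullMeasure N L s₁ ≤ hullBound N L := by
      rw [hullMeasure, ha, h9]
      exact Nat.sub_le _ _
    refine (Tri.loop (fun s' => ∃ g p₁ p₂, HullState W N L T Z g p₁ p₂ s') (hullMeasure N L)
      ⟨_, _, _, hs₁⟩ fun s' _ ⟨g, p₁, p₂, hs'⟩ hb => ?_).mono
      (Nat.mul_le_mul_right _ (by omega)) fun s' f' ⟨⟨g, p₁, p₂, hs'⟩, hb⟩ => ?_
    · simp only [Test.holds, IExp.eval, hs'.iv3, hs'.iv6] at hb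
      exact hullStep_spec hs' hb
    · simp only [Test.holds, IExp.eval, hs'.iv3, hs'.iv6] at hb
      obtain ⟨l, h1, h2⟩ := hs'.hullDone hb
      rw [f'.ia 6 rfl, f'.ra 6 rfl, f'.ra 4 rfl, f'.ra 5 rfl, ha, hr] at h2
      exact ⟨l, hs'.iv5.trans h1, h2⟩

end Hull
end RealRAM

namespace RealRAM
-- The envelopes of the last level as one list.
section Flatten

/-- The position of the first line of the node `U + v` in the common list. -/
def listStart (U : ℕ) (sp : ℕ → ℕ) (v : ℕ) : ℕ := ∑ u ∈ Finset.range v, sp (U + u)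

theorem listStart_succ (U : ℕ) (sp : ℕ → ℕ) (v : ℕ) :
    listStart U sp (v + 1) = listStart U sp v + sp (U + v) := Finset.sum_range_succ _ _

theorem listStart_mono (U : ℕ) (sp : ℕ → ℕ) : Monotone (listStart U sp) :=
  monotone_nat_of_le_succ fun v => (listStart_succ U sp v).symm ▸ Nat.le_add_right _ _

/-- The lines `sq (d * Z + (U + v))` with starts `ss (d * Z + (U + v))` as one list. -/
def Listed (Z U : ℕ) (sp sq : ℕ → ℕ) (ss : ℕ → ℝ) (fq : ℕ → ℕ) (fs : ℕ → ℝ) (v d : ℕ) : Prop :=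
  ∀ v' d', d' < sp (U + v') → v' < v ∨ v' = v ∧ d' < d →
    fq (listStart U sp v' + d') = sq (d' * Z + (U + v')) ∧
    fs (listStart U sp v' + d') = ss (d' * Z + (U + v'))

variable {Z U : ℕ} {sp sq : ℕ → ℕ} {ss : ℕ → ℝ} {fq : ℕ → ℕ} {fs : ℕ → ℝ} {v d : ℕ}

theorem Listed.push (h : Listed Z U sp sq ss fq fs v d) (hd : d < sp (U + v)) :
    Listed Z U sp sq ss
      (Function.update fq (listStart U sp v + d) (sq (d * Z + (U + v))))
      (Function.update fs (listStart U sp v + d) (ss (d * Z + (U + v)))) v (d + 1) := by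
  intro v' d' hd' hlt
  by_cases e : v' = v ∧ d' = d
  · obtain ⟨rfl, rfl⟩ := e
    simp
  · have hlt' : v' < v ∨ v' = v ∧ d' < d := by omega
    have hne : listStart U sp v' + d' ≠ listStart U sp v + d := by
      rcases hlt' with h1 | ⟨rfl, h1⟩
      · have h2 := listStart_mono U sp (Nat.succ_le_of_lt h1)
        rw [Nat.succ_eq_add_one, listStart_succ] at h2
        omega
      · omega
    rw [Function.update_of_ne hne, Function.update_of_ne hne]
    exact h v' d' hd' hlt'

theorem Listed.next (h : Listed Z U sp sq ss fq fs v d) (hd : sp (U + v) ≤ d) :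
    Listed Z U sp sq ss fq fs (v + 1) 0 := by
  intro v' d' hd' hlt
  refine h v' d' hd' ?_
  rcases Nat.lt_succ_iff_lt_or_eq.1 (hlt.resolve_right (by omega)) with h1 | rfl
  · exact Or.inl h1
  · exact Or.inr ⟨rfl, by omega⟩

theorem exists_listStart_add {m p : ℕ} (h : p < listStart U sp m) :
    ∃ v < m, ∃ d < sp (U + v), p = listStart U sp v + d := by
  induction m with
  | zero => simp [listStart] at h
  | succ m ih =>
    by_cases h1 : p < listStart U sp m
    · obtain ⟨v, hv, h2⟩ := ih h1
      exact ⟨v, by omega, h2⟩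
    · rw [listStart_succ] at h
      exact ⟨m, by omega, p - listStart U sp m, by omega, by omega⟩

/-- Word register `5` already contains the first node of the level below the last complete one,
hence the division by `2`. -/
def flattenInit : Program :=
  .iset 2 (.div (.reg 5) (.lit 2)) ;; .iset 8 (.lit 0) ;; .iset 9 (.lit 0)

def flattenStep : Program :=
  .ite (.ilt (.reg 8) (.get 9 (.reg 2)))
    (.iput 3 (.reg 9) (.get 10 (.add (.mul (.reg 8) (.reg 7)) (.reg 2))) ;;
      .rput 8 (.reg 9) (.get 7 (.add (.mul (.reg 8) (.reg 7)) (.reg 2))) ;;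
      .iset 9 (.add (.reg 9) (.lit 1)) ;; .iset 8 (.add (.reg 8) (.lit 1)))
    (.iset 2 (.add (.reg 2) (.lit 1)) ;; .iset 8 (.lit 0))

/-- The node size is recovered as `Z / 2 ^ (l + 1)`, because `Z = 2 * T` and `T = 2 ^ l * S`. -/
def headerProg : Program :=
  .iput 1 (.lit 0) (.reg 1) ;; .iput 1 (.lit 1) (.div (.reg 7) (.reg 5)) ;;
  .iput 1 (.lit 2) (.reg 9) ;; .rput 9 (.lit 0) (.reg 2)

/-- Writes the envelopes of the last level into one list. -/
def flattenProg : Program :=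
  flattenInit ;; .loop (.ilt (.reg 2) (.reg 5)) flattenStep ;; headerProg

def flattenCost (N : ℕ) : ℕ :=
  flattenInit.maxCost + ((8 * N + 1) * iterCost (.ilt (.reg 2) (.reg 5)) flattenStep +
    headerProg.maxCost)

structure FlattenInv (Z U : ℕ) (sp sq : ℕ → ℕ) (ss : ℕ → ℝ) (v d : ℕ) (s : State) : Prop where
  le : v ≤ U
  le' : d ≤ sp (U + v)
  total : listStart U sp v + d ≤ listStart U sp U
  iv2 : s.iv 2 = U + v
  iv8 : s.iv 8 = d
  iv9 : s.iv 9 = listStart U sp v + d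
  listed : Listed Z U sp sq ss (s.ia 3) (s.ra 8) v d

theorem flattenProg_spec {W N L T l S : ℕ} {rk : ℕ → ℕ} {xs sl ic : ℕ → ℝ} {s : State}
    (hW : 8 * N < W) (hs : TreeState W N L T Z s)
    (h5 : s.iv 5 = 2 ^ (l + 1)) (hrk : ∀ q ≤ N, rk q < N)
    (hxs : ∀ a b, a ≤ b → b < N → xs a ≤ xs b)
    (hd : HullDone N L T Z l S rk xs sl ic (s.ia 9) (s.ia 10) (s.ra 7)) :
    Tri W flattenProg s (flattenCost N) fun s' =>
      Listed Z (2 ^ l) (s.ia 9) (s.ia 10) (s.ra 7) (s'.ia 3) (s'.ra 8) (2 ^ l) 0 ∧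
      s'.ia 1 0 = N ∧ s'.ia 1 1 = S ∧ s'.ia 1 2 = listStart (2 ^ l) (s.ia 9) (2 ^ l) ∧
      s'.ra 9 0 = s.rv 2 := by
  have hsum : listStart (2 ^ l) (s.ia 9) (2 ^ l) ≤ 6 * N := hd.sum_le hs.pos hs.size hrk hxs
  set U := 2 ^ l with hU
  set sp := s.ia 9 with hsp
  have hS : 0 < S := by have := hd.le; have := hs.size.pos; omega
  have hUS : U * S = T := hd.mul_eq
  have hUT : U ≤ U * S := Nat.le_mul_of_pos_right _ hS
  have hT := hs.size.ge
  have hZ := hs.eqZ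
  rw [pow_succ, ← hU] at h5
  have hUpos : 0 < U := Nat.two_pow_pos l
  have hdiv : Z / (U * 2) = S := by
    rw [hZ, ← hUS, Nat.mul_comm U 2]
    rw [← Nat.mul_assoc, Nat.mul_div_cancel_left _ (by omega)]
  refine Tri.seq (R := fun s' => s'.iv 2 = U ∧ s'.iv 8 = 0 ∧ s'.iv 9 = 0) (Tri.of_wp ?_)
    fun s₁ f₁ hs₁ => ?_
  · simp only [flattenInit, Program.wp, IExp.eval, Function.update_apply, reduceIte,
      Nat.reduceEqDiff, h5]
    exact ⟨by omega, by omega, by omega, by omega, trivial, trivial⟩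
  have a9 : s₁.ia 9 = sp := f₁.ia 9 rfl
  have a10 : s₁.ia 10 = s.ia 10 := f₁.ia 10 rfl
  have a7 : s₁.ra 7 = s.ra 7 := f₁.ra 7 rfl
  have i5 : s₁.iv 5 = U * 2 := (f₁.iv 5 rfl).trans h5
  have i7 : s₁.iv 7 = Z := (f₁.iv 7 rfl).trans hs.iv7
  refine Tri.seq (R := fun s' => ∃ v d, FlattenInv Z U sp (s.ia 10) (s.ra 7) v d s' ∧ v = U)
    ((Tri.loop (fun s' => ∃ v d, FlattenInv Z U sp (s.ia 10) (s.ra 7) v d s')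
      (fun s' => (2 * U - s'.iv 2) + (listStart U sp U - s'.iv 9)) ⟨0, 0, ?_⟩
      fun s₂ f₂ ⟨v, d, hI⟩ hb => ?_).mono (Nat.mul_le_mul_right _ (by omega))
      fun s₂ f₂ ⟨⟨v, d, hI⟩, hb⟩ => ⟨v, d, hI, ?_⟩)
    fun s₂ f₂ ⟨v, d, hI, hv⟩ => ?_
  · exact ⟨Nat.zero_le _, Nat.zero_le _, by simp [listStart], hs₁.1, hs₁.2.1,
      by simp [listStart, hs₁.2.2], fun v' d' _ h => by omega⟩
  · have b9 := (f₂.ia 9 rfl).trans a9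
    have b10 := (f₂.ia 10 rfl).trans a10
    have b7 := (f₂.ra 7 rfl).trans a7
    have j5 := (f₂.iv 5 rfl).trans i5
    have j7 := (f₂.iv 7 rfl).trans i7
    simp only [Test.holds, IExp.eval, j5, hI.iv2] at hb
    have hvU : v < U := by omega
    have hmono := listStart_mono U sp (Nat.succ_le_of_lt hvU)
    rw [Nat.succ_eq_add_one, listStart_succ] at hmono
    have htot := hI.total
    have hle := hI.le'
    simp only [flattenStep, Program.wp, Test.holds, IExp.eval, RExp.eval, Function.update_self,
      ne_eq, Nat.reduceEqDiff, not_false_eq_true, Function.update_of_ne, hI.iv2, hI.iv8, hI.iv9,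
      b9, b10, b7, j7]
    refine ⟨fun hlt => ⟨?_, by omega, by omega, ⟨v, d + 1, ?_⟩, by omega⟩, fun hlt =>
      ⟨by omega, by omega, ⟨v + 1, 0, ?_⟩, by omega⟩⟩
    · have := ((hd.envelope v hvU).mem d hlt).1
      simp only [← hU] at this
      omega
    · exact ⟨hI.le, hlt, by omega, by simp [hI.iv2], by simp, by simp; omega,
        by simpa using hI.listed.push hlt⟩
    · exact ⟨hvU, Nat.zero_le _, by rw [listStart_succ]; omega, by simp; omega, by simp,
        by simp [hI.iv9, listStart_succ]; omega, by simpa using hI.listed.next (by omega)⟩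
  · have j5 := (f₂.iv 5 rfl).trans i5
    simp only [Test.holds, IExp.eval, j5, hI.iv2] at hb
    have := hI.le
    omega
  · subst hv
    have i1 := (f₂.iv 1 rfl).trans ((f₁.iv 1 rfl).trans hs.iv1)
    have j5 := (f₂.iv 5 rfl).trans i5
    have j7 := (f₂.iv 7 rfl).trans i7
    have r2 := (f₂.rv 2 rfl).trans (f₁.rv 2 rfl)
    have htot := hI.total
    have hd0 : d = 0 := by omega
    subst hd0
    refine Tri.of_wp ?_
    simp only [headerProg, Program.wp, IExp.eval, RExp.eval, Function.update_apply, reduceIte,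
      Nat.reduceEqDiff, i1, j5, j7, hdiv, hI.iv9, r2]
    refine ⟨by omega, ?_, by omega, hI.listed, ?_⟩
    · have := Nat.le_mul_of_pos_left S hUpos
      omega
    · simp
end Flatten
end RealRAM

namespace RealRAM
-- Correctness of the search.
section SearchData

/-- The data of the query structure. -/
structure SearchData (n M Z l S cnt : ℕ) (bx sl ic : ℕ → ℝ) (G : ℕ → ℝ → ℝ) (px rk : ℕ → ℕ)
    (xs : ℕ → ℝ) (sp sq : ℕ → ℕ) (ss : ℕ → ℝ) (fq : ℕ → ℕ) (fs : ℕ → ℝ) : Prop where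
  pieces : PieceSystem n M bx sl ic G
  ranking : Ranking (n * M) bx px rk xs
  pos : 0 < S
  two_le : 2 ≤ M
  size : n * M ≤ 2 ^ l * S
  envelope : ∀ v < 2 ^ l, IsEnvelope sl ic (sp (2 ^ l + v)) (fun d => sq (d * Z + (2 ^ l + v)))
    (fun d => ss (d * Z + (2 ^ l + v))) (xs (v * S)) (xs ((v + 1) * S)) (Spans (n * M) rk S v)
  listed : Listed Z (2 ^ l) sp sq ss fq fs (2 ^ l) 0
  cnt_eq : cnt = listStart (2 ^ l) sp (2 ^ l)

/-- `p` is the number of entries of the increasing list `f` of length `m` that are at most `x`. -/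
def IsRank (m : ℕ) (f : ℕ → ℝ) (x : ℝ) (p : ℕ) : Prop :=
  p ≤ m ∧ (∀ r < p, f r ≤ x) ∧ ∀ r, p ≤ r → r < m → x < f r

theorem exists_lt_and_not_succ {m : ℕ} {p : ℕ → Prop} (h₀ : p 0) (h₁ : ¬ p m) : ∃ j < m, p j ∧ ¬ p (j + 1) := by
  induction m with
  | zero => exact absurd h₀ h₁
  | succ m ih =>
    by_cases h : p m
    · exact ⟨m, Nat.lt_succ_self m, h, h₁⟩
    · obtain ⟨j, hj, h2⟩ := ih h
      exact ⟨j, by omega, h2⟩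

/-- The piece `q` has been taken into account. -/
def Tried (bx sl ic : ℕ → ℝ) (x b : ℝ) (q : ℕ) : Prop :=
  bx q ≤ x → x ≤ bx (q + 1) → lineAt sl ic q x ≤ b

namespace SearchData

variable {n M Z l S cnt : ℕ} {bx sl ic : ℕ → ℝ} {G : ℕ → ℝ → ℝ} {px rk : ℕ → ℕ}
  {xs : ℕ → ℝ} {sp sq : ℕ → ℕ} {ss : ℕ → ℝ} {fq : ℕ → ℕ} {fs : ℕ → ℝ} {x : ℝ}

theorem listed_eq (h : SearchData n M Z l S cnt bx sl ic G px rk xs sp sq ss fq fs) {v d : ℕ}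
    (hv : v < 2 ^ l) (hd : d < sp (2 ^ l + v)) :
    fq (listStart (2 ^ l) sp v + d) = sq (d * Z + (2 ^ l + v)) ∧
    fs (listStart (2 ^ l) sp v + d) = ss (d * Z + (2 ^ l + v)) :=
  h.listed v d hd (Or.inl hv)

theorem mem_spans (h : SearchData n M Z l S cnt bx sl ic G px rk xs sp sq ss fq fs) {v d : ℕ}
    (hv : v < 2 ^ l) (hd : d < sp (2 ^ l + v)) :
    Spans (n * M) rk S v (sq (d * Z + (2 ^ l + v))) ∧ (v + 1) * S < n * M := by
  have h1 := (h.envelope v hv).mem d hd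
  refine ⟨h1, (Nat.mul_le_of_le_div _ _ _ h1.2.2).trans_lt (h.ranking.rk_lt ?_ h1.1)⟩
  have := h1.1
  omega

theorem right_le_start (h : SearchData n M Z l S cnt bx sl ic G px rk xs sp sq ss fq fs)
    {v v' d' : ℕ} (hvv' : v < v') (hv' : v' < 2 ^ l) (hd' : d' < sp (2 ^ l + v')) :
    xs ((v + 1) * S) ≤ ss (d' * Z + (2 ^ l + v')) := by
  have h1 := (h.mem_spans hv' hd').2
  rw [Nat.add_mul, one_mul] at h1
  exact (h.ranking.mono _ _ (Nat.mul_le_mul_right S hvv') (by omega)).trans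
    ((h.envelope v' hv').left_le hd')

theorem fs_mono (h : SearchData n M Z l S cnt bx sl ic G px rk xs sp sq ss fq fs) {a b : ℕ}
    (hab : a ≤ b) (hb : b < cnt) : fs a ≤ fs b := by
  rw [h.cnt_eq] at hb
  obtain ⟨v, hv, d, hd, rfl⟩ := exists_listStart_add (hab.trans_lt hb)
  obtain ⟨v', hv', d', hd', rfl⟩ := exists_listStart_add hb
  rw [(h.listed_eq hv hd).2, (h.listed_eq hv' hd').2]
  rcases lt_trichotomy v v' with h1 | rfl | h1
  · exact ((h.envelope v hv).lt_right d hd).le.trans (h.right_le_start h1 hv' hd')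
  · rcases (by omega : d ≤ d').eq_or_lt with rfl | h2
    · exact le_rfl
    · exact ((h.envelope v hv).start_lt h2 hd').1.le
  · have h2 := listStart_mono (2 ^ l) sp (Nat.succ_le_of_lt h1)
    rw [Nat.succ_eq_add_one, listStart_succ] at h2
    omega

theorem fq_lt (h : SearchData n M Z l S cnt bx sl ic G px rk xs sp sq ss fq fs) {p : ℕ}
    (hp : p < cnt) : fq p < n * M := by
  rw [h.cnt_eq] at hp
  obtain ⟨v, hv, d, hd, rfl⟩ := exists_listStart_add hp
  rw [(h.listed_eq hv hd).1]
  exact (h.mem_spans hv hd).1.1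

/-- Since `lo` counts all breakpoints up to `x`, including those equal to `x`, the comparison with
`x` becomes a comparison of ranks whatever the order of ties. -/
theorem bx_le_iff (h : SearchData n M Z l S cnt bx sl ic G px rk xs sp sq ss fq fs) {lo q : ℕ}
    (hlo : IsRank (n * M) xs x lo) (hq : q < n * M) : bx q ≤ x ↔ rk q < lo := by
  rw [← h.ranking.xs_rk hq]
  refine ⟨fun h1 => ?_, hlo.2.1 _⟩
  by_contra h2
  exact absurd h1 (not_le.2 (hlo.2.2 _ (not_lt.1 h2) (h.ranking.rk_lt (by omega) hq.le)))

/-- It suffices to try the functions with breakpoints in the node of `x` and the line whose start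
precedes `x`. -/
theorem le_of_tried (h : SearchData n M Z l S cnt bx sl ic G px rk xs sp sq ss fq fs) {lo p : ℕ}
    {b : ℝ} (hlo : IsRank (n * M) xs x lo) (hp : IsRank cnt fs x p) (hb : 0 ≤ b)
    (hleaf : ∀ k < S, (lo - 1) / S * S + k < n * M → ∀ j < M,
      Tried bx sl ic x b (px ((lo - 1) / S * S + k) / M * M + j))
    (hlist : 0 < p → Tried bx sl ic x b (fq (p - 1))) {i : ℕ} (hi : i < n) : G i x ≤ b := by
  have hM := h.two_le
  by_cases hG : 0 < G i x
  swap
  · exact (not_lt.1 hG).trans hb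
  obtain ⟨s1, s2⟩ := h.pieces.support i hi x hG
  obtain ⟨j, hj, j1, j2⟩ := exists_lt_and_not_succ (m := M - 1) (p := fun j => bx (i * M + j) ≤ x) s1
    (not_le.2 s2)
  have hiM : i * M + M ≤ n * M := by
    rw [← Nat.succ_mul]
    exact Nat.mul_le_mul_right _ hi
  have hq1 : i * M + j < n * M := by omega
  have hq2 : i * M + j + 1 < n * M := by omega
  have hx : x ≤ bx (i * M + j + 1) := (not_le.1 j2).le
  rw [h.pieces.line i hi j (by omega) x j1 hx]
  have r1 := (h.bx_le_iff hlo hq1).1 j1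
  have r2 : ¬ rk (i * M + j + 1) < lo := fun h' => j2 ((h.bx_le_iff hlo hq2).2 h')
  have hrlt := fun {q} (hq : q < n * M) => h.ranking.rk_lt (by omega) hq.le
  -- The rank `lo - 1` is that of the last breakpoint not after `x`, so `v` is the slab of `x`. By
  -- `r1`, `lo` is positive.
  set v := (lo - 1) / S with hv
  have hvS : v * S ≤ lo - 1 := Nat.div_mul_le_self _ _
  have hvS' : lo - 1 < (v + 1) * S := by
    rw [← Nat.div_lt_iff_lt_mul h.pos]
    exact Nat.lt_succ_self _
  -- If one end of the piece has its rank in the slab, the scan meets this breakpoint and tries all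
  -- pieces of its function.
  have leaf : ∀ j' < M, rk (i * M + j') / S = v → lineAt sl ic (i * M + j) x ≤ b := by
    intro j' hj' hr
    have hq' : i * M + j' < n * M := by omega
    have e1 : v * S + rk (i * M + j') % S = rk (i * M + j') := by
      rw [← hr, Nat.mul_comm, Nat.div_add_mod]
    have h1 := hleaf (rk (i * M + j') % S) (Nat.mod_lt _ h.pos) (by rw [e1]; exact hrlt hq') j
      (by omega)
    rw [e1, h.ranking.px_rk hq', mul_add_div_eq hj'] at h1
    exact h1 j1 hx
  by_cases l1 : rk (i * M + j) / S = v
  · exact leaf j (by omega) l1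
  by_cases l2 : rk (i * M + (j + 1)) / S = v
  · exact leaf (j + 1) (by omega) l2
  have m1 : rk (i * M + j) / S ≤ v := Nat.div_le_div_right (by omega)
  have m2 : v ≤ rk (i * M + j + 1) / S := Nat.div_le_div_right (by omega)
  rw [← Nat.add_assoc] at l2
  have hsp : Spans (n * M) rk S v (i * M + j) := ⟨hq1, by omega, by omega⟩
  have hvN : (v + 1) * S < n * M := (Nat.mul_le_of_le_div _ _ _ hsp.2.2).trans_lt (hrlt hq2)
  have hvl : v < 2 ^ l := by
    by_contra h'
    have := Nat.mul_le_mul_right S (not_lt.1 h')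
    have := h.size
    rw [Nat.add_mul] at hvN
    omega
  have hE := h.envelope v hvl
  have x1 : xs (v * S) ≤ x := hlo.2.1 _ (by omega)
  have x2 : x < xs ((v + 1) * S) := hlo.2.2 _ (by omega) hvN
  obtain ⟨d₀, hd₀, -⟩ := hE.cover _ hsp x x1 x2
  -- The highest line at `x` is the last one of the envelope of `v` that starts at or before `x`.
  obtain ⟨d, hd, d1, d2⟩ := exists_lt_and_not_succ (m := sp (2 ^ l + v))
    (p := fun d => d < sp (2 ^ l + v) ∧ ss (d * Z + (2 ^ l + v)) ≤ x)
    ⟨by omega, by rw [hE.first (by omega)]; exact x1⟩ fun h' => absurd h'.1 (lt_irrefl _)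
  have hle := hE.le_of_start_le hd d1.2 (fun h' => (not_le.1 fun h'' => d2 ⟨h', h''⟩).le) x2 hsp
  have hmono := listStart_mono (2 ^ l) sp (Nat.succ_le_of_lt hvl)
  rw [Nat.succ_eq_add_one, listStart_succ] at hmono
  have hcnt := h.cnt_eq
  -- In the common list, this line immediately precedes the position found by the search: the next
  -- line of the same node starts after `x`, and the lines of later nodes start at or beyond the
  -- right border of `v`.
  have hp1 : p = listStart (2 ^ l) sp v + d + 1 := by
    refine le_antisymm ?_ ?_
    · by_contra hlt
      have h3 := hp.2.1 (listStart (2 ^ l) sp v + (d + 1)) (by omega)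
      have h4 : listStart (2 ^ l) sp v + (d + 1) < listStart (2 ^ l) sp (2 ^ l) := by
        have := hp.1
        omega
      by_cases h5 : d + 1 < sp (2 ^ l + v)
      · rw [(h.listed_eq hvl h5).2] at h3
        exact d2 ⟨h5, h3⟩
      · obtain ⟨v', hv', d', hd', e⟩ := exists_listStart_add h4
        rw [e, (h.listed_eq hv' hd').2] at h3
        have h6 : v < v' := by
          by_contra h7
          have h8 := listStart_mono (2 ^ l) sp (not_lt.1 h7)
          rcases (not_lt.1 h7).eq_or_lt with h9 | h9
          · rw [h9] at hd' e
            omega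
          · have h10 := listStart_mono (2 ^ l) sp (Nat.succ_le_of_lt h9)
            rw [Nat.succ_eq_add_one, listStart_succ] at h10
            omega
        exact absurd h3 (not_le.2 (x2.trans_le (h.right_le_start h6 hv' hd')))
    · by_contra hlt
      have h3 := hp.2.2 (listStart (2 ^ l) sp v + d) (by omega) (by omega)
      rw [(h.listed_eq hvl hd).2] at h3
      exact absurd d1.2 (not_le.2 h3)
  have ht := hlist (by omega)
  rw [hp1, Nat.add_sub_cancel, (h.listed_eq hvl hd).1] at ht
  obtain ⟨q1, q2, q3⟩ := (h.mem_spans hvl hd).1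
  set q := sq (d * Z + (2 ^ l + v)) with hq
  -- The piece of the listed line passes over `v`, hence its breakpoints enclose `x` and the test
  -- before the evaluation succeeds.
  refine hle.trans (ht ((h.bx_le_iff hlo q1).2 ?_) ?_)
  · have := (Nat.div_lt_iff_lt_mul h.pos).1 q2
    omega
  · have hqN : q + 1 < n * M := by
      rcases Nat.lt_or_ge (q + 1) (n * M) with h' | h'
      · exact h'
      · rw [le_antisymm q1 h', h.ranking.rk_last, Nat.zero_div] at q3
        exact absurd q3 (Nat.not_lt_zero _)
    refine (not_le.1 fun h' => ?_).le
    have h3 := (h.bx_le_iff hlo hqN).1 h'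
    have h4 := Nat.mul_le_of_le_div _ _ _ q3
    rw [Nat.succ_eq_add_one] at h4
    omega

/-- A tried line is a lower bound for its function. -/
theorem line_le (h : SearchData n M Z l S cnt bx sl ic G px rk xs sp sq ss fq fs) {q : ℕ}
    (hq : q < n * M) (h₁ : bx q ≤ x) (h₂ : x ≤ bx (q + 1)) :
    q / M < n ∧ lineAt sl ic q x ≤ G (q / M) x := by
  have hM := h.two_le
  have h3 : q / M < n := (Nat.div_lt_iff_lt_mul (by omega)).2 hq
  refine ⟨h3, ?_⟩
  have e : q / M * M + q % M = q := by rw [Nat.mul_comm, Nat.div_add_mod]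
  have hm := Nat.mod_lt q (by omega : 0 < M)
  by_cases hj : q % M + 1 < M
  · have h4 := h.pieces.line (q / M) h3 (q % M) hj x (by rwa [e]) (by rwa [e])
    rw [e] at h4
    exact h4.ge
  · obtain ⟨g1, g2⟩ := h.pieces.gap (q / M) h3
    rw [show M - 1 = q % M by omega, e] at g1 g2
    rw [lineAt, g1, g2, zero_mul, add_zero]
    exact h.pieces.nonneg _ h3 x

end SearchData
end SearchData
end RealRAM

namespace RealRAM
-- The query program.
section Query

def bsearchStep (K : ℕ) : Program :=
  .iset 10 (.div (.add (.reg 6) (.reg 7)) (.lit 2)) ;;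
  .ite (.rle (.get K (.reg 10)) (.reg 1)) (.iset 6 (.add (.reg 10) (.lit 1))) (.iset 7 (.reg 10))

/-- Counts the entries of the increasing real array `K`, whose length is in word register `r`, that
are at most the value of real register `1`. -/
def bsearchProg (K r : ℕ) : Program :=
  .iset 7 (.reg r) ;; .iset 6 (.lit 0) ;; .loop (.ilt (.reg 6) (.reg 7)) (bsearchStep K)

def bsearchCost (K l : ℕ) : ℕ := 4 + (l + 1) * iterCost (.ilt (.reg 6) (.reg 7)) (bsearchStep K)

theorem bsearchProg_spec {W K r m l : ℕ} {f : ℕ → ℝ} {s : State} (hr : s.iv r = m)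
    (hW : 2 * m < W) (hl : m < 2 ^ l) (hf : ∀ i < m, s.ra K i = f i)
    (hm : ∀ a b, a ≤ b → b < m → f a ≤ f b) :
    Tri W (bsearchProg K r) s (bsearchCost K l) fun s' => IsRank m f (s.rv 1) (s'.iv 6) := by
  refine (Tri.seq (T₁ := 2) (R := fun s' => s'.iv 7 = m) (Tri.of_wp ?_) fun s₁ f₁ hs₁ =>
    Tri.seq (T₁ := 2) (R := fun s' => s'.iv 6 = 0) (Tri.of_wp ?_) fun s₂ f₂ hs₂ =>
    ((Tri.loop (fun s' => s'.iv 6 ≤ s'.iv 7 ∧ s'.iv 7 ≤ m ∧ (∀ i < s'.iv 6, f i ≤ s.rv 1) ∧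
      ∀ i, s'.iv 7 ≤ i → i < m → s.rv 1 < f i) (fun s' => (s'.iv 7 - s'.iv 6).size) ?_
      fun s₃ f₃ ⟨h1, h2, h3, h4⟩ hb => ?_).mono (Nat.mul_le_mul_right _ (Nat.succ_le_succ ?_))
      fun s₃ f₃ ⟨⟨h1, h2, h3, h4⟩, hb⟩ => ?_ : Tri W _ _ ((l + 1) * _) _)).mono
      (by rw [bsearchCost]; omega) fun _ _ h => h
  · simp only [Program.wp, IExp.eval, Function.update_self, hr]
    exact ⟨by omega, trivial⟩
  · simp only [Program.wp, IExp.eval, Function.update_self]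
    exact ⟨by omega, trivial⟩
  · have e7 : s₂.iv 7 = m := (f₂.iv 7 rfl).trans hs₁
    rw [e7, hs₂]
    exact ⟨Nat.zero_le _, le_rfl, fun i hi => by omega, fun i hi hi' => by omega⟩
  · have e1 : s₃.rv 1 = s.rv 1 := ((f₃.rv 1 rfl).trans (f₂.rv 1 rfl)).trans (f₁.rv 1 rfl)
    have eK : s₃.ra K = s.ra K := ((f₃.ra K rfl).trans (f₂.ra K rfl)).trans (f₁.ra K rfl)
    simp only [Test.holds, IExp.eval] at hb
    -- Halving the range shortens its binary length, which is the measure of the loop.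
    have hsz : ∀ d, d ≤ (s₃.iv 7 - s₃.iv 6) / 2 → d.size < (s₃.iv 7 - s₃.iv 6).size := by
      intro d hd
      obtain ⟨k, hk⟩ : ∃ k, (s₃.iv 7 - s₃.iv 6).size = k + 1 :=
        Nat.exists_eq_add_one.2 (Nat.size_pos.2 (by omega))
      have h5 := Nat.size_le.1 hk.le
      rw [pow_succ] at h5
      rw [hk]
      exact Nat.lt_succ_of_le (Nat.size_le.2 (by omega))
    simp only [bsearchStep, Program.wp, Test.holds, IExp.eval, RExp.eval, Function.update_apply,
      reduceIte, Nat.reduceEqDiff, e1, eK]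
    rw [hf _ (by omega)]
    refine ⟨by omega, fun h => ⟨by omega, ⟨by omega, h2, fun i hi => ?_, h4⟩, hsz _ (by omega)⟩,
      fun h => ⟨by omega, ⟨by omega, by omega, h3, fun i hi hi' => ?_⟩, hsz _ (by omega)⟩⟩
    · exact (hm _ _ (by omega) (by omega)).trans h
    · exact (not_le.1 h).trans_le (hm _ _ hi hi')
  · rw [hs₂, (f₂.iv 7 rfl).trans hs₁]
    exact Nat.size_le.2 (by simpa using hl)
  · simp only [Test.holds, IExp.eval] at hb
    have h5 : s₃.iv 6 = s₃.iv 7 := by omega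
    rw [← h5] at h2 h4
    exact ⟨h2, h3, h4⟩

/-- The stored tables. -/
structure Tables (N S cnt : ℕ) (bx sl ic : ℕ → ℝ) (px : ℕ → ℕ) (xs : ℕ → ℝ) (fq : ℕ → ℕ)
    (fs : ℕ → ℝ) (D : ℝ) (s : State) : Prop where
  size : s.ia 1 0 = N
  node : s.ia 1 1 = S
  count : s.ia 1 2 = cnt
  shift : s.ra 9 0 = D
  px : ∀ r < N, s.ia 2 r = px r
  fq : ∀ p < cnt, s.ia 3 p = fq p
  bx : ∀ q ≤ N, s.ra 2 q = bx q
  sl : ∀ q < N, s.ra 4 q = sl q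
  ic : ∀ q < N, s.ra 5 q = ic q
  xs : ∀ r < N, s.ra 6 r = xs r
  fs : ∀ p < cnt, s.ra 8 p = fs p

theorem Tables.congr {N S cnt : ℕ} {bx sl ic : ℕ → ℝ} {px : ℕ → ℕ} {xs : ℕ → ℝ} {fq : ℕ → ℕ}
    {fs : ℕ → ℝ} {D : ℝ} {s s' : State} (h : Tables N S cnt bx sl ic px xs fq fs D s)
    (h₁ : s'.ia = s.ia) (h₂ : s'.ra = s.ra) : Tables N S cnt bx sl ic px xs fq fs D s' := by
  constructor <;> simp only [h₁, h₂]
  exacts [h.size, h.node, h.count, h.shift, h.px, h.fq, h.bx, h.sl, h.ic, h.xs, h.fs]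

/-- Compares the line of the piece in word register `9` with the best value so far. -/
def tryPiece (M : ℕ) : Program :=
  .ite (.and (.and (.rle (.get 2 (.reg 9)) (.reg 1))
      (.rle (.reg 1) (.get 2 (.add (.reg 9) (.lit 1)))))
      (.rlt (.reg 2) (lineExp (.reg 9) (.reg 1))))
    (.rset 2 (lineExp (.reg 9) (.reg 1)) ;; .iset 0 (.div (.reg 9) (.lit M))) .skip

/-- Tries the first `j` pieces of the function whose breakpoint has the rank in word register
`11`. -/
def tryMany (M : ℕ) : ℕ → Program
  | 0 => .skip
  | j + 1 => tryMany M j ;;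
      .iset 9 (.add (.mul (.div (.get 2 (.reg 11)) (.lit M)) (.lit M)) (.lit j)) ;; tryPiece M

def scanStep (M : ℕ) : Program :=
  .iset 11 (.add (.mul (.div (.sub (.reg 6) (.lit 1)) (.reg 3)) (.reg 3)) (.reg 8)) ;;
  .ite (.ilt (.reg 11) (.reg 1)) (tryMany M M) .skip ;;
  .iset 8 (.add (.reg 8) (.lit 1))

/-- The search starts with index `0` and best value `0`; this is sound because the functions are
nonnegative. -/
def queryInit : Program :=
  .iset 1 (.get 1 (.lit 0)) ;; .iset 3 (.get 1 (.lit 1)) ;; .iset 4 (.get 1 (.lit 2)) ;;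
  .ite (.ile (.reg 0) (.lit 0)) (.rset 1 (.reg 0)) (.rset 1 (.add (.reg 0) (.get 9 (.lit 0)))) ;;
  .iset 0 (.lit 0) ;; .rset 2 (.lit 0)

/-- Tries the line whose position follows the value of word register `6`. -/
def tryListed (M : ℕ) : Program :=
  .ite (.ile (.reg 6) (.lit 0)) .skip
    (.iset 9 (.get 3 (.sub (.reg 6) (.lit 1))) ;; tryPiece M)

def queryProg (M : ℕ) : Program :=
  queryInit ;; bsearchProg 6 1 ;; .iset 8 (.lit 0) ;;
  .loop (.ilt (.reg 8) (.reg 3)) (scanStep M) ;; bsearchProg 8 4 ;; tryListed M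

/-- The register `0` contains the number of a function whose value at `x` is at least the
nonnegative number in real register `2`. -/
structure Sound (n : ℕ) (G : ℕ → ℝ → ℝ) (x : ℝ) (s : State) : Prop where
  lt : s.iv 0 < n
  nonneg : 0 ≤ s.rv 2
  le : s.rv 2 ≤ G (s.iv 0) x
  point : s.rv 1 = x

/-- The best value does not decrease. -/
structure Improves (s s' : State) : Prop where
  ia : s'.ia = s.ia
  ra : s'.ra = s.ra
  iv : ∀ r, r ≠ 0 → r ≠ 9 → s'.iv r = s.iv r
  le : s.rv 2 ≤ s'.rv 2

theorem Improves.trans {s₁ s₂ s₃ : State} (h : Improves s₁ s₂) (h' : Improves s₂ s₃) :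
    Improves s₁ s₃ :=
  ⟨h'.ia.trans h.ia, h'.ra.trans h.ra, fun r h0 h9 => (h'.iv r h0 h9).trans (h.iv r h0 h9),
    h.le.trans h'.le⟩

theorem Tried.mono {bx sl ic : ℕ → ℝ} {x b b' : ℝ} {q : ℕ} (h : Tried bx sl ic x b q)
    (hb : b ≤ b') : Tried bx sl ic x b' q := fun h₁ h₂ => (h h₁ h₂).trans hb

variable {W n M Z l S cnt : ℕ} {bx sl ic : ℕ → ℝ} {G : ℕ → ℝ → ℝ} {px rk : ℕ → ℕ}
  {xs : ℕ → ℝ} {sp sq : ℕ → ℕ} {ss : ℕ → ℝ} {fq : ℕ → ℕ} {fs : ℕ → ℝ} {x D : ℝ} {s : State}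

theorem tryPiece_spec {q : ℕ} (hd : SearchData n M Z l S cnt bx sl ic G px rk xs sp sq ss fq fs)
    (ht : Tables (n * M) S cnt bx sl ic px xs fq fs D s) (hs : Sound n G x s) (h9 : s.iv 9 = q)
    (hq : q < n * M) (hW : n < W) :
    (tryPiece M).wp W (fun s' => Improves s s' ∧ Sound n G x s' ∧
      Tried bx sl ic x (s'.rv 2) q) s := by
  simp only [tryPiece, lineExp, Program.wp, Test.holds, IExp.eval, RExp.eval, h9, hs.point,
    ht.bx q hq.le, ht.bx (q + 1) hq, ht.sl q hq, ht.ic q hq]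
  refine ⟨fun ⟨⟨h1, h2⟩, h3⟩ => ?_, fun h => ⟨⟨rfl, rfl, fun _ _ _ => rfl, le_rfl⟩, hs,
    fun h1 h2 => not_lt.1 fun h3 => h ⟨⟨h1, h2⟩, h3⟩⟩⟩
  obtain ⟨l1, l2⟩ := hd.line_le hq h1 h2
  refine ⟨l1.trans hW, ⟨rfl, rfl, fun r h0 _ => Function.update_of_ne h0 _ _, ?_⟩,
    ⟨?_, ?_, ?_, ?_⟩, ?_⟩ <;> simp only [Function.update_apply, reduceIte, Nat.reduceEqDiff]
  · exact h3.le
  · exact l1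
  · exact hs.nonneg.trans h3.le
  · exact l2
  · exact hs.point
  · exact fun _ _ => le_rfl

theorem tryMany_spec {r : ℕ} (hd : SearchData n M Z l S cnt bx sl ic G px rk xs sp sq ss fq fs)
    (ht : Tables (n * M) S cnt bx sl ic px xs fq fs D s) (hs : Sound n G x s)
    (h11 : s.iv 11 = r) (hr : r < n * M) (hW : n * M < W) (m : ℕ) (hm : m ≤ M) :
    (tryMany M m).wp W (fun s' => Improves s s' ∧ Sound n G x s' ∧
      ∀ j < m, Tried bx sl ic x (s'.rv 2) (px r / M * M + j)) s := by
  induction m with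
  | zero => exact ⟨⟨rfl, rfl, fun _ _ _ => rfl, le_rfl⟩, hs, fun j hj => by omega⟩
  | succ m ih =>
    rw [tryMany, Program.wp]
    refine Program.wp_mono (ih (by omega)) fun s₁ ⟨i1, i2, i3⟩ => ?_
    have hM := hd.two_le
    have hpx := hd.ranking.perm.lt hr
    have h1 : px r / M < n := (Nat.div_lt_iff_lt_mul (by omega)).2 hpx
    have hq : px r / M * M + m < n * M := by
      have := Nat.mul_le_mul_right M h1
      rw [Nat.succ_eq_add_one, Nat.add_mul] at this
      omega
    have e11 : s₁.iv 11 = r := (i1.iv 11 (by norm_num) (by norm_num)).trans h11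
    simp only [Program.wp, IExp.eval, e11, i1.ia, ht.px r hr]
    refine ⟨hq.trans hW, Program.wp_mono (tryPiece_spec hd (ht.congr rfl i1.ra)
      (x := x) ⟨?_, i2.nonneg, ?_, i2.point⟩ rfl hq ?_)
      fun s₂ ⟨j1, j2, j3⟩ => ⟨?_, j2, fun j hj => ?_⟩⟩
    · simpa using i2.lt
    · simpa using i2.le
    · exact (Nat.le_mul_of_pos_right n (by omega)).trans_lt hW
    · refine i1.trans ⟨j1.ia.trans i1.ia.symm, j1.ra, fun r h0 h9 => ?_, j1.le⟩
      rw [j1.iv r h0 h9]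
      exact Function.update_of_ne h9 _ _
    · rcases Nat.lt_succ_iff_lt_or_eq.1 hj with h | rfl
      · exact (i3 j h).mono j1.le
      · exact j3

theorem setsI_tryMany (M m : ℕ) {r : ℕ} (h0 : r ≠ 0) (h9 : r ≠ 9) :
    (tryMany M m).setsI r = false := by
  induction m with
  | zero => rfl
  | succ m ih => simp [tryMany, tryPiece, Program.setsI, ih, h0, h9]

theorem tryListed_spec {p : ℕ} (hd : SearchData n M Z l S cnt bx sl ic G px rk xs sp sq ss fq fs)
    (ht : Tables (n * M) S cnt bx sl ic px xs fq fs D s) (hs : Sound n G x s) (h6 : s.iv 6 = p)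
    (hp : p ≤ cnt) (hW : n * M < W) :
    (tryListed M).wp W (fun s' => Improves s s' ∧ Sound n G x s' ∧
      (0 < p → Tried bx sl ic x (s'.rv 2) (fq (p - 1)))) s := by
  simp only [tryListed, Program.wp, Test.holds, IExp.eval, h6]
  refine ⟨fun h => ⟨⟨rfl, rfl, fun _ _ _ => rfl, le_rfl⟩, hs, fun h' => by omega⟩, fun h => ?_⟩
  have hM := hd.two_le
  have hq := hd.fq_lt (p := p - 1) (by omega)
  rw [ht.fq (p - 1) (by omega)]
  refine ⟨hq.trans hW, Program.wp_mono (tryPiece_spec (x := x) hd (ht.congr rfl rfl)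
      ⟨?_, hs.nonneg, ?_, hs.point⟩ rfl hq ?_)
      fun s₂ ⟨j1, j2, j3⟩ => ⟨⟨j1.ia, j1.ra, fun r h0 h9 => ?_, j1.le⟩, j2, fun _ => j3⟩⟩
  · simpa using hs.lt
  · simpa using hs.le
  · exact (Nat.le_mul_of_pos_right n (by omega)).trans_lt hW
  · rw [j1.iv r h0 h9]
    exact Function.update_of_ne h9 _ _

/-- The abscissa at which the functions are compared. -/
noncomputable def queryPoint (I : UnboundedInterval) (D : ℝ) : ℝ :=
  if I.tag = 0 then I.endpoint else I.endpoint + D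

def queryCost (M S l : ℕ) : ℕ :=
  queryInit.maxCost + (bsearchCost 6 l + (2 + ((S + 1) *
    iterCost (.ilt (.reg 8) (.reg 3)) (scanStep M) + (bsearchCost 8 l + (tryListed M).maxCost))))

theorem queryProg_spec {I : UnboundedInterval} {k : ℕ}
    (hd : SearchData n M Z l S cnt bx sl ic G px rk xs sp sq ss fq fs)
    (ht : Tables (n * M) S cnt bx sl ic px xs fq fs D s) (hn : 1 ≤ n)
    (h0 : s.iv 0 = I.tag) (hr0 : s.rv 0 = I.endpoint) (hW : 2 * (n * M) < W)
    (hW₁ : 2 * cnt < W) (hW₂ : n * M + S < W) (hk : n * M < 2 ^ k) (hk' : cnt < 2 ^ k) :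
    Tri W (queryProg M) s (queryCost M S k) fun s' => s'.iv 0 < n ∧
      ∀ i < n, G i (queryPoint I D) ≤ G (s'.iv 0) (queryPoint I D) := by
  have hM := hd.two_le
  set x := queryPoint I D with hx
  refine Tri.seq (R := fun s' => s'.iv 1 = n * M ∧ s'.iv 3 = S ∧ s'.iv 4 = cnt ∧ Sound n G x s')
    (Tri.of_wp ?_) fun s₁ f₁ ⟨b1, b3, b4, bs⟩ => ?_
  · simp only [queryInit, Program.wp, Test.holds, IExp.eval, RExp.eval, Function.update_apply,
      reduceIte, Nat.reduceEqDiff, ht.size, ht.node, ht.count, ht.shift, h0, hr0]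
    refine ⟨by omega, by omega, by omega, fun h => ⟨by omega, trivial, trivial, trivial, ?_⟩,
      fun h => ⟨by omega, trivial, trivial, trivial, ?_⟩⟩
    · refine ⟨?_, ?_, ?_, ?_⟩ <;>
        simp only [Function.update_apply, reduceIte, Nat.reduceEqDiff, Nat.cast_zero]
      · exact hn
      · exact le_rfl
      · exact hd.pieces.nonneg 0 hn x
      · rw [hx, queryPoint, if_pos (by omega)]
    · refine ⟨?_, ?_, ?_, ?_⟩ <;>
        simp only [Function.update_apply, reduceIte, Nat.reduceEqDiff, Nat.cast_zero]
      · exact hn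
      · exact le_rfl
      · exact hd.pieces.nonneg 0 hn x
      · rw [hx, queryPoint, if_neg (by omega)]
  have t₁ := ht.congr (funext fun a => f₁.ia a rfl) (funext fun a => f₁.ra a rfl)
  refine Tri.seq (R := fun s' => IsRank (n * M) xs x (s'.iv 6)) ?_ fun s₂ f₂ hlo => ?_
  · rw [← bs.point]
    exact bsearchProg_spec b1 hW hk t₁.xs hd.ranking.mono
  have t₂ := t₁.congr (funext fun a => f₂.ia a rfl) (funext fun a => f₂.ra a rfl)
  refine Tri.seq (T₁ := 2) (R := fun s' => s'.iv 8 = 0) (Tri.of_wp ?_) fun s₃ f₃ b8 => ?_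
  · simp only [Program.wp, IExp.eval, Function.update_self]
    exact ⟨by omega, trivial⟩
  have t₃ := t₂.congr (funext fun a => f₃.ia a rfl) (funext fun a => f₃.ra a rfl)
  have e6 := f₃.iv 6 rfl
  rw [← e6] at hlo
  set lo := s₃.iv 6 with hlo'
  have c1 : s₃.iv 1 = n * M := ((f₃.iv 1 rfl).trans (f₂.iv 1 rfl)).trans b1
  have c3 : s₃.iv 3 = S := ((f₃.iv 3 rfl).trans (f₂.iv 3 rfl)).trans b3
  have c4 : s₃.iv 4 = cnt := ((f₃.iv 4 rfl).trans (f₂.iv 4 rfl)).trans b4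
  have s3 : Sound n G x s₃ := by
    have d0 := (f₃.iv 0 rfl).trans (f₂.iv 0 rfl)
    have d1 := (f₃.rv 1 rfl).trans (f₂.rv 1 rfl)
    have d2 := (f₃.rv 2 rfl).trans (f₂.rv 2 rfl)
    exact ⟨d0 ▸ bs.lt, d2 ▸ bs.nonneg, by rw [d0, d2]; exact bs.le, d1.trans bs.point⟩
  have hlo1 : (lo - 1) / S * S ≤ lo - 1 := Nat.div_mul_le_self _ _
  have hlo2 := hlo.1
  refine Tri.seq (Tri.count_loop (fun k' s' => s'.ia = s₃.ia ∧ s'.ra = s₃.ra ∧ s'.iv 6 = lo ∧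
      s'.iv 1 = n * M ∧ s'.iv 4 = cnt ∧ Sound n G x s' ∧
      ∀ k < k', (lo - 1) / S * S + k < n * M → ∀ j < M,
        Tried bx sl ic x (s'.rv 2) (px ((lo - 1) / S * S + k) / M * M + j)) b8 c3 ?_ ?_
      fun k' hk' s₄ f₄ g8 g3 ⟨g, g', g6, g1, g4, gs, gt⟩ => ?_) fun s₄ f₄ ⟨g, g', g6, g1, g4, gs, gt⟩ => ?_
  · simp [scanStep, Program.setsI, setsI_tryMany]
  · exact ⟨rfl, rfl, rfl, c1, c4, s3, fun k h => by omega⟩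
  · have t₄ := t₃.congr g g'
    simp only [scanStep, Program.wp, Test.holds, IExp.eval, Function.update_apply, reduceIte,
      Nat.reduceEqDiff, g6, g3, g8, g1]
    set s₄' : State := { s₄ with iv := Function.update s₄.iv 11 ((lo - 1) / S * S + k') } with e₄
    have g11 : Sound n G x s₄' := by
      refine ⟨?_, gs.nonneg, ?_, gs.point⟩
      · simpa [e₄] using gs.lt
      · simpa [e₄] using gs.le
    refine ⟨by omega, fun hlt => Program.wp_mono (tryMany_spec (s := s₄') hd
      (t₄.congr rfl rfl) g11 rfl hlt (by omega) M le_rfl) fun s₅ ⟨j1, j2, j3⟩ => ?_, fun hlt => ?_⟩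
    · have i8 := j1.iv 8 (by norm_num) (by norm_num)
      have i6 := j1.iv 6 (by norm_num) (by norm_num)
      have i1 := j1.iv 1 (by norm_num) (by norm_num)
      have i4 := j1.iv 4 (by norm_num) (by norm_num)
      simp only [e₄, Function.update_apply, reduceIte, Nat.reduceEqDiff] at i8 i6 i1 i4
      rw [i8, i6, i1, i4, g8, g6, g1, g4]
      refine ⟨by omega, rfl, j1.ia.trans g, j1.ra.trans g', rfl, rfl, rfl,
        ⟨?_, j2.nonneg, ?_, j2.point⟩, fun k h h' j hj => ?_⟩
      · simpa using j2.lt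
      · simpa using j2.le
      · rcases Nat.lt_succ_iff_lt_or_eq.1 h with h1 | rfl
        · exact (gt k h1 h' j hj).mono j1.le
        · exact j3 j hj
    · refine ⟨by omega, trivial, g, g', trivial, trivial, g4, ⟨?_, gs.nonneg, ?_, gs.point⟩,
        fun k h h' j hj => ?_⟩
      · simpa using gs.lt
      · simpa using gs.le
      · rcases Nat.lt_succ_iff_lt_or_eq.1 h with h1 | rfl
        · exact gt k h1 h' j hj
        · exact absurd h' hlt
  have t₄ := t₃.congr g g'
  refine Tri.seq (R := fun s' => IsRank cnt fs x (s'.iv 6)) ?_ fun s₅ f₅ hp => ?_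
  · rw [← gs.point]
    exact bsearchProg_spec g4 hW₁ hk' t₄.fs fun a b => hd.fs_mono
  have t₅ := t₄.congr (funext fun a => f₅.ia a rfl) (funext fun a => f₅.ra a rfl)
  have d0 := f₅.iv 0 rfl
  have d1 := f₅.rv 1 rfl
  have d2 := f₅.rv 2 rfl
  have s5 : Sound n G x s₅ :=
    ⟨d0 ▸ gs.lt, d2 ▸ gs.nonneg, by rw [d0, d2]; exact gs.le, d1.trans gs.point⟩
  refine (Tri.of_wp (tryListed_spec hd t₅ s5 rfl hp.1 (by omega))).mono le_rfl
    fun s₆ _ ⟨j1, j2, j3⟩ => ⟨j2.lt, fun i hi => ?_⟩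
  refine le_trans (hd.le_of_tried hlo hp j2.nonneg (fun k h h' j hj => ?_) j3 hi) j2.le
  exact (gt k h h' j hj).mono (d2.symm.le.trans j1.le)

end Query
end RealRAM

namespace RealRAM
-- The preprocessing program.
section Build

variable {c n : ℕ}

/-- The first sort is by the breakpoints in real array `2`, the second by the slopes in real array
`4`. The first order is saved by `rankProg` before the second sort overwrites word array `4`. -/
def buildProg (c : ℕ) : Program :=
  convertProg c ;; sortProg 2 ;; rankProg ;; sortProg 4 ;; sizeProg ;; bucketProg ;; hullProg ;;
  flattenProg

def buildCost (c n l : ℕ) : ℕ :=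
  convertCost c n + (sortCost 2 (n * (2 * c)) l + (rankCost (n * (2 * c)) +
    (sortCost 4 (n * (2 * c)) l + (sizeCost l + (bucketCost (n * (2 * c)) l +
      (hullCost (n * (2 * c)) l + flattenCost (n * (2 * c))))))))

theorem _root_.PieceSystem.congr {M : ℕ} {bx sl ic sl' ic' : ℕ → ℝ} {G : ℕ → ℝ → ℝ}
    (h : PieceSystem n M bx sl ic G) (hM : 0 < M) (h₁ : ∀ q < n * M, sl' q = sl q)
    (h₂ : ∀ q < n * M, ic' q = ic q) : PieceSystem n M bx sl' ic' G where
  nonneg := h.nonneg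
  line i hi j hj x := by
    have hiM : (i + 1) * M ≤ n * M := Nat.mul_le_mul_right _ hi
    rw [Nat.add_mul, one_mul] at hiM
    rw [h₁ _ (by omega), h₂ _ (by omega)]
    exact h.line i hi j hj x
  support := h.support
  gap i hi := by
    have hiM : (i + 1) * M ≤ n * M := Nat.mul_le_mul_right _ hi
    rw [Nat.add_mul, one_mul] at hiM
    rw [h₁ _ (by omega), h₂ _ (by omega)]
    exact h.gap i hi

/-- The state holds a data structure for the query program. -/
def Prepared (P : Fin n → Histogram c) (l : ℕ) (s : State) : Prop :=
  ∃ lo hi : ℝ, InRange P lo hi ∧ ∃ (Z k S cnt : ℕ) (sl ic : ℕ → ℝ) (px rk : ℕ → ℕ) (xs : ℕ → ℝ)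
    (sp sq : ℕ → ℕ) (ss : ℕ → ℝ) (fq : ℕ → ℕ) (fs : ℕ → ℝ),
    SearchData n (2 * c) Z k S cnt (allPt P (hi - lo)) sl ic (allBump P (hi - lo)) px rk xs sp sq
      ss fq fs ∧
    Tables (n * (2 * c)) S cnt (allPt P (hi - lo)) sl ic px xs fq fs (hi - lo) s ∧
    S ≤ 2 * l ∧ cnt ≤ 6 * (n * (2 * c))

theorem buildProg_spec {W l : ℕ} (hc : 2 ≤ c) (hn : 1 ≤ n) (P : Fin n → Histogram c)
    (hl : n * (2 * c) ≤ 2 ^ l) (hl₁ : 1 ≤ l) (hW : 16 * ((n * (2 * c) + 1) * (l + 3)) < W) :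
    Tri W (buildProg c) (inputState P) (buildCost c n l) (Prepared P l) := by
  have hN : 0 < n * (2 * c) := Nat.mul_pos hn (by omega)
  have hW' : n * (2 * c) + 1 ≤ (n * (2 * c) + 1) * (l + 3) := Nat.le_mul_of_pos_right _ (by omega)
  have e2 : ∀ q, (inputState P).ra 2 q = 0 ∧ (inputState P).ra 3 q = 0 := fun q => by
    simp [inputState]
  have e7 : (inputState P).ia 7 = fun _ => 0 := by simp [inputState]
  have e9 : (inputState P).ia 9 = fun _ => 0 := by simp [inputState]
  refine Tri.seq (convertProg_spec hc (holdsInput_inputState P) e2 (by omega))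
    fun s₁ f₁ ⟨hrange, hD, hp⟩ => ?_
  set N := n * (2 * c) with hNdef
  set D := s₁.rv 2 with hDdef
  have x7 := (f₁.ia 7 rfl).trans e7
  have x9 := (f₁.ia 9 rfl).trans e9
  refine Tri.seq (sortProg_spec (by omega) hp.size hl) fun s₂ f₂ ⟨hperm, hsorted⟩ => ?_
  replace x7 := (f₂.ia 7 rfl).trans x7
  replace x9 := (f₂.ia 9 rfl).trans x9
  have y1 := (f₂.iv 1 rfl).trans hp.size
  have y2 := (f₂.ra 2 rfl).trans hp.pt
  have y4 : ∀ q < N, s₂.ra 4 q = allSlope P D q := (f₂.ra 4 rfl) ▸ hp.slope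
  have y5 : ∀ q < N, s₂.ra 5 q = allIcpt P D q := (f₂.ra 5 rfl) ▸ hp.icpt
  have yD := f₂.rv 2 rfl
  refine Tri.seq (rankProg_spec (by omega) y1 hperm ((f₂.ra 2 rfl) ▸ hsorted))
    fun s₃ f₃ hrank => ?_
  rw [y2] at hrank
  replace x7 := (f₃.ia 7 rfl).trans x7
  replace x9 := (f₃.ia 9 rfl).trans x9
  replace y1 := (f₃.iv 1 rfl).trans y1
  replace y2 := (f₃.ra 2 rfl).trans y2
  replace y4 : ∀ q < N, s₃.ra 4 q = allSlope P D q := (f₃.ra 4 rfl) ▸ y4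
  replace y5 : ∀ q < N, s₃.ra 5 q = allIcpt P D q := (f₃.ra 5 rfl) ▸ y5
  replace yD := (f₃.rv 2 rfl).trans yD
  refine Tri.seq (sortProg_spec (by omega) y1 hl) fun s₄ f₄ ⟨hperm', hsorted'⟩ => ?_
  rw [← f₄.ra 4 rfl] at hsorted' y4
  rw [← f₄.ra 5 rfl] at y5
  rw [← f₄.ia 2 rfl, ← f₄.ia 6 rfl, ← f₄.ra 6 rfl] at hrank
  replace x7 := (f₄.ia 7 rfl).trans x7
  replace x9 := (f₄.ia 9 rfl).trans x9
  replace y1 := (f₄.iv 1 rfl).trans y1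
  replace y2 := (f₄.ra 2 rfl).trans y2
  replace yD := (f₄.rv 2 rfl).trans yD
  refine Tri.seq (sizeProg_spec hN (by omega) y1 hl hl₁) fun s₅ f₅ ⟨hsize, hL, hZ⟩ => ?_
  rw [← f₅.ia 4 rfl] at hperm' hsorted'
  rw [← f₅.ra 4 rfl] at hsorted' y4
  rw [← f₅.ra 5 rfl] at y5
  rw [← f₅.ia 2 rfl, ← f₅.ia 6 rfl, ← f₅.ra 6 rfl] at hrank
  replace x7 := (f₅.ia 7 rfl).trans x7
  replace x9 := (f₅.ia 9 rfl).trans x9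
  replace y1 := (f₅.iv 1 rfl).trans y1
  replace y2 := (f₅.ra 2 rfl).trans y2
  replace yD := (f₅.rv 2 rfl).trans yD
  have hX : (N + 1) * (s₅.iv 3 + 3) ≤ (N + 1) * (l + 3) := Nat.mul_le_mul_left _ (by omega)
  have hts : TreeState W N (s₅.iv 3) (s₅.iv 4) (s₅.iv 7) s₅ :=
    { word := by omega, size := hsize, pos := hN, iv1 := y1, iv3 := rfl, iv4 := rfl, iv7 := rfl,
      eqZ := hZ }
  have hrk : ∀ q ≤ N, s₅.ia 6 q < N := fun q => hrank.rk_lt hN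
  refine Tri.seq ((bucketProg_spec hts hrk hperm' hsorted' (congrFun x7)).mono
    (T' := bucketCost N l) ?_ fun _ _ h => h) fun s₆ f₆ hb => ?_
  · rw [bucketCost, bucketCost]
    gcongr
  set L := s₅.iv 3
  set T := s₅.iv 4
  set Z := s₅.iv 7
  have g4 := f₆.ra 4 rfl
  have g5 := f₆.ra 5 rfl
  have g6 := f₆.ra 6 rfl
  have k6 := f₆.ia 6 rfl
  have hts₆ : TreeState W N L T Z s₆ :=
    hts.congr (f₆.iv 1 rfl) (f₆.iv 3 rfl) (f₆.iv 4 rfl) (f₆.iv 7 rfl)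
  refine Tri.seq ((hullProg_spec hts₆ ⟨hN, hsize, hZ, by rw [k6]; exact hrk,
    by rw [g6]; exact hrank.mono, by rw [k6, g4]; exact hb⟩
    (congrFun ((f₆.ia 9 rfl).trans x9))).mono (T' := hullCost N l) ?_ fun _ _ h => h)
    fun s₇ f₇ ⟨k, h5, hd⟩ => ?_
  · rw [hullCost, hullCost, hullBound, hullBound]
    gcongr
  rw [k6, g4, g5, g6] at hd
  have hts₇ : TreeState W N L T Z s₇ :=
    hts₆.congr (f₇.iv 1 rfl) (f₇.iv 3 rfl) (f₇.iv 4 rfl) (f₇.iv 7 rfl)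
  have z6 := (f₇.ra 6 rfl).trans g6
  refine (flattenProg_spec (by omega) hts₇ h5 hrk hrank.mono hd).mono le_rfl
    fun s₈ f₈ ⟨hlist, m0, m1, m2, mD⟩ => ?_
  have hDe : s₁.rv 1 - s₁.rv 0 = D := hD.symm
  refine ⟨s₁.rv 0, s₁.rv 1, hrange, ?_⟩
  rw [hDe]
  have hD₁ : ∀ i, (P i).pt (P i).k ≤ (P i).pt 0 + D := fun i => by
    have := hrange i
    linarith
  have hD₀ : 0 ≤ D := by
    have h1 := hrange ⟨0, hn⟩
    have h2 := (P ⟨0, hn⟩).pt_mono (Nat.zero_le (P ⟨0, hn⟩).k)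
    linarith
  refine ⟨Z, k, T / 2 ^ k, s₈.ia 1 2, s₅.ra 4, s₅.ra 5, s₅.ia 2, s₅.ia 6, s₅.ra 6, s₇.ia 9,
    s₇.ia 10, s₇.ra 7, s₈.ia 3, s₈.ra 8, ?_, ?_, ?_, ?_⟩
  · exact
      { pieces := (pieceSystem_allBump hc hD₀ hD₁).congr (by omega) y4 y5
        ranking := hrank
        pos := by have := hd.le; have := hsize.pos; omega
        two_le := by omega
        size := by rw [hd.mul_eq]; exact hsize.le
        envelope := hd.envelope
        listed := hlist
        cnt_eq := m2 }
  · have w2 := ((f₈.ra 2 rfl).trans (f₇.ra 2 rfl)).trans ((f₆.ra 2 rfl).trans y2)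
    have w4 := ((f₈.ra 4 rfl).trans (f₇.ra 4 rfl)).trans g4
    have w5 := ((f₈.ra 5 rfl).trans (f₇.ra 5 rfl)).trans g5
    have w6 := (f₈.ra 6 rfl).trans z6
    have v2 := ((f₈.ia 2 rfl).trans (f₇.ia 2 rfl)).trans (f₆.ia 2 rfl)
    exact ⟨m0, m1, rfl, by rw [mD, f₇.rv 2 rfl, f₆.rv 2 rfl, yD],
      fun r _ => by rw [v2], fun p _ => rfl, fun q _ => by rw [w2], fun q _ => by rw [w4],
      fun q _ => by rw [w5], fun q _ => by rw [w6], fun p _ => rfl⟩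
  · have := hd.lt
    omega
  · rw [m2]
    exact hd.sum_le hN hsize hrk hrank.mono

end Build
end RealRAM

namespace RealRAM
-- Growth of the time bounds.
section Cost

/-- At most linear growth. -/
def LinearBound (g : ℕ → ℕ) : Prop := ∃ C, ∀ n, g n ≤ C * (n + 1)

/-- At most the growth of a product of linear functions. -/
def CostBound (f : ℕ → ℕ → ℕ) : Prop := ∃ C, ∀ n l, f n l ≤ C * ((n + 1) * (l + 3))

namespace LinearBound

theorem const (a : ℕ) : LinearBound fun _ => a := ⟨a, fun _ => Nat.le_mul_of_pos_right _ (by omega)⟩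

theorem id : LinearBound fun n => n := ⟨1, fun n => (Nat.le_succ n).trans_eq (Nat.one_mul _).symm⟩

theorem add {f g : ℕ → ℕ} (hf : LinearBound f) (hg : LinearBound g) :
    LinearBound fun n => f n + g n := by
  obtain ⟨C, hC⟩ := hf
  obtain ⟨D, hD⟩ := hg
  exact ⟨C + D, fun n => (Nat.add_le_add (hC n) (hD n)).trans_eq (Nat.add_mul _ _ _).symm⟩

theorem mul_const {f : ℕ → ℕ} (hf : LinearBound f) (a : ℕ) : LinearBound fun n => f n * a := by
  obtain ⟨C, hC⟩ := hf
  exact ⟨C * a, fun n => (Nat.mul_le_mul_right a (hC n)).trans_eq (by ring)⟩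

end LinearBound

namespace CostBound

theorem of_linear {g : ℕ → ℕ} (hg : LinearBound g) : CostBound fun n _ => g n := by
  obtain ⟨C, hC⟩ := hg
  exact ⟨C, fun n l => (hC n).trans (Nat.mul_le_mul_left _ (Nat.le_mul_of_pos_right _ (by omega)))⟩

theorem mul_add_three {g : ℕ → ℕ} (hg : LinearBound g) : CostBound fun n l => g n * (l + 3) := by
  obtain ⟨C, hC⟩ := hg
  exact ⟨C, fun n l => (Nat.mul_le_mul_right _ (hC n)).trans_eq (Nat.mul_assoc _ _ _)⟩

theorem mul_linear {g : ℕ → ℕ} (hg : LinearBound g) : CostBound fun n l => l * g n := by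
  obtain ⟨C, hC⟩ := mul_add_three hg
  refine ⟨C, fun n l => le_trans ?_ (hC n l)⟩
  exact (Nat.mul_comm _ _).trans_le (Nat.mul_le_mul_left _ (by omega))

theorem level : CostBound fun _ l => l :=
  ⟨1, fun n l => by
    rw [Nat.one_mul]
    exact (Nat.le_add_right l 3).trans (Nat.le_mul_of_pos_left _ (by omega))⟩

theorem add {f g : ℕ → ℕ → ℕ} (hf : CostBound f) (hg : CostBound g) :
    CostBound fun n l => f n l + g n l := by
  obtain ⟨C, hC⟩ := hf
  obtain ⟨D, hD⟩ := hg
  exact ⟨C + D, fun n l => (Nat.add_le_add (hC n l) (hD n l)).trans_eq (Nat.add_mul _ _ _).symm⟩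

theorem mul_const {f : ℕ → ℕ → ℕ} (hf : CostBound f) (a : ℕ) :
    CostBound fun n l => f n l * a := by
  obtain ⟨C, hC⟩ := hf
  exact ⟨C * a, fun n l => (Nat.mul_le_mul_right a (hC n l)).trans_eq (by ring)⟩

theorem const_mul {f : ℕ → ℕ → ℕ} (hf : CostBound f) (a : ℕ) :
    CostBound fun n l => a * f n l := by
  simpa only [Nat.mul_comm] using hf.mul_const a

theorem const (a : ℕ) : CostBound fun _ _ => a := of_linear (.const a)

end CostBound

variable (c : ℕ)

theorem linearBound_size : LinearBound fun n => n * (2 * c) := LinearBound.id.mul_const _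

theorem linearBound_succ_mul (a : ℕ) : LinearBound fun n => (n * (2 * c) + 1) * a :=
  ((linearBound_size c).add (.const 1)).mul_const a

theorem costBound_sort (K : ℕ) : CostBound fun n l => sortCost K (n * (2 * c)) l := by
  refine (CostBound.const _).add ((CostBound.of_linear (linearBound_succ_mul c _)).add
    ((CostBound.const _).add (((CostBound.mul_linear (LinearBound.add (LinearBound.add ?_
      (.const _)) (.const _))).add (.const _)).add (.const _))))
  exact (LinearBound.const _).add ((linearBound_succ_mul c _).add ((LinearBound.const _).add
    ((linearBound_succ_mul c _).add (.const _))))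

theorem costBound_build : CostBound (buildCost c) := by
  refine CostBound.add (.of_linear ?_) ((costBound_sort c 2).add (CostBound.add (.of_linear ?_)
    ((costBound_sort c 4).add (CostBound.add ?_ (CostBound.add ?_ (CostBound.add ?_
      (.of_linear ?_)))))))
  · exact (LinearBound.const _).add (((LinearBound.id.add (.const 1)).mul_const _).add
      ((LinearBound.const _).add ((((LinearBound.id.mul_const c).add (.const 1)).mul_const _).add
        ((LinearBound.const _).add (linearBound_succ_mul c _)))))
  · exact (LinearBound.const _).add ((linearBound_succ_mul c _).add (.const _))
  · exact (CostBound.const _).add (((CostBound.level.add (.const 1)).mul_const _).add (.const _))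
  · exact (CostBound.const _).add
      (((CostBound.mul_add_three (linearBound_size c)).add (.const 1)).mul_const _)
  · exact (CostBound.const _).add ((((CostBound.mul_add_three
      ((linearBound_size c).add (.const 1))).const_mul 32).add (.const 1)).mul_const _)
  · refine (LinearBound.const _).add (LinearBound.add (LinearBound.mul_const (LinearBound.add ?_
      (.const 1)) _) (.const _))
    simpa only [Nat.mul_comm] using (linearBound_size c).mul_const 8

theorem costBound_query (M : ℕ) : CostBound fun _ l => queryCost M (2 * l) l := by
  have h : ∀ K, CostBound fun _ l => bsearchCost K l := fun K =>
    (CostBound.const _).add ((CostBound.level.add (.const 1)).mul_const _)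
  exact (CostBound.const _).add ((h 6).add ((CostBound.const 2).add
    ((((CostBound.level.const_mul 2).add (.const 1)).mul_const _).add ((h 8).add (.const _)))))

end Cost

/-! ### From the functions back to probabilities, with the memory cut down. -/

section Answer

variable {c n : ℕ} {P : Fin n → Histogram c} {lo hi : ℝ}

/-- The functions `allBump` compare the probabilities of an unbounded interval. -/
theorem isTop1Answer_of_le (hr : InRange P lo hi) (I : UnboundedInterval) {s : State}
    (hs : s.iv 0 < n) (h : ∀ i < n, allBump P (hi - lo) i (queryPoint I (hi - lo)) ≤
      allBump P (hi - lo) (s.iv 0) (queryPoint I (hi - lo))) : IsTop1Answer P I s := by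
  refine ⟨⟨s.iv 0, hs⟩, rfl, fun j => ?_⟩
  have hj := h j j.2
  rw [allBump, allBump, dif_pos j.2, dif_pos hs] at hj
  set i : Fin n := ⟨s.iv 0, hs⟩
  change (P j).bump (hi - lo) _ ≤ (P i).bump (hi - lo) _ at hj
  cases I with
  | atMost b =>
    simp only [queryPoint, UnboundedInterval.tag, UnboundedInterval.endpoint, if_true,
      UnboundedInterval.toSet, Histogram.law_Iic] at hj ⊢
    -- Up to `hi` the subtracted copy is still `0` for every point. Beyond `hi` every probability is
    -- `1`, so any index is right.
    rcases le_total b hi with hb | hb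
    · rw [Histogram.bump_of_le _ (by linarith [(hr j).1]),
        Histogram.bump_of_le _ (by linarith [(hr i).1])] at hj
      exact ENNReal.ofReal_le_ofReal hj
    · rw [Histogram.cdf_of_ge _ ((hr j).2.trans hb), Histogram.cdf_of_ge _ ((hr i).2.trans hb)]
  | atLeast a =>
    simp only [queryPoint, UnboundedInterval.tag, UnboundedInterval.endpoint, one_ne_zero, if_false,
      UnboundedInterval.toSet, Histogram.law_Ici] at hj ⊢
    -- For `lo ≤ a` the abscissa `a + D` is beyond all breakpoints, so the first copy is `1` for
    -- every point. Below `lo` every probability is `1`.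
    rcases le_total lo a with ha | ha
    · rw [Histogram.bump_of_ge _ (by linarith [(hr j).2]),
        Histogram.bump_of_ge _ (by linarith [(hr i).2]), add_sub_cancel_right] at hj
      exact ENNReal.ofReal_le_ofReal hj
    · rw [Histogram.cdf_of_le _ (ha.trans (hr j).1), Histogram.cdf_of_le _ (ha.trans (hr i).1)]
  | whole => simp only [UnboundedInterval.toSet, Histogram.law_univ, le_refl]

/-- A query reads only header cells, tables indexed by pieces or ranks up to `N`, and the common
list of length at most `6 * N`. All of these lie in the kept prefix of the kept arrays. -/
theorem query_of_prepared {l k W len : ℕ} {s : State} (hs : Prepared P l s) (hn : 1 ≤ n)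
    (I : UnboundedInterval) (hk : 6 * (n * (2 * c)) < 2 ^ k) (hlk : l ≤ k)
    (hlen : 6 * (n * (2 * c)) + 3 ≤ len)
    (hW : 16 * ((n * (2 * c) + 1) * (l + 3)) < W) :
    Tri W (queryProg (2 * c))
      (queryState (s.restrict 11 len) I) (queryCost (2 * c) (2 * k) k)
      (IsTop1Answer P I) := by
  obtain ⟨lo, hi, hr, Z, m, S, cnt, sl, ic, px, rk, xs, sp, sq, ss, fq, fs, hd, ht, hS, hcnt⟩ := hs
  have e : (n * (2 * c) + 1) * (l + 3) = n * (2 * c) * l + 3 * (n * (2 * c)) + l + 3 := by ring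
  have ht' : Tables (n * (2 * c)) S cnt (allPt P (hi - lo)) sl ic px xs fq fs (hi - lo)
      (queryState (s.restrict 11 len) I) := by
    have hia : ∀ a i, a < 11 → i < len →
        (queryState (s.restrict 11 len) I).ia a i = s.ia a i :=
      fun a i ha hi => if_pos ⟨ha, hi⟩
    have hra : ∀ a i, a < 11 → i < len →
        (queryState (s.restrict 11 len) I).ra a i = s.ra a i :=
      fun a i ha hi => if_pos ⟨ha, hi⟩
    constructor
    · rw [hia _ _ (by norm_num) (by omega), ht.size]
    · rw [hia _ _ (by norm_num) (by omega), ht.node]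
    · rw [hia _ _ (by norm_num) (by omega), ht.count]
    · rw [hra _ _ (by norm_num) (by omega), ht.shift]
    · intro r h; rw [hia _ _ (by norm_num) (by omega), ht.px r h]
    · intro r h; rw [hia _ _ (by norm_num) (by omega), ht.fq r h]
    · intro r h; rw [hra _ _ (by norm_num) (by omega), ht.bx r h]
    · intro r h; rw [hra _ _ (by norm_num) (by omega), ht.sl r h]
    · intro r h; rw [hra _ _ (by norm_num) (by omega), ht.ic r h]
    · intro r h; rw [hra _ _ (by norm_num) (by omega), ht.xs r h]
    · intro r h; rw [hra _ _ (by norm_num) (by omega), ht.fs r h]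
  refine (queryProg_spec (W := W) (k := k) (I := I) hd ht' hn rfl rfl ?_ ?_ ?_ ?_ ?_).mono ?_
    fun s' _ ⟨h1, h2⟩ => isTop1Answer_of_le hr I h1 h2
  · generalize n * (2 * c) * l = y at e
    omega
  · generalize n * (2 * c) * l = y at e
    omega
  · generalize n * (2 * c) * l = y at e
    omega
  · omega
  · omega
  · rw [queryCost, queryCost]
    have : S ≤ 2 * k := by omega
    gcongr

end Answer
end RealRAM

/-! ### Constants, word size and the final assembly. -/

open RealRAM

/-- Both `Nat.log 2 n` and `1` are at most `log (n + 1) / log 2`, and `2 / log 2 < 4`. In this way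
additive constants are absorbed for `1 ≤ n`. -/
theorem log_two_succ_le {n : ℕ} (hn : 1 ≤ n) :
    ((Nat.log 2 n + 1 : ℕ) : ℝ) ≤ 4 * Real.log (n + 1) := by
  have h1 : (2 : ℝ) ^ (Nat.log 2 n) ≤ n := by exact_mod_cast Nat.pow_log_le_self 2 (by omega)
  have hn' : (1 : ℝ) ≤ n := by exact_mod_cast hn
  have h2 : (Nat.log 2 n : ℝ) * Real.log 2 ≤ Real.log (n + 1) := by
    rw [← Real.log_pow]
    exact Real.log_le_log (by positivity) (by linarith)
  have h3 : Real.log 2 ≤ Real.log (n + 1) := Real.log_le_log (by norm_num) (by linarith)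
  have h4 := Real.log_two_gt_d9
  have h5 : (0 : ℝ) ≤ (Nat.log 2 n : ℝ) := Nat.cast_nonneg _
  push_cast
  nlinarith

theorem le_log_of_le {n j m : ℕ} (hn : 1 ≤ n) (h : m ≤ j * (Nat.log 2 n + 1)) :
    (m : ℝ) ≤ (j * 4 : ℕ) * Real.log (n + 1) :=
  calc (m : ℝ) ≤ ((j * (Nat.log 2 n + 1) : ℕ) : ℝ) := by exact_mod_cast h
    _ = (j : ℝ) * ((Nat.log 2 n + 1 : ℕ) : ℝ) := by push_cast; ring
    _ ≤ (j : ℝ) * (4 * Real.log (n + 1)) := by gcongr; exact log_two_succ_le hn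
    _ = _ := by push_cast; ring

/-- The constant factor is moved into the exponent by `a < 2 ^ a ≤ (n + 2) ^ a`, so words with
`O(log n)` bits suffice. -/
theorem word_bound {c n l a : ℕ} (hl : l ≤ 2 * c + n + 1)
    (ha : a = 16 * ((2 * c + 1) * (2 * c + 4))) :
    16 * ((n * (2 * c) + 1) * (l + 3)) < (n + 2) ^ (a + 2) := by
  have h1 : n * (2 * c) + 1 ≤ (2 * c + 1) * (n + 2) := by
    have : (2 * c + 1) * (n + 2) = n * (2 * c) + 4 * c + n + 2 := by ring
    omega
  have h2 : l + 3 ≤ (2 * c + 4) * (n + 2) := by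
    have : (2 * c + 4) * (n + 2) = 2 * (c * n) + 4 * c + 4 * n + 8 := by ring
    omega
  calc 16 * ((n * (2 * c) + 1) * (l + 3))
      ≤ 16 * (((2 * c + 1) * (n + 2)) * ((2 * c + 4) * (n + 2))) := by gcongr
    _ = a * (n + 2) ^ 2 := by rw [ha]; ring
    _ < 2 ^ a * (n + 2) ^ 2 := Nat.mul_lt_mul_of_pos_right Nat.lt_two_pow_self (by positivity)
    _ ≤ (n + 2) ^ a * (n + 2) ^ 2 :=
        Nat.mul_le_mul_right _ (Nat.pow_le_pow_left (Nat.le_add_left 2 n) a)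
    _ = (n + 2) ^ (a + 2) := (pow_add _ _ _).symm

theorem cast_mul_le {C j n m : ℕ} {x y : ℝ} (hy : 0 ≤ y) (hm : (m : ℝ) ≤ (j : ℕ) * x)
    (hn : (n : ℝ) = y) : ((C * (n * m) : ℕ) : ℝ) ≤ ((C * j : ℕ) : ℝ) * (y * x) := by
  subst hn
  calc ((C * (n * m) : ℕ) : ℝ) = (C * n : ℝ) * (m : ℝ) := by push_cast; ring
    _ ≤ (C * n : ℝ) * ((j : ℕ) * x) := by gcongr
    _ = _ := by push_cast; ring

theorem mainTheorem5 (c : ℕ) :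
    ∃ (build query : RealRAM.Program) (w A : ℕ) (K : ℝ),
      ∀ n : ℕ, 1 ≤ n → ∀ P : Fin n → Histogram c,
        ∃ (t : ℕ) (s : RealRAM.State) (len : ℕ),
          RealRAM.Exec ((n + 2) ^ w) build (inputState P) t s ∧
          (t : ℝ) ≤ K * (n * Real.log (n + 1)) ∧
          ((2 * A * len : ℕ) : ℝ) ≤ K * n ∧
          ∀ I : UnboundedInterval, ∃ (t' : ℕ) (s' : RealRAM.State),
            RealRAM.Exec ((n + 2) ^ w) query (queryState (s.restrict A len) I) t' s' ∧
            (t' : ℝ) ≤ K * Real.log (n + 1) ∧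
            IsTop1Answer P I s' := by
  obtain ⟨C₁, hC₁⟩ := costBound_build c
  obtain ⟨C₂, hC₂⟩ := costBound_query (2 * c)
  obtain ⟨a, ha⟩ : ∃ a, a = 16 * ((2 * c + 1) * (2 * c + 4)) := ⟨_, rfl⟩
  obtain ⟨j₁, hj₁⟩ : ∃ j, j = (2 * c + 4) * 4 := ⟨_, rfl⟩
  obtain ⟨j₂, hj₂⟩ : ∃ j, j = (2 * c + 7) * 4 := ⟨_, rfl⟩
  -- With `N = 2 * c * n` and `1 ≤ n`, the prefix length `m * n` is at least `6 * N + 3`.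
  obtain ⟨m, hm⟩ : ∃ m, m = 12 * c + 3 := ⟨_, rfl⟩
  obtain ⟨K, hK⟩ : ∃ K, K = 2 * C₁ * j₁ + 2 * 11 * m + C₂ * j₂ := ⟨_, rfl⟩
  refine ⟨buildProg c, queryProg (2 * c), a + 2, 11, (K : ℝ), fun n hn P => ?_⟩
  -- Since `1 ≤ n`, there is a histogram, and its two unbounded pieces force `2 ≤ c`.
  have hc : 2 ≤ c := le_trans (Nat.le_add_left 2 _) (P ⟨0, hn⟩).pieces_le
  -- The exponent is chosen such that `2 ^ (2 * c)` exceeds `2 * c` and the remaining power of two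
  -- exceeds `n`.
  obtain ⟨l, hl⟩ : ∃ l, l = 2 * c + Nat.log 2 n + 1 := ⟨_, rfl⟩
  have hlt : n < 2 ^ (Nat.log 2 n + 1) := Nat.lt_pow_succ_log_self (by norm_num) n
  have hN : n * (2 * c) ≤ 2 ^ l := by
    rw [hl, Nat.add_assoc, pow_add, Nat.mul_comm]
    exact Nat.mul_le_mul Nat.lt_two_pow_self.le hlt.le
  have hlog : Nat.log 2 n ≤ n := Nat.log_le_self 2 n
  have hW : 16 * ((n * (2 * c) + 1) * (l + 3)) < (n + 2) ^ (a + 2) := word_bound (by omega) ha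
  obtain ⟨t, s, he, ht, hs⟩ := buildProg_spec hc hn P hN (by omega) hW
  have hn0 : (0 : ℝ) ≤ n := Nat.cast_nonneg n
  have hlog0 : 0 ≤ Real.log ((n : ℝ) + 1) := Real.log_nonneg (by linarith)
  have hl3 : ((l + 3 : ℕ) : ℝ) ≤ (j₁ : ℕ) * Real.log (n + 1) := by
    rw [hj₁]
    refine le_log_of_le hn ?_
    rw [Nat.mul_add, mul_one]
    have := Nat.le_mul_of_pos_left (Nat.log 2 n) (by omega : 0 < 2 * c + 4)
    omega
  have hl6 : ((l + 3 + 3 : ℕ) : ℝ) ≤ (j₂ : ℕ) * Real.log (n + 1) := by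
    rw [hj₂]
    refine le_log_of_le hn ?_
    rw [Nat.mul_add, mul_one]
    have := Nat.le_mul_of_pos_left (Nat.log 2 n) (by omega : 0 < 2 * c + 7)
    omega
  refine ⟨t, s, m * n, he, ?_, ?_, fun I => ?_⟩
  · have h1 : t ≤ 2 * C₁ * (n * (l + 3)) := by
      refine (ht.trans (hC₁ n l)).trans ?_
      rw [Nat.mul_comm 2, Nat.mul_assoc]
      refine Nat.mul_le_mul_left _ ?_
      rw [← Nat.mul_assoc]
      exact Nat.mul_le_mul_right _ (by omega)
    refine ((Nat.cast_le (α := ℝ)).2 h1).trans ((cast_mul_le hn0 hl3 rfl).trans ?_)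
    exact mul_le_mul_of_nonneg_right (Nat.cast_le.2 (by omega)) (mul_nonneg hn0 hlog0)
  · rw [← Nat.mul_assoc, Nat.cast_mul]
    exact mul_le_mul_of_nonneg_right (Nat.cast_le.2 (by omega)) hn0
  -- The common list can be six times as long as the table of pieces, and `6 < 2 ^ 3`.
  · have hk : 6 * (n * (2 * c)) < 2 ^ (l + 3) := by
      rw [pow_add]
      have := Nat.two_pow_pos l
      omega
    have hlen : 6 * (n * (2 * c)) + 3 ≤ m * n := by
      have : m * n = 6 * (n * (2 * c)) + 3 * n := by rw [hm]; ring
      omega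
    obtain ⟨t', s', he', ht', hs'⟩ := query_of_prepared hs hn I hk (by omega) hlen hW
    refine ⟨t', s', he', ?_, hs'⟩
    -- The query cost depends on the level only, so the first argument of its bound may be taken to
    -- be `0`.
    have h1 : t' ≤ C₂ * (1 * (l + 3 + 3)) := by
      have := ht'.trans (hC₂ 0 (l + 3))
      simpa using this
    refine ((Nat.cast_le (α := ℝ)).2 h1).trans
      ((cast_mul_le zero_le_one hl6 Nat.cast_one).trans ?_)
    rw [one_mul]
    exact mul_le_mul_of_nonneg_right (Nat.cast_le.2 (by omega)) hlog0
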